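/- Let $k$ be a commutative ring; all DG categories below are small DG $k$-categories. For a DG category $\mathcal A$ let $\mathrm{Ho}^{\cdot}(\mathcal A)$ be the graded homotopy category (same objects, the morphisms of degree $n$ from $X$ to $Y$ are $H^n\mathrm{Hom}(X,Y)$), $\mathrm{Ho}(\mathcal A)$ its degree $0$ part, $\mathcal A^{\mathrm{pretr}}$ the DG category of one-sided twisted complexes over $\mathcal A$, $\mathcal A^{\mathrm{tr}}$ the triangulated category given by its homotopy category, and $D(\mathcal A)$ the derived category of right DG $\mathcal A$-modules, i.e. the Verdier quotient of the homotopy category of right DG $\mathcal A$-modules by the acyclic ones, viewed as a graded category through $\mathrm{Ext}^n(M,N)=\mathrm{Hom}(M,N[n])$. The Yoneda embedding $X\mapsto h_X=\mathrm{Hom}(-,X)$ gives a functor $\mathrm{Ho}^{\cdot}(\mathcal A)\to D(\mathcal A)$. Let $\mathcal A,\mathcal C$ be DG categories, let $\mathcal B\subset\mathcal A$ be a full DG subcategory, and let $\xi:\mathcal A\to\mathcal C$ be a DG functor which is a DG quotient of $\mathcal A$ modulo $\mathcal B$: the functor $\mathrm{Ho}(\mathcal A)\to\mathrm{Ho}(\mathcal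 C)$ is essentially surjective, and the functor $\mathcal A^{\mathrm{tr}}\to\mathcal C^{\mathrm{tr}}$ induces an equivalence $\mathcal A^{\mathrm{tr}}/\mathcal B^{\mathrm{tr}}\to\mathcal C^{\mathrm{tr}}$ from the Verdier quotient. Let $\xi^*:D(\mathcal C)\to D(\mathcal A)$ be the restriction functor along $\xi$. Then: (a) The composite $\mathrm{Ho}^{\cdot}(\mathcal C)\to D(\mathcal C)\to D(\mathcal A)$ of the Yoneda functor and $\xi^*$ is fully faithful, i.e. for all $c,c'\in\mathcal C$ and $n\in\mathbb Z$ the map $H^n\mathrm{Hom}_{\mathcal C}(c,c')\to\mathrm{Ext}^n_{D(\mathcal A)}(\xi^*h_c,\xi^*h_{c'})$ is bijective. (b) The restriction functor $\mathrm{Res}:D(\mathcal A)\to D(\mathcal B)$ along $\mathcal B\hookrightarrow\mathcal A$ has a left adjoint $L\mathrm{Ind}$ (the derived induction functor), and an object of $D(\mathcal A)$ is isomorphic to $\xi^*h_c$ for some $c\in\mathcal C$ if and only if it is isomorphic to $\mathrm{Cone}(L\mathrm{Ind}\,\mathrm{Res}\,h_a\to h_a)$ for some $a\in\mathcal A$,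 where the morphism is the counit of the adjunction. -/

import Mathlib

open CategoryTheory

universe w u v u₁ v₁ u₂ v₂ u₃ v₃

set_option linter.checkUnivs false in
/-- A differential graded `k`-category. `Hom X Y n` is the degree `n` part of the Hom complex,
`comp h g f` is the composite `g ∘ f` (first `f`, then `g`), and indices are carried along with
proofs of equalities between degrees. -/
structure DGCat (k : Type w) [CommRing k] where
  Obj : Type u
  Hom : Obj → Obj → ℤ → Type v
  [addCommGroup : ∀ X Y n, AddCommGroup (Hom X Y n)]
  [module : ∀ X Y n, Module k (Hom X Y n)]
  d : ∀ {X Y : Obj} {n m : ℤ}, n + 1 = m → (Hom X Y n →ₗ[k] Hom X Y m)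
  one : ∀ X : Obj, Hom X X 0
  comp : ∀ {X Y Z : Obj} {q p n : ℤ}, q + p = n →
    (Hom Y Z q →ₗ[k] Hom X Y p →ₗ[k] Hom X Z n)
  d_d : ∀ {X Y : Obj} {n m l : ℤ} (h : n + 1 = m) (h' : m + 1 = l) (f : Hom X Y n),
    d h' (d h f) = 0
  one_comp : ∀ {X Y : Obj} {n : ℤ} (f : Hom X Y n), comp (zero_add n) (one Y) f = f
  comp_one : ∀ {X Y : Obj} {n : ℤ} (f : Hom X Y n), comp (add_zero n) f (one X) = f
  assoc : ∀ {W X Y Z : Obj} {r q p rq qp n : ℤ} (h₁ : r + q = rq) (h₂ : rq + p = n)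
    (h₃ : q + p = qp) (h₄ : r + qp = n) (e : Hom Y Z r) (g : Hom X Y q) (f : Hom W X p),
    comp h₂ (comp h₁ e g) f = comp h₄ e (comp h₃ g f)
  leibniz : ∀ {X Y Z : Obj} {q p n q' p' n' : ℤ} (h : q + p = n) (hn : n + 1 = n')
    (hq : q + 1 = q') (hp : p + 1 = p') (h₁ : q' + p = n') (h₂ : q + p' = n')
    (g : Hom Y Z q) (f : Hom X Y p),
    d hn (comp h g f) = comp h₁ (d hq g) f + q.negOnePow • comp h₂ g (d hp f)

attribute [instance] DGCat.addCommGroup DGCat.module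

/-- A DG functor. -/
structure DGFunctor {k : Type w} [CommRing k] (A : DGCat.{w, u₁, v₁} k)
    (C : DGCat.{w, u₂, v₂} k) where
  obj : A.Obj → C.Obj
  map : ∀ {X Y : A.Obj} {n : ℤ}, A.Hom X Y n →ₗ[k] C.Hom (obj X) (obj Y) n
  map_one : ∀ X : A.Obj, map (A.one X) = C.one (obj X)
  map_comp : ∀ {X Y Z : A.Obj} {q p n : ℤ} (h : q + p = n) (g : A.Hom Y Z q) (f : A.Hom X Y p),
    map (A.comp h g f) = C.comp h (map g) (map f)
  map_d : ∀ {X Y : A.Obj} {n m : ℤ} (h : n + 1 = m) (f : A.Hom X Y n),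
    map (A.d h f) = C.d h (map f)

namespace DGCat

section Basic

variable {k : Type w} [CommRing k] (A : DGCat.{w, u, v} k)

theorem d_one {X : A.Obj} {m : ℤ} (h : 0 + 1 = m) : A.d h (A.one X) = 0 := by
  subst h
  have h1 := A.leibniz (zero_add 0) rfl rfl rfl (by norm_num) (by norm_num) (A.one X) (A.one X)
  have h2 : A.comp (by norm_num : (0 : ℤ) + (0 + 1) = 0 + 1) (A.one X)
      (A.d (rfl : (0 : ℤ) + 1 = 0 + 1) (A.one X)) = A.d rfl (A.one X) := A.one_comp _
  have h3 : A.comp (by norm_num : ((0 : ℤ) + 1) + 0 = 0 + 1)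
      (A.d (rfl : (0 : ℤ) + 1 = 0 + 1) (A.one X)) (A.one X) = A.d rfl (A.one X) := A.comp_one _
  rw [A.one_comp, h2, h3, Int.negOnePow_zero, one_smul] at h1
  exact left_eq_add.mp h1

/-! ### Graded homotopy category -/

/-- Closed morphisms of degree `n`. -/
def cocycles (X Y : A.Obj) (n : ℤ) : Submodule k (A.Hom X Y n) :=
  LinearMap.ker (A.d (rfl : n + 1 = n + 1))

/-- Exact morphisms of degree `n`. -/
def coboundaries (X Y : A.Obj) (n : ℤ) : Submodule k (A.Hom X Y n) :=
  LinearMap.range (A.d (sub_add_cancel n 1) : A.Hom X Y (n - 1) →ₗ[k] A.Hom X Y n)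

/-- The degree `n` morphisms of the graded homotopy category: the `n`-th cohomology of the
Hom complex. -/
abbrev H (X Y : A.Obj) (n : ℤ) : Type v :=
  A.cocycles X Y n ⧸ (A.coboundaries X Y n).submoduleOf (A.cocycles X Y n)

variable {A}

theorem mem_cocycles {X Y : A.Obj} {n m : ℤ} (h : n + 1 = m) {f : A.Hom X Y n} :
    f ∈ A.cocycles X Y n ↔ A.d h f = 0 := by
  subst h
  exact LinearMap.mem_ker

theorem mem_coboundaries {X Y : A.Obj} {n m : ℤ} (h : m + 1 = n) {f : A.Hom X Y n} :
    f ∈ A.coboundaries X Y n ↔ ∃ g : A.Hom X Y m, A.d h g = f := by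
  obtain rfl : m = n - 1 := by omega
  exact LinearMap.mem_range

/-- The class of a closed morphism. -/
def cls {X Y : A.Obj} {n : ℤ} (f : A.cocycles X Y n) : A.H X Y n := Submodule.Quotient.mk f

theorem cls_eq_iff {X Y : A.Obj} {n : ℤ} (f g : A.cocycles X Y n) :
    cls f = cls g ↔ (f : A.Hom X Y n) - g ∈ A.coboundaries X Y n :=
  Submodule.Quotient.eq _

theorem comp_mem_cocycles {X Y Z : A.Obj} {q p n : ℤ} (h : q + p = n) {g : A.Hom Y Z q}
    {f : A.Hom X Y p} (hg : g ∈ A.cocycles Y Z q) (hf : f ∈ A.cocycles X Y p) :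
    A.comp h g f ∈ A.cocycles X Z n := by
  rw [mem_cocycles rfl] at hg hf ⊢
  rw [A.leibniz h rfl rfl rfl (by omega) (by omega), hg, hf]
  simp

theorem one_mem_cocycles (X : A.Obj) : A.one X ∈ A.cocycles X X 0 := by
  rw [mem_cocycles rfl]
  exact A.d_one rfl

/-- Composition of closed morphisms. -/
def zcomp {X Y Z : A.Obj} {q p n : ℤ} (h : q + p = n) (g : A.cocycles Y Z q)
    (f : A.cocycles X Y p) : A.cocycles X Z n :=
  ⟨A.comp h g.1 f.1, comp_mem_cocycles h g.2 f.2⟩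

/-- Composition in the graded homotopy category. -/
def hcomp {X Y Z : A.Obj} {q p n : ℤ} (h : q + p = n) : A.H Y Z q → A.H X Y p → A.H X Z n :=
  Quotient.map₂ (zcomp h) (by
    intro g g' hg f f' hf
    rw [← Quotient.eq_iff_equiv] at hg hf ⊢
    have hg := (cls_eq_iff _ _).1 hg
    have hf := (cls_eq_iff _ _).1 hf
    refine (cls_eq_iff _ _).2 ?_
    obtain ⟨a, ha⟩ := (mem_coboundaries (sub_add_cancel q 1)).1 hg
    obtain ⟨b, hb⟩ := (mem_coboundaries (sub_add_cancel p 1)).1 hf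
    have e1 := A.leibniz (by omega : (q - 1) + p = n - 1) (sub_add_cancel n 1)
      (sub_add_cancel q 1) rfl h (by omega : q - 1 + (p + 1) = n) a (f : A.Hom X Y p)
    have e2 := A.leibniz (by omega : q + (p - 1) = n - 1) (sub_add_cancel n 1)
      rfl (sub_add_cancel p 1) (by omega : q + 1 + (p - 1) = n) h (g' : A.Hom Y Z q) b
    rw [(mem_cocycles rfl).1 f.2, ha] at e1
    rw [(mem_cocycles rfl).1 g'.2, hb] at e2
    have key : A.comp h g.1 f.1 - A.comp h g'.1 f'.1 =
        A.comp h (g.1 - g'.1) f.1 + A.comp h g'.1 (f.1 - f'.1) := by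
      simp
    refine (mem_coboundaries (sub_add_cancel n 1)).2
      ⟨A.comp (by omega) a (f : A.Hom X Y p) +
        q.negOnePow • A.comp (by omega) (g' : A.Hom Y Z q) b, ?_⟩
    rw [map_add, e1, LinearMap.map_smul_of_tower, e2]
    simp only [zcomp, key, map_zero, smul_zero, add_zero, LinearMap.zero_apply, zero_add,
      smul_smul, Int.units_mul_self, one_smul])

theorem hcomp_cls {X Y Z : A.Obj} {q p n : ℤ} (h : q + p = n) (g : A.cocycles Y Z q)
    (f : A.cocycles X Y p) : hcomp h (cls g) (cls f) = cls (zcomp h g f) := rfl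

theorem cls_surjective {X Y : A.Obj} {n : ℤ} (x : A.H X Y n) : ∃ f, cls f = x :=
  Submodule.Quotient.mk_surjective _ x

variable (A)

/-- The homotopy category: same objects, morphisms are the degree `0` cohomology of the Hom
complexes. -/
structure Ho where
  as : A.Obj

instance : Category (Ho A) where
  Hom X Y := A.H X.as Y.as 0
  id X := cls ⟨A.one X.as, one_mem_cocycles _⟩
  comp f g := hcomp (zero_add 0) g f
  id_comp f := by
    obtain ⟨f, rfl⟩ := cls_surjective f
    exact congrArg cls (Subtype.ext (A.comp_one f.1))
  comp_id f := by
    obtain ⟨f, rfl⟩ := cls_surjective f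
    exact congrArg cls (Subtype.ext (A.one_comp f.1))
  assoc f g h := by
    obtain ⟨f, rfl⟩ := cls_surjective f
    obtain ⟨g, rfl⟩ := cls_surjective g
    obtain ⟨h, rfl⟩ := cls_surjective h
    exact congrArg cls (Subtype.ext (A.assoc _ _ _ _ h.1 g.1 f.1).symm)

variable {A}

/-- The morphism of the homotopy category given by a closed morphism of degree `0`. -/
def homMk {X Y : A.Obj} (f : A.cocycles X Y 0) : (Ho.mk X : Ho A) ⟶ Ho.mk Y := cls f

variable (A)

/-- The full DG subcategory on a set of objects. -/
def full (B : Set A.Obj) : DGCat.{w, u, v} k where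
  Obj := B
  Hom X Y n := A.Hom X Y n
  d h := A.d h
  one X := A.one X
  comp h := A.comp h
  d_d := A.d_d
  one_comp := A.one_comp
  comp_one := A.comp_one
  assoc := A.assoc
  leibniz := A.leibniz

/-- The inclusion of a full DG subcategory. -/
def incl (B : Set A.Obj) : DGFunctor (A.full B) A where
  obj X := X.1
  map := LinearMap.id
  map_one _ := rfl
  map_comp _ _ _ := rfl
  map_d _ _ := rfl

end Basic

end DGCat

namespace DGFunctor

open DGCat

variable {k : Type w} [CommRing k] {A : DGCat.{w, u₁, v₁} k} {C : DGCat.{w, u₂, v₂} k}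
  (F : DGFunctor A C)

theorem map_mem_cocycles {X Y : A.Obj} {n : ℤ} {f : A.Hom X Y n} (hf : f ∈ A.cocycles X Y n) :
    F.map f ∈ C.cocycles (F.obj X) (F.obj Y) n := by
  rw [mem_cocycles rfl] at hf ⊢
  rw [← F.map_d, hf, map_zero]

/-- The action on closed morphisms. -/
def zmap {X Y : A.Obj} {n : ℤ} (f : A.cocycles X Y n) : C.cocycles (F.obj X) (F.obj Y) n :=
  ⟨F.map f, F.map_mem_cocycles f.2⟩

/-- The functor between graded homotopy categories, on morphisms of degree `n`. -/
def hmap {X Y : A.Obj} {n : ℤ} : A.H X Y n → C.H (F.obj X) (F.obj Y) n :=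
  Quotient.map F.zmap (by
    intro f f' hf
    rw [← Quotient.eq_iff_equiv] at hf ⊢
    refine (cls_eq_iff _ _).2 ?_
    obtain ⟨a, ha⟩ := (mem_coboundaries (sub_add_cancel n 1)).1 ((cls_eq_iff _ _).1 hf)
    refine (mem_coboundaries (sub_add_cancel n 1)).2 ⟨F.map a, ?_⟩
    rw [← F.map_d, ha, map_sub]
    rfl)

theorem hmap_cls {X Y : A.Obj} {n : ℤ} (f : A.cocycles X Y n) :
    F.hmap (cls f) = cls (F.zmap f) := rfl

/-- The functor induced on homotopy categories. -/
def ho : Ho A ⥤ Ho C where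
  obj X := ⟨F.obj X.as⟩
  map f := F.hmap f
  map_id X := congrArg cls (Subtype.ext (F.map_one X.as))
  map_comp f g := by
    obtain ⟨f, rfl⟩ := cls_surjective f
    obtain ⟨g, rfl⟩ := cls_surjective g
    exact congrArg cls (Subtype.ext (F.map_comp _ _ _))

end DGFunctor

/-! ### One-sided twisted complexes -/

namespace DGCat

section Pretr

variable {k : Type w} [CommRing k]

/-- A formal finite direct sum of formal shifts `⨁ i, obj i [deg i]`. -/
structure FormalSum (A : DGCat.{w, u, v} k) where
  n : ℕ
  obj : Fin n → A.Obj
  deg : Fin n → ℤ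

/-- Matrices of degree `l`: the entry from `X j [r j]` to `Y i [s i]` is a morphism of degree
`l + s i - r j`. -/
abbrev FormalSum.Mat {A : DGCat.{w, u, v} k} (X Y : FormalSum A) (l : ℤ) : Type v :=
  ∀ (i : Fin Y.n) (j : Fin X.n), A.Hom (X.obj j) (Y.obj i) (l + Y.deg i - X.deg j)

/-- The identity, as a morphism between equal objects, of a degree equal to `0`. -/
def eqHom (A : DGCat.{w, u, v} k) {X Y : A.Obj} (h : X = Y) {n : ℤ} (hn : n = 0) :
    A.Hom X Y n := by
  subst h
  subst hn
  exact A.one X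

theorem eqHom_comp (A : DGCat.{w, u, v} k) {X Y : A.Obj} {q n : ℤ} (hq : q = 0) (h : q + n = n)
    (f : A.Hom X Y n) : A.comp h (A.eqHom rfl hq) f = f := by
  subst hq
  exact A.one_comp f

theorem comp_eqHom (A : DGCat.{w, u, v} k) {X Y : A.Obj} {p n : ℤ} (hp : p = 0) (h : n + p = n)
    (f : A.Hom X Y n) : A.comp h f (A.eqHom rfl hp) = f := by
  subst hp
  exact A.comp_one f

theorem smul_apply₂ {M N P : Type*} [AddCommGroup M] [AddCommGroup N]
    [AddCommGroup P] [Module k M] [Module k N] [Module k P] (f : M →ₗ[k] N →ₗ[k] P) (x : M)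
    (y : N) (a : ℤˣ) : f (a • x) y = a • f x y := by
  rw [LinearMap.map_smul_of_tower, LinearMap.smul_apply]

theorem apply_smul₂ {M N P : Type*} [AddCommGroup M] [AddCommGroup N]
    [AddCommGroup P] [Module k M] [Module k N] [Module k P] (f : M →ₗ[k] N →ₗ[k] P) (x : M)
    (y : N) (a : ℤˣ) : f x (a • y) = a • f x y := by
  rw [LinearMap.map_smul_of_tower]

/-- The DG category of formal finite direct sums of shifts. Composition is multiplication of
matrices, and the differential is applied entrywise, with the sign of the differential of a shifted
complex. -/
def formalSums (A : DGCat.{w, u, v} k) : DGCat.{w, u, v} k where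
  Obj := FormalSum A
  Hom X Y l := X.Mat Y l
  d {X Y l m} h :=
    { toFun := fun f i j => (Y.deg i).negOnePow • A.d (by omega) (f i j)
      map_add' := fun f g => by
        funext i j
        simp [smul_add]
      map_smul' := fun a f => by
        funext i j
        simp [smul_comm _ a] }
  one X := fun i j =>
    if h : j = i then A.eqHom (congrArg X.obj h) (by rw [h]; omega) else 0
  comp {X Y Z q p n} h :=
    LinearMap.mk₂ k
      (fun g f i j => ∑ l : Fin Y.n, A.comp (by omega) (g i l) (f l j))
      (fun g g' f => by
        funext i j
        simp [Finset.sum_add_distrib])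
      (fun a g f => by
        funext i j
        simp [Finset.smul_sum])
      (fun g f f' => by
        funext i j
        simp [Finset.sum_add_distrib])
      (fun a g f => by
        funext i j
        simp [Finset.smul_sum])
  d_d h h' f := by
    funext i j
    simp [A.d_d]
  one_comp {X Y n} f := by
    funext i j
    simp only [LinearMap.mk₂_apply]
    rw [Finset.sum_eq_single i]
    · rw [dif_pos rfl]
      exact A.eqHom_comp _ _ _
    · intro l _ hl
      rw [dif_neg hl]
      simp
    · simp
  comp_one {X Y n} f := by
    funext i j
    simp only [LinearMap.mk₂_apply]
    rw [Finset.sum_eq_single j]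
    · rw [dif_pos rfl]
      exact A.comp_eqHom _ _ _
    · intro l _ hl
      rw [dif_neg (Ne.symm hl)]
      simp
    · simp
  assoc {W X Y Z r q p rq qp n} h₁ h₂ h₃ h₄ e g f := by
    funext i j
    simp only [LinearMap.mk₂_apply, map_sum, LinearMap.sum_apply]
    rw [Finset.sum_comm]
    refine Finset.sum_congr rfl fun l _ => Finset.sum_congr rfl fun m _ => ?_
    exact A.assoc _ _ _ _ _ _ _
  leibniz {X Y Z q p n q' p' n'} h hn hq hp h₁ h₂ g f := by
    funext i j
    simp only [LinearMap.mk₂_apply, LinearMap.coe_mk, AddHom.coe_mk, map_sum, Finset.smul_sum,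
      Pi.add_apply, Pi.smul_apply, ← Finset.sum_add_distrib]
    refine Finset.sum_congr rfl fun l _ => ?_
    rw [A.leibniz (by omega : (q + Z.deg i - Y.deg l) + (p + Y.deg l - X.deg j) =
      n + Z.deg i - X.deg j) (by omega) (q' := q' + Z.deg i - Y.deg l)
      (p' := p' + Y.deg l - X.deg j) (by omega) (by omega) (by omega) (by omega),
      smul_apply₂, apply_smul₂, smul_add, smul_smul, smul_smul]
    congr 2
    rw [← Int.negOnePow_add, ← Int.negOnePow_add, Int.negOnePow_eq_iff]
    exact ⟨Z.deg i - Y.deg l, by ring⟩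

/-- An object with a twisting morphism: `q` of degree `1` with `dq + q² = 0`. -/
structure TwistedObj (E : DGCat.{w, u, v} k) where
  X : E.Obj
  q : E.Hom X X 1
  maurerCartan : E.d (by norm_num : (1 : ℤ) + 1 = 2) q + E.comp (by norm_num) q q = 0

/-- The DG category of objects with a twisting morphism: the differential of `f` of degree `l` is
`df + q' f - (-1)^l f q`. -/
def twist (E : DGCat.{w, u, v} k) : DGCat.{w, max u v, v} k where
  Obj := TwistedObj E
  Hom X Y l := E.Hom X.X Y.X l
  d {X Y l m} h := E.d h + E.comp (by omega) Y.q
    - l.negOnePow • (E.comp (by omega : l + 1 = m)).flip X.q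
  one X := E.one X.X
  comp h := E.comp h
  d_d {X Y n m l} h h' f := by
    subst h
    obtain rfl : l = n + 2 := by omega
    have hX := X.maurerCartan
    have hY := Y.maurerCartan
    rw [add_eq_zero_iff_eq_neg] at hX hY
    simp only [LinearMap.sub_apply, LinearMap.add_apply, LinearMap.smul_apply,
      LinearMap.flip_apply, map_add, map_sub, E.d_d, LinearMap.map_smul_of_tower]
    rw [E.leibniz (by omega : (1 : ℤ) + n = n + 1) (by omega) (rfl : (1 : ℤ) + 1 = 2) rfl
      (by omega : (2 : ℤ) + n = n + 2) (by omega : (1 : ℤ) + (n + 1) = n + 2) Y.q f,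
      E.leibniz (rfl : n + 1 = n + 1) (by omega) rfl (rfl : (1 : ℤ) + 1 = 2)
      (by omega : n + 1 + 1 = n + 2) rfl f X.q, hX, hY,
      E.assoc (by omega : (1 : ℤ) + n = n + 1) (by omega : (n + 1) + 1 = n + 2) rfl
        (by omega) Y.q f X.q,
      ← E.assoc (by omega : (1 : ℤ) + 1 = 2) (by omega : 2 + n = n + 2) (by omega)
        (by omega) Y.q Y.q f,
      E.assoc (by omega : n + 1 = n + 1) (by omega : n + 1 + 1 = n + 2) rfl (by omega) f X.q X.q]
    simp only [Int.negOnePow_succ, Int.negOnePow_one, map_neg, LinearMap.neg_apply, smul_add,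
      smul_neg, smul_smul, neg_mul, Int.units_mul_self, one_smul, Units.neg_smul]
    abel
  one_comp f := E.one_comp f
  comp_one f := E.comp_one f
  assoc := E.assoc
  leibniz {X Y Z q p n q' p' n'} h hn hq hp h₁ h₂ g f := by
    subst hq hp hn h
    simp only [LinearMap.sub_apply, LinearMap.add_apply, LinearMap.smul_apply,
      LinearMap.flip_apply, map_add, map_sub, LinearMap.map_smul_of_tower,
      smul_add, smul_sub, smul_smul]
    rw [E.leibniz rfl rfl rfl rfl h₁ h₂ g f,
      ← E.assoc (by omega : (1 : ℤ) + q = q + 1) h₁ rfl (by omega) Z.q g f,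
      E.assoc rfl h₁ (by omega : (1 : ℤ) + p = p + 1) h₂ g Y.q f,
      E.assoc rfl (by omega : q + p + 1 = q + p + 1) rfl h₂ g f X.q, Int.negOnePow_add]
    abel

/-- The DG category of one-sided twisted complexes `(⨁ i, C i [r i], q)`, with `q i j = 0` for
`i ≥ j`. -/
def pretr (A : DGCat.{w, u, v} k) : DGCat.{w, max u v, v} k :=
  A.formalSums.twist.full {X | ∀ i j : Fin X.X.n, j ≤ i → X.q i j = 0}

/-- Transport of morphisms along an equality of degrees. -/
def castDeg (A : DGCat.{w, u, v} k) {X Y : A.Obj} {n m : ℤ} (h : n = m) :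
    A.Hom X Y n →ₗ[k] A.Hom X Y m := h ▸ LinearMap.id

theorem castDeg_rfl (A : DGCat.{w, u, v} k) {X Y : A.Obj} {n : ℤ} (f : A.Hom X Y n) :
    A.castDeg rfl f = f := rfl

theorem d_castDeg (A : DGCat.{w, u, v} k) {X Y : A.Obj} {n m n' m' : ℤ} (h : n = m)
    (h' : n' = m') (hn : n + 1 = n') (hm : m + 1 = m') (f : A.Hom X Y n) :
    A.d hm (A.castDeg h f) = A.castDeg h' (A.d hn f) := by
  subst h h'
  rfl

theorem comp_castDeg (A : DGCat.{w, u, v} k) {X Y Z : A.Obj} {q p n q' p' n' : ℤ} (hq : q = q')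
    (hp : p = p') (hn : n = n') (h : q + p = n) (h' : q' + p' = n') (g : A.Hom Y Z q)
    (f : A.Hom X Y p) :
    A.comp h' (A.castDeg hq g) (A.castDeg hp f) = A.castDeg hn (A.comp h g f) := by
  subst hq hp hn
  rfl

/-- The matrix `(q_Y, f; 0, -q_X)`, whose rows and columns are indexed by the summands of `Y`
followed by the summands of `X[1]`. -/
def coneMatrix {A : DGCat.{w, u, v} k} {X Y : FormalSum A} (qX : X.Mat X 1) (qY : Y.Mat Y 1)
    (f : X.Mat Y 0) : ∀ a b : Fin Y.n ⊕ Fin X.n,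
    A.Hom (Sum.elim Y.obj X.obj b) (Sum.elim Y.obj X.obj a)
      (1 + Sum.elim Y.deg (fun i => X.deg i + 1) a - Sum.elim Y.deg (fun i => X.deg i + 1) b)
  | .inl i, .inl j => qY i j
  | .inl i, .inr j => A.castDeg (by simp only [Sum.elim_inl, Sum.elim_inr]; omega) (f i j)
  | .inr _, .inl _ => 0
  | .inr i, .inr j => -A.castDeg (by simp only [Sum.elim_inr]; omega) (qX i j)

theorem coneMatrix_eq {A : DGCat.{w, u, v} k} {X Y : FormalSum A} (qX : X.Mat X 1)
    (qY : Y.Mat Y 1) (f : X.Mat Y 0)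
    (hX : ∀ i j, (X.deg i).negOnePow • A.d (by omega) (qX i j) +
      ∑ l, A.comp (by omega) (qX i l) (qX l j) =
        (0 : A.Hom (X.obj j) (X.obj i) (2 + X.deg i - X.deg j)))
    (hY : ∀ i j, (Y.deg i).negOnePow • A.d (by omega) (qY i j) +
      ∑ l, A.comp (by omega) (qY i l) (qY l j) =
        (0 : A.Hom (Y.obj j) (Y.obj i) (2 + Y.deg i - Y.deg j)))
    (hf : ∀ i j, (Y.deg i).negOnePow • A.d (by omega) (f i j) +
      ∑ l, A.comp (by omega) (qY i l) (f l j) - ∑ l, A.comp (by omega) (f i l) (qX l j) =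
        (0 : A.Hom (X.obj j) (Y.obj i) (1 + Y.deg i - X.deg j)))
    (a b : Fin Y.n ⊕ Fin X.n) :
    (Sum.elim Y.deg (fun i => X.deg i + 1) a).negOnePow •
        A.d (by omega) (coneMatrix qX qY f a b) +
      ∑ c, A.comp (by omega) (coneMatrix qX qY f a c) (coneMatrix qX qY f c b) =
    (0 : A.Hom _ _ (2 + Sum.elim Y.deg (fun i => X.deg i + 1) a -
        Sum.elim Y.deg (fun i => X.deg i + 1) b)) := by
  rw [Fintype.sum_sum_type]
  rcases a with i | i <;> rcases b with j | j
  · have e : (Y.deg i).negOnePow • A.d (by omega) (qY i j) +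
        (∑ l, A.comp (by omega) (qY i l) (qY l j) +
          ∑ l : Fin X.n, A.comp (q := 1 + Y.deg i - (X.deg l + 1))
            (p := 1 + (X.deg l + 1) - Y.deg j) (Y := X.obj l) (by omega)
            (A.castDeg (by omega) (f i l)) 0) =
        (0 : A.Hom (Y.obj j) (Y.obj i) (2 + Y.deg i - Y.deg j)) := by
      simp only [map_zero, Finset.sum_const_zero, add_zero]
      exact hY i j
    exact e
  · have h₁ : 1 + Y.deg i - X.deg j = 2 + Y.deg i - (X.deg j + 1) := by omega
    have e : (Y.deg i).negOnePow • A.d (n := 1 + Y.deg i - (X.deg j + 1)) (by omega)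
          (A.castDeg (by omega) (f i j)) +
        (∑ l, A.comp (p := 1 + Y.deg l - (X.deg j + 1)) (by omega) (qY i l)
            (A.castDeg (by omega) (f l j)) +
          ∑ l, A.comp (q := 1 + Y.deg i - (X.deg l + 1)) (p := 1 + (X.deg l + 1) - (X.deg j + 1))
            (by omega) (A.castDeg (by omega) (f i l)) (-A.castDeg (by omega) (qX l j))) =
        (0 : A.Hom (X.obj j) (Y.obj i) (2 + Y.deg i - (X.deg j + 1))) := by
      refine Eq.trans ?_ ((congrArg (A.castDeg h₁) (hf i j)).trans (map_zero (A.castDeg h₁)))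
      rw [map_sub, map_add, LinearMap.map_smul_of_tower, map_sum, map_sum]
      refine Eq.trans ?_ (sub_eq_add_neg _ _).symm
      rw [← Finset.sum_neg_distrib]
      refine Eq.trans ?_ (add_assoc _ _ _).symm
      refine congrArg₂ (· + ·) ?_ (congrArg₂ (· + ·) ?_ ?_)
      · exact congrArg (fun t => (Y.deg i).negOnePow • t)
          (A.d_castDeg _ _ (by omega) _ (f i j))
      · refine Finset.sum_congr rfl fun l _ => ?_
        exact A.comp_castDeg rfl _ _ _ _ (qY i l) (f l j)
      · refine Finset.sum_congr rfl fun l _ => ?_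
        refine (map_neg _ _).trans (congrArg Neg.neg ?_)
        exact A.comp_castDeg _ _ _ _ _ (f i l) (qX l j)
    exact e
  · have e : ((X.deg i + 1).negOnePow • A.d (n := 1 + (X.deg i + 1) - Y.deg j) (by omega) 0 +
        (∑ l, A.comp (Y := Y.obj l) (q := 1 + (X.deg i + 1) - Y.deg l) (by omega) 0 (qY l j) +
          ∑ l, A.comp (q := 1 + (X.deg i + 1) - (X.deg l + 1))
            (p := 1 + (X.deg l + 1) - Y.deg j) (by omega)
            (-A.castDeg (by omega) (qX i l)) 0) :
        A.Hom (Y.obj j) (X.obj i) (2 + (X.deg i + 1) - Y.deg j)) = 0 := by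
      simp only [map_zero, LinearMap.zero_apply, Finset.sum_const_zero, add_zero, smul_zero]
    exact e
  · have h₁ : 2 + X.deg i - X.deg j = 2 + (X.deg i + 1) - (X.deg j + 1) := by omega
    have e : ((X.deg i + 1).negOnePow • A.d (n := 1 + (X.deg i + 1) - (X.deg j + 1)) (by omega)
          (-A.castDeg (by omega) (qX i j)) +
        (∑ l, A.comp (Y := Y.obj l) (q := 1 + (X.deg i + 1) - Y.deg l)
            (p := 1 + Y.deg l - (X.deg j + 1)) (by omega) 0 (A.castDeg (by omega) (f l j)) +
          ∑ l, A.comp (q := 1 + (X.deg i + 1) - (X.deg l + 1))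
            (p := 1 + (X.deg l + 1) - (X.deg j + 1)) (by omega)
            (-A.castDeg (by omega) (qX i l)) (-A.castDeg (by omega) (qX l j))) :
        A.Hom (X.obj j) (X.obj i) (2 + (X.deg i + 1) - (X.deg j + 1))) = 0 := by
      refine Eq.trans ?_ ((congrArg (A.castDeg h₁) (hX i j)).trans (map_zero (A.castDeg h₁)))
      rw [map_add, LinearMap.map_smul_of_tower, map_sum]
      simp only [map_zero, LinearMap.zero_apply, Finset.sum_const_zero, zero_add,
        map_neg, LinearMap.neg_apply, neg_neg, Int.negOnePow_succ, Units.neg_smul,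
        smul_neg]
      refine congrArg₂ (· + ·) ?_ ?_
      · exact congrArg (fun t => (X.deg i).negOnePow • t)
          (A.d_castDeg _ _ (by omega) _ (qX i j))
      · refine Finset.sum_congr rfl fun l _ => ?_
        exact A.comp_castDeg _ _ _ _ _ (qX i l) (qX l j)
    exact e

theorem coneMatrix_zero {A : DGCat.{w, u, v} k} {X Y : FormalSum A} (qX : X.Mat X 1)
    (qY : Y.Mat Y 1) (f : X.Mat Y 0) (hX : ∀ i j, j ≤ i → qX i j = 0)
    (hY : ∀ i j, j ≤ i → qY i j = 0) (a b : Fin Y.n ⊕ Fin X.n)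
    (hab : finSumFinEquiv b ≤ finSumFinEquiv a) : coneMatrix qX qY f a b = 0 := by
  rw [Fin.le_def] at hab
  rcases a with i | i <;> rcases b with j | j <;>
    simp only [finSumFinEquiv_apply_left, finSumFinEquiv_apply_right,
      Fin.val_natAdd, Fin.val_castAdd] at hab
  · exact hY i j (Fin.le_def.2 (by omega))
  · omega
  · rfl
  · have h : A.castDeg (by omega : 1 + X.deg i - X.deg j = 1 + (X.deg i + 1) - (X.deg j + 1))
        (qX i j) = 0 := by rw [hX i j (Fin.le_def.2 (by omega)), map_zero]
    exact (congrArg Neg.neg h).trans neg_zero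

/-- The formal direct sum `Y ⊕ X[1]`. -/
def coneSum {A : DGCat.{w, u, v} k} (X Y : FormalSum A) : FormalSum A where
  n := Y.n + X.n
  obj i := Sum.elim Y.obj X.obj (finSumFinEquiv.symm i)
  deg i := Sum.elim Y.deg (fun j => X.deg j + 1) (finSumFinEquiv.symm i)

theorem twist_d_zero {A : DGCat.{w, u, v} k} {X Y : A.pretr.Obj} (f : A.pretr.cocycles X Y 0)
    (i : Fin Y.1.X.n) (j : Fin X.1.X.n) :
    (Y.1.X.deg i).negOnePow • A.d (by omega) (f.1 i j) +
      ∑ l, A.comp (by omega) (Y.1.q i l) (f.1 l j) -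
      ∑ l, A.comp (by omega) (f.1 i l) (X.1.q l j) =
        (0 : A.Hom (X.1.X.obj j) (Y.1.X.obj i) (1 + Y.1.X.deg i - X.1.X.deg j)) := by
  have h := congrFun₂ ((mem_cocycles (zero_add 1)).1 f.2) i j
  refine Eq.trans (congrArg (HSub.hSub _) ?_) h
  exact (one_smul ℤˣ _).symm.trans (congrArg (· • _) Int.negOnePow_zero.symm)

/-- The cone `(Y ⊕ X[1], (q_Y, f; 0, -q_X))` of a closed morphism of degree `0` between one-sided
twisted complexes. -/
def pretrCone {A : DGCat.{w, u, v} k} {X Y : A.pretr.Obj} (f : A.pretr.cocycles X Y 0) :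
    A.pretr.Obj where
  val :=
    { X := coneSum X.1.X Y.1.X
      q := fun i j =>
        coneMatrix X.1.q Y.1.q f.1 (finSumFinEquiv.symm i) (finSumFinEquiv.symm j)
      maurerCartan := by
        funext i j
        have h := coneMatrix_eq X.1.q Y.1.q f.1 (congrFun₂ X.1.maurerCartan)
          (congrFun₂ Y.1.maurerCartan) (twist_d_zero f) (finSumFinEquiv.symm i) (finSumFinEquiv.symm j)
        rw [← Equiv.sum_comp (finSumFinEquiv (m := Y.1.X.n) (n := X.1.X.n)).symm] at h
        exact h }
  property i j hij := coneMatrix_zero _ _ _ X.2 Y.2 _ _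
    (((Equiv.apply_symm_apply _ j).trans_le hij).trans_eq (Equiv.apply_symm_apply _ i).symm)

end Pretr

end DGCat

namespace DGFunctor

open DGCat

variable {k : Type w} [CommRing k] {A : DGCat.{w, u₁, v₁} k} {C : DGCat.{w, u₂, v₂} k}

theorem map_eqHom (F : DGFunctor A C) {X Y : A.Obj} (h : X = Y) {n : ℤ} (hn : n = 0) :
    F.map (A.eqHom h hn) = C.eqHom (congrArg F.obj h) hn := by
  subst h
  subst hn
  exact F.map_one X

theorem map_units_smul (F : DGFunctor A C) {X Y : A.Obj} {n : ℤ} (a : ℤˣ) (f : A.Hom X Y n) :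
    F.map (a • f) = a • F.map f := LinearMap.map_smul_of_tower _ _ _

theorem map_entry_one (F : DGFunctor A C) (X : FormalSum A) (i j : Fin X.n) :
    F.map (if h : j = i then A.eqHom (congrArg X.obj h) (by rw [h]; omega) else 0 :
      A.Hom (X.obj j) (X.obj i) (0 + X.deg i - X.deg j)) =
    if h : j = i then C.eqHom (congrArg (fun l => F.obj (X.obj l)) h) (by rw [h]; omega) else 0 := by
  split_ifs with h
  · exact F.map_eqHom _ _
  · exact map_zero _

theorem map_entry_comp (F : DGFunctor A C) {X Y Z : FormalSum A} {q p n : ℤ} (h : q + p = n)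
    (g : Y.Mat Z q) (f : X.Mat Y p) (i : Fin Z.n) (j : Fin X.n) :
    F.map (∑ l, A.comp (by omega) (g i l) (f l j) :
      A.Hom (X.obj j) (Z.obj i) (n + Z.deg i - X.deg j)) =
    ∑ l, C.comp (by omega) (F.map (g i l)) (F.map (f l j)) := by
  rw [map_sum]
  exact Finset.sum_congr rfl fun l _ => F.map_comp _ _ _

/-- A DG functor applied to the summands of a formal direct sum. -/
def formalSumsObj (F : DGFunctor A C) (X : A.formalSums.Obj) : C.formalSums.Obj :=
  { n := X.n, obj := fun i => F.obj (X.obj i), deg := X.deg : FormalSum C }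

/-- A DG functor applied to formal finite direct sums of shifts, entry by entry. -/
def formalSums (F : DGFunctor A C) : DGFunctor A.formalSums C.formalSums where
  obj := F.formalSumsObj
  map :=
    { toFun := fun f i j => F.map (f i j)
      map_add' := fun f g => by
        funext i j
        exact map_add _ _ _
      map_smul' := fun a f => by
        funext i j
        exact map_smul _ _ _ }
  map_one X := by
    funext i j
    exact F.map_entry_one X i j
  map_comp h g f := by
    funext i j
    exact F.map_entry_comp h g f i j
  map_d h f := by
    funext i j
    refine (F.map_units_smul _ _).trans (congrArg _ ?_)
    exact F.map_d _ _

/-- A DG functor applied to objects with a twisting morphism. -/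
def twist (F : DGFunctor A C) : DGFunctor A.twist C.twist where
  obj X :=
    { X := F.obj X.X
      q := F.map X.q
      maurerCartan := by
        rw [← F.map_d, ← F.map_comp, ← map_add, X.maurerCartan, map_zero] }
  map := F.map
  map_one X := F.map_one X.X
  map_comp h g f := F.map_comp h g f
  map_d {X Y n m} h f := by
    refine (map_sub F.map _ _).trans (congrArg₂ (· - ·) ?_ ?_)
    · refine (map_add F.map _ _).trans (congrArg₂ (· + ·) ?_ ?_)
      · exact F.map_d _ _
      · exact F.map_comp _ _ _
    · refine (F.map_units_smul _ _).trans (congrArg _ ?_)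
      exact F.map_comp _ _ _

/-- The restriction of a DG functor to full DG subcategories. -/
def full (F : DGFunctor A C) (B : Set A.Obj) (B' : Set C.Obj) (h : ∀ X ∈ B, F.obj X ∈ B') :
    DGFunctor (A.full B) (C.full B') where
  obj X := ⟨F.obj X.1, h X.1 X.2⟩
  map := F.map
  map_one X := F.map_one X.1
  map_comp h g f := F.map_comp h g f
  map_d h f := F.map_d h f

/-- The DG functor induced on one-sided twisted complexes. -/
def pretr (F : DGFunctor A C) : DGFunctor A.pretr C.pretr :=
  F.formalSums.twist.full _ _ fun X hX => by
    intro i j hij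
    exact (congrArg F.map (hX i j hij)).trans (map_zero F.map)

end DGFunctor

/-! ### DG quotients -/

namespace DGCat

variable {k : Type w} [CommRing k] (A : DGCat.{w, u, v} k)

/-- The morphisms of the homotopy category of one-sided twisted complexes over `A` whose cone is
isomorphic to a one-sided twisted complex over the full DG subcategory with set of objects `B`. -/
def quotientMorphisms (B : Set A.Obj) : MorphismProperty (Ho A.pretr) := fun X Y f =>
  ∃ (φ : A.pretr.cocycles X.as Y.as 0) (Z : A.pretr.Obj), homMk φ = f ∧
    (∀ i : Fin Z.1.X.n, Z.1.X.obj i ∈ B) ∧ Nonempty (Ho.mk (pretrCone φ) ≅ Ho.mk Z)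

variable {A} {C : DGCat.{w, u₁, v₁} k}

/-- The DG functor `ξ : A → C` is a DG quotient of `A` modulo its full DG subcategory with set of
objects `B`: it is essentially surjective on homotopy categories, and it exhibits the triangulated
category `C^tr` as the Verdier quotient of `A^tr` by `B^tr`. -/
structure IsDGQuotient (ξ : DGFunctor A C) (B : Set A.Obj) : Prop where
  essSurj : ξ.ho.EssSurj
  isLocalization : ξ.pretr.ho.IsLocalization (A.quotientMorphisms B)

end DGCat

/-! ### DG modules -/

set_option linter.checkUnivs false in
/-- A right DG `A`-module. `M.act h x f` is `x · f`. -/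
structure DGModule {k : Type w} [CommRing k] (A : DGCat.{w, u, v} k) where
  X : A.Obj → ℤ → Type u₁
  [addCommGroup : ∀ a n, AddCommGroup (X a n)]
  [module : ∀ a n, Module k (X a n)]
  d : ∀ {a : A.Obj} {n m : ℤ}, n + 1 = m → (X a n →ₗ[k] X a m)
  act : ∀ {a b : A.Obj} {q p n : ℤ}, q + p = n → (X b q →ₗ[k] A.Hom a b p →ₗ[k] X a n)
  d_d : ∀ {a : A.Obj} {n m l : ℤ} (h : n + 1 = m) (h' : m + 1 = l) (x : X a n),
    d h' (d h x) = 0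
  act_one : ∀ {a : A.Obj} {n : ℤ} (x : X a n), act (add_zero n) x (A.one a) = x
  act_act : ∀ {a b c : A.Obj} {r q p rq qp n : ℤ} (h₁ : r + q = rq) (h₂ : rq + p = n)
    (h₃ : q + p = qp) (h₄ : r + qp = n) (x : X c r) (g : A.Hom b c q) (f : A.Hom a b p),
    act h₂ (act h₁ x g) f = act h₄ x (A.comp h₃ g f)
  leibniz : ∀ {a b : A.Obj} {q p n q' p' n' : ℤ} (h : q + p = n) (hn : n + 1 = n')
    (hq : q + 1 = q') (hp : p + 1 = p') (h₁ : q' + p = n') (h₂ : q + p' = n')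
    (x : X b q) (f : A.Hom a b p),
    d hn (act h x f) = act h₁ (d hq x) f + q.negOnePow • act h₂ x (A.d hp f)

attribute [instance] DGModule.addCommGroup DGModule.module

namespace DGModule

section

variable {k : Type w} [CommRing k] {A : DGCat.{w, u, v} k}

/-- Families of `k`-linear maps of degree `n`. -/
abbrev PreHom (M N : DGModule.{w, u, v, u₁} A) (n : ℤ) : Type max u u₁ :=
  ∀ (a : A.Obj) (i : {i : ℤ × ℤ // i.1 + n = i.2}), M.X a i.1.1 →ₗ[k] N.X a i.1.2

/-- Morphisms of degree `n` (not necessarily closed) of right DG modules: they commute with the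
action of `A`. -/
def homs (M N : DGModule.{w, u, v, u₁} A) (n : ℤ) : Submodule k (PreHom M N n) where
  carrier := {φ | ∀ (a b : A.Obj) (p q r s t : ℤ) (hq : p + n = q) (hs : r + n = s)
    (hr : p + t = r) (hs' : q + t = s) (x : M.X b p) (f : A.Hom a b t),
    φ a ⟨(r, s), hs⟩ (M.act hr x f) = N.act hs' (φ b ⟨(p, q), hq⟩ x) f}
  add_mem' {φ ψ} hφ hψ a b p q r s t hq hs hr hs' x f := by
    have h₁ := hφ a b p q r s t hq hs hr hs' x f
    have h₂ := hψ a b p q r s t hq hs hr hs' x f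
    simp only [Pi.add_apply, LinearMap.add_apply, map_add, h₁, h₂]
  zero_mem' a b p q r s t hq hs hr hs' x f := by
    simp only [Pi.zero_apply, LinearMap.zero_apply, map_zero]
  smul_mem' c {φ} hφ a b p q r s t hq hs hr hs' x f := by
    have h₁ := hφ a b p q r s t hq hs hr hs' x f
    simp only [Pi.smul_apply, LinearMap.smul_apply, map_smul, h₁]

variable {M N P : DGModule.{w, u, v, u₁} A}

/-- The component `M(a)^p → N(a)^q` of a morphism of degree `n`, where `p + n = q`. -/
def app {n : ℤ} (φ : M.homs N n) (a : A.Obj) {p q : ℤ} (h : p + n = q) : M.X a p →ₗ[k] N.X a q :=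
  φ.1 a ⟨(p, q), h⟩

theorem app_act {n : ℤ} (φ : M.homs N n) {a b : A.Obj} {p q r s t : ℤ} (hq : p + n = q)
    (hs : r + n = s) (hr : p + t = r) (hs' : q + t = s) (x : M.X b p) (f : A.Hom a b t) :
    app φ a hs (M.act hr x f) = N.act hs' (app φ b hq x) f :=
  φ.2 a b p q r s t hq hs hr hs' x f

theorem homs_ext {n : ℤ} {φ ψ : M.homs N n}
    (h : ∀ (a : A.Obj) (p q : ℤ) (hq : p + n = q) (x : M.X a p), app φ a hq x = app ψ a hq x) :
    φ = ψ := by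
  apply Subtype.ext
  funext a ⟨⟨p, q⟩, hq⟩
  exact LinearMap.ext (h a p q hq)

/-- A morphism of degree `n` from its components. -/
def mkHom {n : ℤ} (φ : ∀ (a : A.Obj) (p q : ℤ), p + n = q → (M.X a p →ₗ[k] N.X a q))
    (h : ∀ (a b : A.Obj) (p q r s t : ℤ) (hq : p + n = q) (hs : r + n = s)
      (hr : p + t = r) (hs' : q + t = s) (x : M.X b p) (f : A.Hom a b t),
      φ a r s hs (M.act hr x f) = N.act hs' (φ b p q hq x) f) : M.homs N n :=
  ⟨fun a i => φ a i.1.1 i.1.2 i.2, h⟩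

theorem app_add {n : ℤ} (φ ψ : M.homs N n) {a : A.Obj} {p q : ℤ} (h : p + n = q) (x : M.X a p) :
    app (φ + ψ) a h x = app φ a h x + app ψ a h x := rfl

theorem app_sub {n : ℤ} (φ ψ : M.homs N n) {a : A.Obj} {p q : ℤ} (h : p + n = q) (x : M.X a p) :
    app (φ - ψ) a h x = app φ a h x - app ψ a h x := rfl

theorem app_zero {n : ℤ} {a : A.Obj} {p q : ℤ} (h : p + n = q) (x : M.X a p) :
    app (0 : M.homs N n) a h x = 0 := rfl

theorem app_smul {n : ℤ} (c : k) (φ : M.homs N n) {a : A.Obj} {p q : ℤ} (h : p + n = q)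
    (x : M.X a p) : app (c • φ) a h x = c • app φ a h x := rfl

theorem app_units_smul {n : ℤ} (c : ℤˣ) (φ : M.homs N n) {a : A.Obj} {p q : ℤ} (h : p + n = q)
    (x : M.X a p) : app (c • φ) a h x = c • app φ a h x := rfl

/-- The differential `d φ - (-1)^n φ d` of a morphism `φ` of degree `n`. -/
def homsD (M N : DGModule.{w, u, v, u₁} A) {n m : ℤ} (h : n + 1 = m) :
    M.homs N n →ₗ[k] M.homs N m where
  toFun φ :=
    mkHom (fun a p q hq => (N.d (by omega)).comp (app φ a (q := q - 1) (by omega)) -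
        n.negOnePow • (app φ a (p := p + 1) (by omega)).comp (M.d rfl)) (by
      intro a b p q r s t hq hs hr hs' x f
      simp only [LinearMap.sub_apply, LinearMap.smul_apply, LinearMap.comp_apply, map_sub]
      rw [app_act φ (q := q - 1) (by omega) (by omega) hr (by omega),
        M.leibniz hr rfl rfl rfl (by omega) (by omega), map_add,
        N.leibniz (q' := q) (p' := t + 1) (by omega) (by omega) (by omega) rfl hs' (by omega),
        app_act φ (q := q) (by omega) (by omega) (by omega) hs',
        LinearMap.map_smul_of_tower, app_act φ (q := q - 1) (by omega) (by omega) (by omega)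
        (by omega), smul_add, smul_smul, ← Int.negOnePow_add, LinearMap.map_smul_of_tower,
        LinearMap.smul_apply, show n + p = q - 1 by omega]
      abel)
  map_add' φ ψ := by
    refine homs_ext fun a p q hq x => ?_
    change N.d _ (app φ a _ x + app ψ a _ x) -
      n.negOnePow • (app φ a _ (M.d _ x) + app ψ a _ (M.d _ x)) =
      (N.d _ (app φ a _ x) - n.negOnePow • app φ a _ (M.d _ x)) +
      (N.d _ (app ψ a _ x) - n.negOnePow • app ψ a _ (M.d _ x))
    rw [map_add, smul_add]
    abel
  map_smul' c φ := by
    refine homs_ext fun a p q hq x => ?_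
    change N.d _ (c • app φ a _ x) - n.negOnePow • c • app φ a _ (M.d _ x) =
      c • (N.d _ (app φ a _ x) - n.negOnePow • app φ a _ (M.d _ x))
    rw [map_smul, smul_sub, smul_comm c]

theorem homsD_apply {n m : ℤ} (h : n + 1 = m) (φ : M.homs N n) {a : A.Obj} {p q p' q' : ℤ}
    (hq : p + m = q) (h₁ : p + n = q') (h₂ : q' + 1 = q) (h₃ : p + 1 = p') (h₄ : p' + n = q)
    (x : M.X a p) :
    app (homsD M N h φ) a hq x =
      N.d h₂ (app φ a h₁ x) - n.negOnePow • app φ a h₄ (M.d h₃ x) := by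
  obtain rfl : q' = q - 1 := by omega
  subst h₃
  rfl

/-- Composition of morphisms of right DG modules. -/
def homsComp {q p n : ℤ} (h : q + p = n) : N.homs P q →ₗ[k] M.homs N p →ₗ[k] M.homs P n :=
  LinearMap.mk₂ k
    (fun ψ φ => mkHom (fun a i j hj =>
        (app ψ a (p := i + p) (by omega)).comp (app φ a rfl)) (by
      intro a b i j r s t hj hs hr hs' x f
      simp only [LinearMap.comp_apply]
      rw [app_act φ (q := i + p) (by omega) (by omega) hr (by omega),
        app_act ψ (q := j) (by omega) (by omega) (by omega) hs']))
    (fun _ _ _ => rfl) (fun _ _ _ => rfl)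
    (fun ψ φ φ' => by
      refine homs_ext fun a i j hj x => ?_
      exact map_add (app ψ a _) _ _)
    (fun c ψ φ => by
      refine homs_ext fun a i j hj x => ?_
      exact map_smul (app ψ a _) _ _)

theorem homsComp_apply {q p n : ℤ} (h : q + p = n) (ψ : N.homs P q) (φ : M.homs N p) {a : A.Obj}
    {i j l : ℤ} (hj : i + n = j) (h₁ : i + p = l) (h₂ : l + q = j) (x : M.X a i) :
    app (homsComp h ψ φ) a hj x = app ψ a h₂ (app φ a h₁ x) := by
  subst h₁
  rfl

/-- Transport of elements along an equality of degrees. -/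
def castDeg (M : DGModule.{w, u, v, u₁} A) {a : A.Obj} {n m : ℤ} (h : n = m) :
    M.X a n →ₗ[k] M.X a m := h ▸ LinearMap.id

/-- The DG category of right DG `A`-modules. -/
def dgCat (A : DGCat.{w, u, v} k) : DGCat.{w, max u v w (u₁ + 1), max u u₁} k where
  Obj := DGModule.{w, u, v, u₁} A
  Hom M N n := M.homs N n
  d h := homsD _ _ h
  one M := mkHom (fun a p q hq => M.castDeg (by omega)) (by
    intro a b p q r s t hq hs hr hs' x f
    obtain rfl : p = q := by omega
    obtain rfl : r = s := by omega
    rfl)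
  comp h := homsComp h
  d_d {M N n m l} h h' φ := by
    refine homs_ext fun a p q hq x => ?_
    rw [homsD_apply h' _ hq (q' := p + m) rfl (by omega) rfl (by omega),
      homsD_apply h _ rfl (q' := p + n) rfl (by omega) rfl (by omega),
      homsD_apply h _ (by omega) (q' := p + m) (by omega) (by omega) rfl (by omega)]
    subst h
    change _ = (0 : N.X a q)
    simp [M.d_d, N.d_d, Int.negOnePow_succ]
  one_comp {M N n} φ := by
    refine homs_ext fun a p q hq x => ?_
    exact homsComp_apply (zero_add n) _ φ hq hq (add_zero q) x
  comp_one {M N n} φ := by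
    refine homs_ext fun a p q hq x => ?_
    exact homsComp_apply (add_zero n) φ _ hq (add_zero p) hq x
  assoc {W M N P r q p rq qp n} h₁ h₂ h₃ h₄ e g f := by
    refine homs_ext fun a i j hj x => ?_
    rw [homsComp_apply h₂ _ _ hj rfl (by omega),
      homsComp_apply h₁ _ _ _ (l := i + qp) (by omega) (by omega),
      homsComp_apply h₄ _ _ hj rfl (by omega),
      homsComp_apply h₃ _ _ _ (l := i + p) (by omega) (by omega)]
  leibniz {M N P q p n q' p' n'} h hn hq hp h₁ h₂ g f := by
    refine homs_ext fun a i j hj x => ?_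
    rw [homsD_apply hn _ hj (q' := i + n) rfl (by omega) rfl (by omega),
      homsComp_apply h _ _ _ (l := i + p) (by omega) (by omega),
      homsComp_apply h _ _ _ (l := i + p') (by omega) (by omega)]
    change _ = app (homsComp h₁ (homsD _ _ hq g) f) a hj x +
      q.negOnePow • app (homsComp h₂ g (homsD _ _ hp f)) a hj x
    rw [homsComp_apply h₁ _ _ _ (l := i + p) (by omega) (by omega),
      homsComp_apply h₂ _ _ _ (l := i + p') (by omega) (by omega),
      homsD_apply hq _ _ (q' := i + n) (by omega) (by omega) (p' := i + p') (by omega) (by omega),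
      homsD_apply hp _ _ (q' := i + p) (by omega) (by omega) rfl (by omega)]
    subst h
    simp [smul_sub, smul_smul, Int.negOnePow_add]

end

end DGModule

namespace DGModule

section

variable {k : Type w} [CommRing k] {A : DGCat.{w, u, v} k} {M N : DGModule.{w, u, v, u₁} A}

theorem d_app {n m : ℤ} (h : n + 1 = m) (φ : (dgCat A).cocycles M N n) {a : A.Obj}
    {p q p' q' : ℤ} (h₁ : p + n = q) (h₂ : q + 1 = q') (h₃ : p + 1 = p') (h₄ : p' + n = q')
    (x : M.X a p) :
    N.d h₂ (app φ.1 a h₁ x) = n.negOnePow • app φ.1 a h₄ (M.d h₃ x) := by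
  have e := homsD_apply h φ.1 (by omega : p + m = q') h₁ h₂ h₃ h₄ x
  have e' : homsD M N h φ.1 = 0 := (DGCat.mem_cocycles (A := dgCat A) h).1 φ.2
  rw [e', app_zero] at e
  exact (sub_eq_zero.1 e.symm)

/-- The cone of a closed morphism of degree `0` between right DG modules: `N ⊕ M[1]`, with
differential `(y, x) ↦ (dy + φ x, -dx)`. -/
def cone (φ : (dgCat A).cocycles M N 0) : DGModule.{w, u, v, u₁} A where
  X a n := N.X a n × M.X a (n + 1)
  d {a n m} h :=
    { toFun := fun z => (N.d h z.1 + app φ.1 a (by omega) z.2, -M.d (by omega) z.2)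
      map_add' := fun z z' => by
        simp only [Prod.fst_add, Prod.snd_add, map_add, neg_add, Prod.mk_add_mk]
        rw [add_add_add_comm]
      map_smul' := fun c z => by
        simp only [Prod.smul_fst, Prod.smul_snd, map_smul, RingHom.id_apply, Prod.smul_mk,
          smul_add, smul_neg] }
  act {a b q p n} h :=
    LinearMap.mk₂ k (fun z f => (N.act h z.1 f, M.act (by omega) z.2 f))
      (fun z z' f => by simp)
      (fun c z f => by simp)
      (fun z f f' => by simp)
      (fun c z f => by simp)
  d_d {a n m l} h h' z := by
    have e := d_app (zero_add 1) φ (a := a) (q := m) (q' := l) (p := n + 1) (p' := m + 1)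
      (by omega) h' (by omega) (by omega) z.2
    rw [Int.negOnePow_zero, one_smul] at e
    simp only [LinearMap.coe_mk, AddHom.coe_mk, map_add, map_neg, N.d_d, M.d_d, e, zero_add,
      neg_zero]
    rw [add_neg_cancel]
    rfl
  act_one z := Prod.ext (N.act_one z.1) (M.act_one z.2)
  act_act h₁ h₂ h₃ h₄ z g f :=
    Prod.ext (N.act_act h₁ h₂ h₃ h₄ z.1 g f)
      (M.act_act (by omega) (by omega) h₃ (by omega) z.2 g f)
  leibniz {a b q p n q' p' n'} h hn hq hp h₁ h₂ z f := by
    refine Prod.ext ?_ ?_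
    · change N.d hn (N.act h z.1 f) + app φ.1 a _ (M.act _ z.2 f) =
        N.act h₁ (N.d hq z.1 + app φ.1 b _ z.2) f + q.negOnePow • N.act h₂ z.1 (A.d hp f)
      rw [N.leibniz h hn hq hp h₁ h₂, app_act φ.1 (q := q') (by omega) (by omega) (by omega) h₁,
        map_add, LinearMap.add_apply]
      abel
    · change -M.d _ (M.act _ z.2 f) = M.act _ (-M.d _ z.2) f +
        q.negOnePow • M.act _ z.2 (A.d hp f)
      rw [M.leibniz (q' := q' + 1) (by omega) (by omega) (by omega) hp (by omega) (by omega),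
        map_neg, LinearMap.neg_apply, Int.negOnePow_succ, Units.neg_smul]
      abel

/-- The shift `M[r]`. -/
def shift (M : DGModule.{w, u, v, u₁} A) (r : ℤ) : DGModule.{w, u, v, u₁} A where
  X a n := M.X a (n + r)
  d h := r.negOnePow • M.d (by omega)
  act h := M.act (by omega)
  d_d h h' x := by
    simp [M.d_d]
  act_one x := M.act_one x
  act_act h₁ h₂ h₃ h₄ x g f := M.act_act (by omega) (by omega) h₃ (by omega) x g f
  leibniz {a b q p n q' p' n'} h hn hq hp h₁ h₂ x f := by
    simp only [LinearMap.smul_apply]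
    rw [M.leibniz (q' := q' + r) (by omega) (by omega) (by omega) hp (by omega) (by omega),
      smul_add, LinearMap.map_smul_of_tower, LinearMap.smul_apply, smul_smul, ← Int.negOnePow_add]
    congr 2
    rw [Int.negOnePow_eq_iff]
    exact ⟨r, by ring⟩

/-- A morphism `M → N` of degree `m`, as a morphism `M → N[r]` of degree `l = m - r`. -/
def shiftHom {m r l : ℤ} (h : l + r = m) (φ : M.homs N m) : M.homs (N.shift r) l :=
  mkHom (fun a p q hq => app φ a (q := q + r) (by omega))
    (fun _ _ _ _ _ _ _ hq hs hr hs' x f =>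
      app_act φ (by omega) (by omega) hr (by omega) x f)

theorem homsD_shiftHom {m r l m' l' : ℤ} (h : l + r = m) (h' : l' + r = m') (hm : m + 1 = m')
    (hl : l + 1 = l') (φ : M.homs N m) :
    homsD M (N.shift r) hl (shiftHom h φ) = r.negOnePow • shiftHom h' (homsD M N hm φ) := by
  refine homs_ext fun a p q hq x => ?_
  rw [homsD_apply hl _ hq (q' := p + l) rfl (by omega) rfl (by omega), app_units_smul]
  have e := homsD_apply hm φ (by omega : p + m' = q + r) (q' := p + l + r) (by omega) (by omega)
    rfl (by omega) x
  refine Eq.trans ?_ (congrArg (fun t => r.negOnePow • t) e.symm)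
  subst h
  refine Eq.trans ?_ (smul_sub r.negOnePow _ _).symm
  refine congrArg₂ (· - ·) rfl ?_
  refine Eq.trans ?_ (smul_smul r.negOnePow (l + r).negOnePow _).symm
  refine congrArg₂ (· • ·) ?_ rfl
  rw [← Int.negOnePow_add, Int.negOnePow_eq_iff]
  exact ⟨-r, by ring⟩

theorem shiftHom_mem {n : ℤ} {φ : M.homs N n} (h : φ ∈ (dgCat A).cocycles M N n) :
    shiftHom (zero_add n) φ ∈ (dgCat A).cocycles M (N.shift n) 0 := by
  have h' : homsD M N rfl φ = 0 := (DGCat.mem_cocycles (A := dgCat A) rfl).1 h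
  refine (DGCat.mem_cocycles (A := dgCat A) rfl).2 ?_
  refine (homsD_shiftHom _ (by omega) rfl rfl φ).trans ?_
  rw [h']
  exact smul_zero _

/-- The identification `H^n Hom(M, N) = H^0 Hom(M, N[n])`. -/
def hShift (M N : DGModule.{w, u, v, u₁} A) (n : ℤ) :
    (dgCat A).H M N n → (dgCat A).H M (N.shift n) 0 :=
  Quotient.map (fun φ => ⟨shiftHom (zero_add n) φ.1, shiftHom_mem φ.2⟩) (by
    intro φ ψ h
    rw [← Quotient.eq_iff_equiv] at h ⊢
    refine (DGCat.cls_eq_iff _ _).2 ?_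
    obtain ⟨β, hβ⟩ := (DGCat.mem_coboundaries (sub_add_cancel n 1)).1
      ((DGCat.cls_eq_iff _ _).1 h)
    let φ' : M.homs N n := φ.1
    let ψ' : M.homs N n := ψ.1
    let β' : M.homs N (n - 1) := β
    have hβ' : homsD M N (sub_add_cancel n 1) β' = φ' - ψ' := hβ
    have e : homsD M (N.shift n) (by norm_num : (-1 : ℤ) + 1 = 0)
        (n.negOnePow • shiftHom (by omega : -1 + n = n - 1) β') =
        shiftHom (zero_add n) (φ' - ψ') := by
      rw [LinearMap.map_smul_of_tower, homsD_shiftHom (by omega : -1 + n = n - 1) (zero_add n)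
        (sub_add_cancel n 1), smul_smul, Int.units_mul_self, one_smul, hβ']
    exact (DGCat.mem_coboundaries (A := dgCat A) (by norm_num : (-1 : ℤ) + 1 = 0)).2 ⟨_, e⟩)

theorem hShift_cls {n : ℤ} (φ : (dgCat A).cocycles M N n) :
    hShift M N n (DGCat.cls φ) =
      DGCat.cls (A := dgCat A) ⟨shiftHom (zero_add n) φ.1, shiftHom_mem φ.2⟩ := rfl

/-- A right DG module is acyclic if all the complexes `M(a)` are exact. -/
def IsAcyclic (M : DGModule.{w, u, v, u₁} A) : Prop :=
  ∀ (a : A.Obj) (l n m : ℤ) (hl : l + 1 = n) (hn : n + 1 = m) (x : M.X a n),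
    M.d hn x = 0 → ∃ y : M.X a l, M.d hl y = x

/-- The right DG module `h_Y = Hom(-, Y)`. -/
def representable (Y : A.Obj) : DGModule.{w, u, v, v} A where
  X a n := A.Hom a Y n
  d h := A.d h
  act h := A.comp h
  d_d := A.d_d
  act_one := A.comp_one
  act_act := A.assoc
  leibniz := A.leibniz

/-- The Yoneda embedding on morphisms: `f` acts by `x ↦ f ∘ x`. -/
def yonedaMap (X Y : A.Obj) (n : ℤ) :
    A.Hom X Y n →ₗ[k] (representable X).homs (representable Y) n where
  toFun f := mkHom (M := representable X) (N := representable Y)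
    (fun a p q hq => A.comp (by omega : n + p = q) f)
    (fun a b p q r s t hq hs hr hs' x g => (A.assoc _ _ _ _ f x g).symm)
  map_add' f g := homs_ext fun a p q hq x =>
    LinearMap.congr_fun (map_add (A.comp (by omega : n + p = q)) f g) x
  map_smul' c f := homs_ext fun a p q hq x =>
    LinearMap.congr_fun (map_smul (A.comp (by omega : n + p = q)) c f) x

/-- The Yoneda embedding. -/
def yoneda (A : DGCat.{w, u, v} k) : DGFunctor A (dgCat.{w, u, v, v} A) where
  obj := representable
  map {X Y n} := yonedaMap X Y n
  map_one X := homs_ext fun a p q hq x => by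
    obtain rfl : p = q := by omega
    exact A.one_comp x
  map_comp {X Y Z q p n} h g f := homs_ext fun a i j (hj : i + n = j) x =>
    A.assoc h (show n + i = j by omega) (by omega : p + i = i + p)
      (show q + (i + p) = j by omega) g f x
  map_d {X Y n m} h f := homs_ext fun a p q (hq : p + m = q) x => by
    refine Eq.trans ?_ (homsD_apply h _ hq (q' := p + n) rfl (by omega) rfl (by omega) x).symm
    have e := A.leibniz (by omega : n + p = p + n) (by omega) h rfl (by omega : m + p = q)
      (by omega : n + (p + 1) = q) f (show A.Hom a X p from x)
    exact eq_sub_of_add_eq e.symm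

end

section Restriction

variable {k : Type w} [CommRing k] {A : DGCat.{w, u, v} k} {C : DGCat.{w, u₂, v₂} k}

/-- The restriction of a right DG `C`-module along a DG functor `A → C`. -/
def restrict (F : DGFunctor A C) (M : DGModule.{w, u₂, v₂, u₁} C) :
    DGModule.{w, u, v, u₁} A where
  X a n := M.X (F.obj a) n
  d h := M.d h
  act h := (M.act h).compl₂ F.map
  d_d := M.d_d
  act_one {a n} x := by
    rw [LinearMap.compl₂_apply, F.map_one]
    exact M.act_one x
  act_act h₁ h₂ h₃ h₄ x g f := by
    simp only [LinearMap.compl₂_apply, F.map_comp]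
    exact M.act_act h₁ h₂ h₃ h₄ x _ _
  leibniz h hn hq hp h₁ h₂ x f := by
    simp only [LinearMap.compl₂_apply, F.map_d]
    exact M.leibniz h hn hq hp h₁ h₂ x _

/-- The restriction of morphisms of DG modules. -/
def restrictHom (F : DGFunctor A C) (M N : DGModule.{w, u₂, v₂, u₁} C) (n : ℤ) :
    M.homs N n →ₗ[k] (restrict F M).homs (restrict F N) n where
  toFun φ := mkHom (M := restrict F M) (N := restrict F N)
    (fun a _ _ hq => app φ (F.obj a) hq)
    (fun _ _ _ _ _ _ _ hq hs hr hs' x g => app_act φ hq hs hr hs' x (F.map g))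
  map_add' _ _ := rfl
  map_smul' _ _ := rfl

/-- The restriction DG functor. -/
def res (F : DGFunctor A C) : DGFunctor (dgCat.{w, u₂, v₂, u₁} C) (dgCat.{w, u, v, u₁} A) where
  obj M := restrict F M
  map {M N n} := restrictHom F M N n
  map_one _ := rfl
  map_comp _ _ _ := rfl
  map_d _ _ := rfl

end Restriction

end DGModule

/-! ### Derived categories of right DG modules over small DG categories -/

namespace DGCat

variable {k : Type u} [CommRing k] (A : DGCat.{u, u, u} k)

/-- The homotopy category of right DG `A`-modules. -/
abbrev K : Type (u + 1) := Ho (DGModule.dgCat.{u, u, u, u} A)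

/-- The morphisms of the homotopy category of right DG modules which have an acyclic cone. -/
def acyclicCone : MorphismProperty (K A) := fun M N f =>
  ∃ φ : (DGModule.dgCat A).cocycles M.as N.as 0, homMk φ = f ∧ (DGModule.cone φ).IsAcyclic

/-- The derived category of right DG `A`-modules: the Verdier quotient of the homotopy category
by the acyclic modules. -/
abbrev Derived : Type (u + 1) := (acyclicCone A).Localization

/-- The object of the derived category given by a right DG module. -/
abbrev toDerived (M : DGModule.{u, u, u, u} A) : Derived A := (acyclicCone A).Q.obj ⟨M⟩

variable {A} {C : DGCat.{u, u, u} k}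

theorem acyclicCone_res (F : DGFunctor A C) :
    (acyclicCone C).IsInvertedBy ((DGModule.res F).ho ⋙ (acyclicCone A).Q) := by
  rintro M N f ⟨φ, rfl, hφ⟩
  exact (acyclicCone A).Q_inverts _ ⟨(DGModule.res F).zmap φ, rfl, fun a l n m hl hn x hx =>
    hφ (F.obj a) l n m hl hn x hx⟩

/-- The restriction functor `D(C) → D(A)` along a DG functor `A → C`. -/
noncomputable def resDerived (F : DGFunctor A C) : Derived C ⥤ Derived A :=
  Localization.Construction.lift ((DGModule.res F).ho ⋙ (acyclicCone A).Q) (acyclicCone_res F)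

/-- The functor from the homotopy category of `A` to `D(A)` induced by the Yoneda embedding. -/
noncomputable def hoToDerived (A : DGCat.{u, u, u} k) : Ho A ⥤ Derived A := (DGModule.yoneda A).ho ⋙ (acyclicCone A).Q

/-- `Ext^n(M, N) = Hom(M, N[n])` in the derived category, i.e. the morphisms of degree `n` of the
derived category viewed as a graded category. -/
abbrev Ext (M N : DGModule.{u, u, u, u} A) (n : ℤ) : Type (u + 1) :=
  toDerived A M ⟶ toDerived A (N.shift n)

/-- The functor from the graded homotopy category of `C` to `D(C)` induced by the Yoneda
embedding, on morphisms of degree `n`. -/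
noncomputable def gradedToDerived (c c' : C.Obj) (n : ℤ) (f : C.H c c' n) :
    Ext (DGModule.representable c) (DGModule.representable c') n :=
  (acyclicCone C).Q.map (X := ⟨DGModule.representable c⟩)
    (Y := ⟨(DGModule.representable c').shift n⟩)
    (DGModule.hShift _ _ n ((DGModule.yoneda C).hmap f))

/-- The functor `D(C) → D(A)` on morphisms of degree `n`. -/
noncomputable def resExt (F : DGFunctor A C) (M N : DGModule.{u, u, u, u} C) (n : ℤ) (f : Ext M N n) :
    Ext (M.restrict F) (N.restrict F) n :=
  (resDerived F).map f

/-- `Z` is (isomorphic to) a cone of the morphism `f : X ⟶ Y` of `D(A)`: up to isomorphism, `f` is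
the image of a closed morphism `φ` of degree `0` of right DG modules, and `Z` is the image of the
cone of `φ`. -/
def IsConeOf {X Y : Derived A} (f : X ⟶ Y) (Z : Derived A) : Prop :=
  ∃ (M N : DGModule.{u, u, u, u} A) (φ : (DGModule.dgCat A).cocycles M N 0)
    (e₁ : toDerived A M ≅ X) (e₂ : toDerived A N ≅ Y),
    (acyclicCone A).Q.map (homMk φ) ≫ e₂.hom = e₁.hom ≫ f ∧
      Nonempty (Z ≅ toDerived A (DGModule.cone φ))

end DGCat

/-! Everything follows from one computation: for an object a of A, the module ξ^* h_{ξ a} is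
quasi-isomorphic to the cone of the counit LInd Res h_a → h_a.

Derived induction is made explicit by semi-free modules (`Cells`). A morphism out of such a module
is freely determined by the values on its generators, so a presentation S over B, read over A by
`Cells.incl`, satisfies Hom_A(S, M) = Hom_B(S, Res M) (`Cells.bijective_restrictHom`). Semi-free
modules are homotopically projective (`Cells.hProj_sem`), so this passes to derived categories, and
every module has a semi-free resolution (`qIsoAt_resolution`). Hence Res has a left adjoint, and the
counit at h_a is, up to isomorphism, any σ : S → h_a with S generated over B and σ a
quasi-isomorphism at the objects of B (`exists_iso_counit`).

Put N = cone σ; it is exact at the objects of B. Since ξ kills B (`IsDGQuotient.exactAt_restrict`),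
the module ξ^* h_{ξ a} is exact there too, so Hom(S, ξ^* h_{ξ a}) is exact and the unit h_a → ξ^*
h_{ξ a} extends to θ : N → ξ^* h_{ξ a}. The heart of the proof is that θ is a quasi-isomorphism
(`IsDGQuotient.qIsoAt`). Modules extend to one-sided twisted complexes (`ext`). For a module exact
on B, the cohomology of the extension is a presheaf on A^tr which inverts the morphisms with cone in
B^tr (`inverts_coh_ext`), so it factors through the localization C^tr.

Surjectivity of θ on cohomology: it is a map from a presheaf factoring through C^tr to one
represented in C^tr, and the identity lies in its image, because the class ι of 1_a in N is sent to
the identity (`Localization.surjective_of_id`).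

Injectivity: let w be a class of N at a twisted complex z killed by θ. If no generator of S occurs
in w, then w = ι x for a morphism x : z → a[n] whose image in C^tr vanishes; as the presheaf factors
through C^tr, ι x = 0. Otherwise take a generator of highest rank in w, at b in B. Its coefficients
form a closed morphism f : z → b[s]. Pulled back to the fibre of f, the class w can be rewritten
without that generator, so it vanishes there by induction; hence w comes from b[s], where N is exact
(`InjOnSupp.insert`).

Part (a): as N is built from S and h_a, the map Hom(ξ^* h_{ξ a}, X) → Hom(h_a, X) in D(A) is
injective for X exact on B. For X = ξ^* h_{c'}[n] the target is H^n Hom_C(ξ a, c'), and the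
composite with H^n Hom_C(ξ a, c') → Ext^n is the identity. Objects c are reduced to ξ a by essential
surjectivity.

Part (b): each c is homotopy equivalent to some ξ a, and morphisms isomorphic in D(A) have
isomorphic cones (`nonempty_cone_iso`). -/

namespace DGModule

section

variable {k : Type w} [CommRing k] {A : DGCat.{w, u, v} k}

/-! ### The Yoneda lemma for DG modules -/

/-- The morphism `h_a → M` of degree `n` given by an element of `M(a)^n`. -/
def eltHom {M : DGModule.{w, u, v, v} A} {a : A.Obj} {n : ℤ} (x : M.X a n) :
    (representable a).homs M n :=
  mkHom (M := representable a) (N := M) (fun b p q hq => M.act (by omega : n + p = q) x)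
    (fun b c p q r s t hq hs hr hs' y f =>
      (M.act_act (by omega : n + p = q) hs' hr (by omega) x y f).symm)

variable {M N : DGModule.{w, u, v, v} A}

theorem eltHom_sub {a : A.Obj} {n : ℤ} (x y : M.X a n) :
    eltHom (x - y) = eltHom x - eltHom y :=
  homs_ext fun b p q h f => by
    rw [app_sub]
    exact LinearMap.congr_fun (map_sub (M.act (by omega : n + p = q)) x y) f

theorem homsD_eltHom {a : A.Obj} {n m : ℤ} (h : n + 1 = m) (x : M.X a n) :
    homsD _ _ h (eltHom x) = eltHom (M.d h x) :=
  homs_ext fun b p q hq f => by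
    rw [homsD_apply h _ hq (q' := p + n) rfl (by omega) rfl (by omega)]
    refine sub_eq_of_eq_add ?_
    exact M.leibniz (by omega : n + p = p + n) (by omega) h rfl (by omega : m + p = q)
      (by omega : n + (p + 1) = q) x (show A.Hom b a p from f)

theorem app_eltHom_one {a : A.Obj} {n : ℤ} (x : M.X a n) :
    app (eltHom x) a (zero_add n) (A.one a) = x := M.act_one x

theorem eltHom_app {a : A.Obj} {n : ℤ} (φ : (representable a).homs M n) :
    eltHom (app φ a (zero_add n) (A.one a)) = φ :=
  homs_ext fun b p q hq f => by
    have e := app_act φ (zero_add n) hq (zero_add p) (by omega) (A.one a)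
      (show A.Hom b a p from f)
    refine e.symm.trans (congrArg _ ?_)
    exact A.one_comp f

theorem eltHom_injective {a : A.Obj} {n : ℤ} {x y : M.X a n} (h : eltHom x = eltHom y) :
    x = y := by
  rw [← app_eltHom_one x, h, app_eltHom_one]

end

/-! ### Exactness at an object, orthogonality and homotopically projective modules -/

section

variable {k : Type w} [CommRing k] {A : DGCat.{w, u, v} k}

/-- The complex `M(a)` is exact. -/
def ExactAt (M : DGModule.{w, u, v, u₁} A) (a : A.Obj) : Prop :=
  ∀ (l n m : ℤ) (hl : l + 1 = n) (hn : n + 1 = m) (x : M.X a n),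
    M.d hn x = 0 → ∃ y : M.X a l, M.d hl y = x

/-- The complex `Hom(P, M)` is exact. -/
def Orth (P M : DGModule.{w, u, v, u₁} A) : Prop :=
  ∀ (l n m : ℤ) (hl : l + 1 = n) (hn : n + 1 = m) (φ : P.homs M n),
    homsD P M hn φ = 0 → ∃ ψ : P.homs M l, homsD P M hl ψ = φ

/-- Homotopically projective DG modules. -/
def HProj (P : DGModule.{w, u, v, u₁} A) : Prop :=
  ∀ M : DGModule.{w, u, v, u₁} A, M.IsAcyclic → Orth P M

/-- By the Yoneda lemma, `eltHom` identifies M(a) with Hom(h_a, M), differentials included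
(`homsD_eltHom`). -/
theorem orth_representable {M : DGModule.{w, u, v, v} A} {a : A.Obj} (h : M.ExactAt a) :
    Orth (representable a) M := by
  intro l n m hl hn φ hφ
  have e : M.d hn (app φ a (zero_add n) (A.one a)) = 0 := by
    refine eltHom_injective (a := a) ?_
    rw [← homsD_eltHom, eltHom_app, hφ]
    exact homs_ext fun b p q hq f => (LinearMap.congr_fun (map_zero (M.act _)) f).symm
  obtain ⟨y, hy⟩ := h l n m hl hn _ e
  exact ⟨eltHom y, by rw [homsD_eltHom, hy, eltHom_app]⟩

theorem hProj_representable (a : A.Obj) : HProj (representable a) :=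
  fun _ hM => orth_representable (hM a)

variable {M N P : DGModule.{w, u, v, u₁} A}

theorem app_neg {n : ℤ} (φ : M.homs N n) {a : A.Obj} {p q : ℤ} (h : p + n = q) (x : M.X a p) :
    app (-φ) a h x = -app φ a h x := rfl

/-- A closed morphism of degree `0`, as an element of the complex of morphisms. -/
def toHom (φ : (dgCat A).cocycles M N 0) : M.homs N 0 := φ.1

/-- The closed morphism of degree `0` given by an element of the complex of morphisms. -/
def ofHom (φ : M.homs N 0) (h : homsD M N (zero_add 1) φ = 0) : (dgCat A).cocycles M N 0 :=
  ⟨φ, (DGCat.mem_cocycles (A := dgCat A) (zero_add 1)).2 h⟩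

theorem toHom_ofHom (φ : M.homs N 0) (h : homsD M N (zero_add 1) φ = 0) :
    toHom (ofHom φ h) = φ := rfl

theorem homsD_toHom (φ : (dgCat A).cocycles M N 0) {m : ℤ} (h : 0 + 1 = m) :
    homsD M N h (toHom φ) = 0 :=
  (DGCat.mem_cocycles (A := dgCat A) h).1 φ.2

theorem homsD_homsD {n m l : ℤ} (h : n + 1 = m) (h' : m + 1 = l) (φ : M.homs N n) :
    homsD M N h' (homsD M N h φ) = 0 :=
  (dgCat A).d_d h h' φ

theorem homsD_homsComp {q p n q' p' n' : ℤ} (h : q + p = n) (hn : n + 1 = n')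
    (hq : q + 1 = q') (hp : p + 1 = p') (h₁ : q' + p = n') (h₂ : q + p' = n')
    (g : N.homs P q) (f : M.homs N p) :
    homsD M P hn (homsComp h g f) = homsComp h₁ (homsD N P hq g) f +
      q.negOnePow • homsComp h₂ g (homsD M N hp f) :=
  (dgCat A).leibniz h hn hq hp h₁ h₂ g f

theorem homsComp_assoc {L : DGModule.{w, u, v, u₁} A} {r q p rq qp n : ℤ} (h₁ : r + q = rq)
    (h₂ : rq + p = n) (h₃ : q + p = qp) (h₄ : r + qp = n) (e : P.homs L r) (g : N.homs P q)
    (f : M.homs N p) :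
    homsComp h₂ (homsComp h₁ e g) f = homsComp h₄ e (homsComp h₃ g f) :=
  (dgCat A).assoc h₁ h₂ h₃ h₄ e g f

theorem toHom_d (φ : (dgCat A).cocycles M N 0) {a : A.Obj} {p q : ℤ} (h : p + 1 = q)
    (x : M.X a p) :
    N.d h (app (toHom φ) a (add_zero p) x) = app (toHom φ) a (add_zero q) (M.d h x) := by
  have e := d_app (zero_add 1) φ (add_zero p) h h (add_zero q) x
  rw [Int.negOnePow_zero, one_smul] at e
  exact e

/-! ### Morphisms from and to a cone -/

section ConeCoordinates

variable (φ : (dgCat A).cocycles M N 0) {a : A.Obj}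

/-- The inclusion of the target in the cone, on elements. -/
def inl {p : ℤ} : N.X a p →ₗ[k] (cone φ).X a p := LinearMap.inl k (N.X a p) (M.X a (p + 1))

/-- The inclusion of the shifted source in the cone, on elements. -/
def inr {p p' : ℤ} (h : p + 1 = p') : M.X a p' →ₗ[k] (cone φ).X a p :=
  LinearMap.inr k (N.X a p) (M.X a (p + 1)) ∘ₗ M.castDeg h.symm

/-- The first coordinate of an element of a cone. -/
def fst {p : ℤ} : (cone φ).X a p →ₗ[k] N.X a p := LinearMap.fst k (N.X a p) (M.X a (p + 1))

/-- The second coordinate of an element of a cone. -/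
def snd {p p' : ℤ} (h : p + 1 = p') : (cone φ).X a p →ₗ[k] M.X a p' :=
  M.castDeg h ∘ₗ LinearMap.snd k (N.X a p) (M.X a (p + 1))

variable {φ}

theorem cone_ext {p p' : ℤ} (h : p + 1 = p') {z z' : (cone φ).X a p} (h₁ : fst φ z = fst φ z')
    (h₂ : snd φ h z = snd φ h z') : z = z' := by
  subst h
  exact Prod.ext h₁ h₂

theorem fst_inl {p : ℤ} (y : N.X a p) : fst φ (inl φ y) = y := rfl

theorem fst_inr {p p' : ℤ} (h : p + 1 = p') (x : M.X a p') : fst φ (inr φ h x) = 0 := rfl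

theorem snd_inl {p p' : ℤ} (h : p + 1 = p') (y : N.X a p) : snd φ h (inl φ y) = 0 :=
  map_zero (M.castDeg h)

theorem snd_inr {p p' : ℤ} (h : p + 1 = p') (x : M.X a p') : snd φ h (inr φ h x) = x := by
  subst h
  rfl

theorem inl_add_inr {p p' : ℤ} (h : p + 1 = p') (z : (cone φ).X a p) :
    inl φ (fst φ z) + inr φ h (snd φ h z) = z :=
  cone_ext h (by rw [map_add, fst_inl, fst_inr, add_zero])
    (by rw [map_add, snd_inl, snd_inr, zero_add])

theorem fst_d {p q : ℤ} (h : p + 1 = q) (z : (cone φ).X a p) :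
    fst φ ((cone φ).d h z) = N.d h (fst φ z) + app (toHom φ) a (add_zero q) (snd φ h z) := by
  subst h
  rfl

theorem snd_d {p q r : ℤ} (h : p + 1 = q) (hr : q + 1 = r) (z : (cone φ).X a p) :
    snd φ hr ((cone φ).d h z) = -M.d hr (snd φ h z) := by
  subst h
  subst hr
  rfl

theorem fst_act {b : A.Obj} {p q n : ℤ} (h : q + p = n) (z : (cone φ).X a q) (f : A.Hom b a p) :
    fst φ ((cone φ).act h z f) = N.act h (fst φ z) f := rfl

theorem snd_act {b : A.Obj} {p q n q' n' : ℤ} (h : q + p = n) (hq : q + 1 = q') (hn : n + 1 = n')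
    (h' : q' + p = n') (z : (cone φ).X a q) (f : A.Hom b a p) :
    snd φ hn ((cone φ).act h z f) = M.act h' (snd φ hq z) f := by
  subst hq hn
  rfl

theorem d_inl {p q : ℤ} (h : p + 1 = q) (y : N.X a p) :
    (cone φ).d h (inl φ y) = inl φ (N.d h y) :=
  cone_ext rfl (by rw [fst_d, fst_inl, fst_inl, snd_inl, map_zero, add_zero])
    (by rw [snd_d, snd_inl, snd_inl, map_zero, neg_zero])

theorem d_inr {p q r : ℤ} (h : p + 1 = q) (hr : q + 1 = r) (x : M.X a q) :
    (cone φ).d h (inr φ h x) = inl φ (app (toHom φ) a (add_zero q) x) - inr φ hr (M.d hr x) :=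
  cone_ext hr
    (by rw [fst_d, fst_inr, snd_inr, map_zero, zero_add, map_sub, fst_inl, fst_inr, sub_zero])
    (by rw [snd_d, snd_inr, map_sub, snd_inl, snd_inr, zero_sub])

theorem inl_act {b : A.Obj} {p q n : ℤ} (h : q + p = n) (y : N.X a q) (f : A.Hom b a p) :
    (cone φ).act h (inl φ y) f = inl φ (N.act h y f) :=
  cone_ext rfl rfl (by
    rw [snd_act h rfl rfl (by omega), snd_inl, snd_inl, map_zero, LinearMap.zero_apply])

theorem inr_act {b : A.Obj} {p q n q' n' : ℤ} (h : q + p = n) (hq : q + 1 = q')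
    (hn : n + 1 = n') (h' : q' + p = n') (x : M.X a q') (f : A.Hom b a p) :
    (cone φ).act h (inr φ hq x) f = inr φ hn (M.act h' x f) :=
  cone_ext hn (by rw [fst_act, fst_inr, fst_inr, map_zero, LinearMap.zero_apply]) (by
    rw [snd_act h hq hn h', snd_inr, snd_inr])

end ConeCoordinates

/-- The morphism `(y, x) ↦ g y + s x` from a cone. -/
def coneDesc (φ : (dgCat A).cocycles M N 0) {n l : ℤ} (h : l + 1 = n) (g : N.homs P n)
    (s : M.homs P l) : (cone φ).homs P n :=
  mkHom (M := cone φ) (N := P)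
    (fun a p q hq => app g a hq ∘ₗ fst φ + app s a (by omega : p + 1 + l = q) ∘ₗ snd φ rfl)
    (fun a b p q r t i hq ht hr ht' x f => by
      change app g a ht (fst φ _) + app s a _ (snd φ rfl _) =
        P.act ht' (app g b hq (fst φ x) + app s b _ (snd φ rfl x)) f
      rw [fst_act, snd_act hr rfl rfl (by omega), map_add, LinearMap.add_apply,
        app_act g hq ht hr ht', app_act s (by omega) (by omega) (by omega) ht'])

theorem app_coneDesc (φ : (dgCat A).cocycles M N 0) {n l : ℤ} (h : l + 1 = n) (g : N.homs P n)
    (s : M.homs P l) {a : A.Obj} {p q p' : ℤ} (hq : p + n = q) (hp : p + 1 = p') (hq' : p' + l = q)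
    (z : (cone φ).X a p) :
    app (coneDesc φ h g s) a hq z = app g a hq (fst φ z) + app s a hq' (snd φ hp z) := by
  subst hp
  rfl

/-- The differential on Hom(cone φ, P) is triangular, with precomposition by φ off the diagonal. In
degree 0, a closed morphism from the cone is thus a closed g together with a homotopy s from gφ to
zero. -/
theorem homsD_coneDesc (φ : (dgCat A).cocycles M N 0) {n l m : ℤ} (h : l + 1 = n)
    (hn : n + 1 = m) (g : N.homs P n) (s : M.homs P l) :
    homsD (cone φ) P hn (coneDesc φ h g s) =
      coneDesc φ hn (homsD N P hn g)
        (homsD M P h s - n.negOnePow • homsComp (add_zero n) g (toHom φ)) :=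
  homs_ext fun a p q hq z => by
    rw [homsD_apply hn _ hq (q' := p + n) rfl (by omega) rfl (by omega),
      app_coneDesc φ h g s (p' := p + 1) _ rfl (by omega),
      app_coneDesc φ h g s (p' := p + 1 + 1) _ rfl (by omega),
      app_coneDesc φ hn _ _ (p' := p + 1) _ rfl (by omega), fst_d,
      snd_d rfl rfl, app_sub, app_units_smul,
      homsD_apply hn g hq (q' := p + n) rfl (by omega) rfl (by omega),
      homsD_apply h s _ (q' := p + n) (by omega) (by omega) rfl (by omega),
      homsComp_apply (add_zero n) g (toHom φ) _ (l := p + 1) (by omega) (by omega)]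
    subst h
    simp only [map_add, map_neg, smul_add, smul_neg, Int.negOnePow_succ, Units.neg_smul]
    abel

/-- The inclusion `N → cone φ`. -/
def coneInl (φ : (dgCat A).cocycles M N 0) : N.homs (cone φ) 0 :=
  mkHom (M := N) (N := cone φ) (fun a p q hq => inl φ ∘ₗ N.castDeg (by omega))
    (fun a b p q r t i hq ht hr ht' x f => by
      obtain rfl : p = q := by omega
      obtain rfl : r = t := by omega
      exact (inl_act _ _ _).symm)

theorem app_coneInl (φ : (dgCat A).cocycles M N 0) {a : A.Obj} {p : ℤ} (y : N.X a p) :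
    app (coneInl φ) a (add_zero p) y = inl φ y := by
  have : ∀ (q : ℤ) (h : p + 0 = q) (h' : p = q), app (coneInl φ) a h y = inl φ (N.castDeg h' y) :=
    fun q h h' => rfl
  exact this p (add_zero p) rfl

theorem homsD_coneInl (φ : (dgCat A).cocycles M N 0) :
    homsD N (cone φ) (zero_add 1) (coneInl φ) = 0 :=
  homs_ext fun a p q hq y => by
    rw [homsD_apply (zero_add 1) _ hq (add_zero p) hq hq (add_zero q) y, Int.negOnePow_zero,
      one_smul, app_coneInl, app_coneInl, d_inl, sub_self, app_zero]

/-- The inclusion `M → cone φ` of degree `-1`. -/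
def coneInr (φ : (dgCat A).cocycles M N 0) : M.homs (cone φ) (-1) :=
  mkHom (M := M) (N := cone φ) (fun a p q hq => inr φ (by omega))
    (fun a b p q r t i hq ht hr ht' x f => (inr_act _ _ _ _ _ _).symm)

theorem app_coneInr (φ : (dgCat A).cocycles M N 0) {a : A.Obj} {p q : ℤ} (h : p + -1 = q)
    (h' : q + 1 = p) (x : M.X a p) : app (coneInr φ) a h x = inr φ h' x := rfl

/-- Every morphism from a cone is given by its two components. -/
theorem exists_coneDesc (φ : (dgCat A).cocycles M N 0) {n l : ℤ} (h : l + 1 = n)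
    (γ : (cone φ).homs P n) :
    ∃ s : M.homs P l, γ = coneDesc φ h (homsComp (add_zero n) γ (coneInl φ)) s := by
  refine ⟨homsComp (by omega) γ (coneInr φ), homs_ext fun a p q hq z => ?_⟩
  rw [app_coneDesc φ h _ _ _ rfl (by omega), homsComp_apply (add_zero n) _ _ hq (add_zero p) hq,
    homsComp_apply _ _ _ _ (by omega : p + 1 + -1 = p) hq, app_coneInl, app_coneInr φ _ rfl,
    ← map_add, inl_add_inr]

theorem coneDesc_sub (φ : (dgCat A).cocycles M N 0) {n l : ℤ} (h : l + 1 = n) (g g' : N.homs P n)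
    (s s' : M.homs P l) :
    coneDesc φ h g s - coneDesc φ h g' s' = coneDesc φ h (g - g') (s - s') :=
  homs_ext fun a p q hq z => by
    rw [app_sub, app_coneDesc φ h _ _ _ rfl (by omega), app_coneDesc φ h _ _ _ rfl (by omega),
      app_coneDesc φ h _ _ _ rfl (by omega), app_sub, app_sub]
    abel

theorem coneDesc_zero (φ : (dgCat A).cocycles M N 0) {n l : ℤ} (h : l + 1 = n) :
    coneDesc φ h (0 : N.homs P n) (0 : M.homs P l) = 0 :=
  homs_ext fun a p q hq z => by
    rw [app_coneDesc φ h _ _ _ rfl (by omega), app_zero, app_zero, app_zero, add_zero]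

theorem coneDesc_inj (φ : (dgCat A).cocycles M N 0) {n l : ℤ} (h : l + 1 = n) {g g' : N.homs P n}
    {s s' : M.homs P l} (e : coneDesc φ h g s = coneDesc φ h g' s') : g = g' ∧ s = s' := by
  constructor
  · refine homs_ext fun a p q hq x => ?_
    have := congrArg (fun γ => app γ a hq (inl φ x)) e
    simpa only [app_coneDesc φ h _ _ hq rfl (by omega : p + 1 + l = q), fst_inl, snd_inl, map_zero,
      add_zero] using this
  · refine homs_ext fun a p q hq x => ?_
    have hp : p - 1 + 1 = p := by omega
    have hq' : p - 1 + n = q := by omega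
    have := congrArg (fun γ => app γ a hq' (inr φ hp x)) e
    simpa only [app_coneDesc φ h _ _ hq' hp hq, fst_inr, snd_inr, map_zero,
      zero_add] using this

/-- A closed morphism from the cone of `φ : M → N` is exact if its restriction to `N` is, provided
that `Hom(M, P)` is exact. -/
theorem exact_of_exact_coneInl (φ : (dgCat A).cocycles M N 0) (hM : Orth M P) {n m l : ℤ}
    (hl : l + 1 = n) (hn : n + 1 = m) (γ : (cone φ).homs P n) (hγ : homsD _ _ hn γ = 0)
    (ψ : N.homs P l) (hψ : homsD _ _ hl ψ = homsComp (add_zero n) γ (coneInl φ)) :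
    ∃ β, homsD _ _ hl β = γ := by
  obtain ⟨s, hs⟩ := exists_coneDesc φ hl γ
  rw [← hψ] at hs
  obtain ⟨i, hi⟩ : ∃ i, i + 1 = l := ⟨l - 1, by omega⟩
  have e := homsD_coneDesc φ hi hl ψ (0 : M.homs P i)
  rw [map_zero, zero_sub] at e
  -- Subtracting the boundary of (ψ, 0) kills the restriction to N; what remains is a cocycle on M
  -- alone, where exactness of Hom(M, P) applies.
  have e' : γ - homsD _ _ hl (coneDesc φ hi ψ (0 : M.homs P i)) =
      coneDesc φ hl 0 (s + l.negOnePow • homsComp (add_zero l) ψ (toHom φ)) := by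
    rw [e, hs, coneDesc_sub, sub_self, sub_neg_eq_add]
  have e'' : homsD M P hl (s + l.negOnePow • homsComp (add_zero l) ψ (toHom φ)) = 0 := by
    have h := homsD_coneDesc φ hl hn (0 : N.homs P n)
      (s + l.negOnePow • homsComp (add_zero l) ψ (toHom φ))
    have h₀ : homsComp (add_zero n) (0 : N.homs P n) (toHom φ) = 0 := by
      rw [map_zero, LinearMap.zero_apply]
    rw [← e', map_sub, hγ, homsD_homsD, map_zero, h₀, smul_zero, sub_zero, sub_zero,
      ← coneDesc_zero φ hn] at h
    exact (coneDesc_inj φ hn h).2.symm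
  obtain ⟨β, hβ⟩ := hM _ _ _ hi hl _ e''
  refine ⟨coneDesc φ hi ψ β, ?_⟩
  rw [homsD_coneDesc, hβ, hs]
  congr 1
  abel

theorem Orth.cone (φ : (dgCat A).cocycles M N 0) (hM : Orth M P) (hN : Orth N P) :
    Orth (cone φ) P := by
  intro l n m hl hn γ hγ
  have e : homsD N P hn (homsComp (add_zero n) γ (coneInl φ)) = 0 := by
    rw [homsD_homsComp (add_zero n) hn hn (zero_add 1) (add_zero m) hn, hγ, homsD_coneInl, map_zero,
      map_zero, LinearMap.zero_apply, smul_zero, add_zero]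
  obtain ⟨ψ, hψ⟩ := hN l n m hl hn _ e
  exact exact_of_exact_coneInl φ hM hl hn γ hγ ψ hψ

theorem HProj.cone (φ : (dgCat A).cocycles M N 0) (hM : HProj M) (hN : HProj N) :
    HProj (cone φ) := fun P hP => (hM P hP).cone φ (hN P hP)

/-- The morphism `x ↦ (t x, s x)` to a cone. -/
def coneLift (φ : (dgCat A).cocycles M N 0) {n m : ℤ} (h : n + 1 = m) (t : P.homs N n)
    (s : P.homs M m) : P.homs (cone φ) n :=
  mkHom (M := P) (N := cone φ)
    (fun a p q hq => inl φ ∘ₗ app t a hq + inr φ rfl ∘ₗ app s a (by omega : p + m = q + 1))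
    (fun a b p q r i j hq hi hr hi' x f => by
      change inl φ (app t a hi _) + inr φ rfl (app s a _ _) =
        (DGModule.cone φ).act hi' (inl φ (app t b hq x) + inr φ rfl (app s b _ x)) f
      rw [map_add, LinearMap.add_apply, inl_act, inr_act hi' rfl rfl (by omega),
        app_act t hq hi hr hi', app_act s (q := q + 1) (by omega) (by omega) hr (by omega)])

theorem app_coneLift (φ : (dgCat A).cocycles M N 0) {n m : ℤ} (h : n + 1 = m) (t : P.homs N n)
    (s : P.homs M m) {a : A.Obj} {p q q' : ℤ} (hq : p + n = q) (hq' : q + 1 = q') (hp : p + m = q')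
    (x : P.X a p) :
    app (coneLift φ h t s) a hq x = inl φ (app t a hq x) + inr φ hq' (app s a hp x) := by
  subst hq'
  rfl

/-- Dual to `homsD_coneDesc`: a closed morphism into the cone is a closed s into M together with a t
bounding -φs. -/
theorem homsD_coneLift (φ : (dgCat A).cocycles M N 0) {n m l : ℤ} (h : n + 1 = m)
    (hm : m + 1 = l) (t : P.homs N n) (s : P.homs M m) :
    homsD P (cone φ) h (coneLift φ h t s) =
      coneLift φ hm (homsD _ _ h t + homsComp (zero_add m) (toHom φ) s) (-homsD _ _ hm s) :=
  homs_ext fun a p q hq x => by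
    rw [homsD_apply h _ hq (q' := p + n) rfl (by omega) rfl (by omega),
      app_coneLift φ h t s rfl rfl (by omega), app_coneLift φ h t s _ rfl (by omega),
      app_coneLift φ hm _ _ _ rfl (by omega), app_add,
      homsD_apply h t hq (q' := p + n) rfl (by omega) rfl (by omega),
      homsComp_apply (zero_add m) (toHom φ) s hq hq (add_zero q), app_neg,
      homsD_apply hm s _ (q' := p + n + 1) (by omega) (by omega) rfl (by omega),
      map_add, d_inl]
    obtain rfl : p + n + 1 = q := by omega
    rw [d_inr rfl rfl]
    subst h
    simp only [Int.negOnePow_succ, Units.neg_smul, map_add, map_sub, map_neg, smul_add,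
      LinearMap.map_smul_of_tower, sub_neg_eq_add]
    abel

theorem exists_coneLift (φ : (dgCat A).cocycles M N 0) {n m : ℤ} (h : n + 1 = m)
    (γ : P.homs (cone φ) n) : ∃ t s, γ = coneLift φ h t s := by
  refine ⟨mkHom (fun a p q hq => fst φ ∘ₗ app γ a hq)
    (fun a b p q r i j hq hi hr hi' x f => congrArg (fst φ) (app_act γ hq hi hr hi' x f)),
    mkHom (fun a p q hq => snd φ (by omega) ∘ₗ app γ a (q := q - 1) (by omega))
    (fun a b p q r i j hq hi hr hi' x f => ?_), homs_ext fun a p q hq x => ?_⟩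
  · change snd φ _ (app γ a _ (P.act hr x f)) = M.act hi' (snd φ _ (app γ b _ x)) f
    rw [app_act γ (q := q - 1) (by omega) (by omega) hr (by omega),
      snd_act _ (by omega) (by omega) hi']
  · rw [app_coneLift φ h _ _ hq rfl (by omega)]
    have : ∀ (q' : ℤ) (h₁ : q' = q) (h₂ : q' + 1 = q + 1) (h₃ : p + n = q'),
        app γ a hq x = inl φ (fst φ (app γ a hq x)) + inr φ rfl (snd φ h₂ (app γ a h₃ x)) := by
      rintro _ rfl _ _
      rw [inl_add_inr]
    exact this (q + 1 - 1) (by omega) (by omega) (by omega)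

end

end DGModule

/-! ### Exactness of triangular differentials -/

/-- A differential on a product of complexes which is triangular for a well-founded relation is
exact if its diagonal components are. -/
theorem exists_of_triangular {I : Type*} (r : I → I → Prop) (hr : WellFounded r)
    (htr : ∀ i j l, r i j → r j l → r i l) {U V W : I → Type*} [∀ i, AddCommGroup (U i)]
    [∀ i, AddCommGroup (V i)] [∀ i, AddCommGroup (W i)] (D₁ : (∀ i, U i) →+ ∀ i, V i)
    (D₂ : (∀ i, V i) →+ ∀ i, W i) (d₁ : ∀ i, U i →+ V i) (d₂ : ∀ i, V i →+ W i)
    (hD₁ : ∀ i u, (∀ j, r j i → u j = 0) → D₁ u i = d₁ i (u i))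
    (hD₂ : ∀ i v, (∀ j, r j i → v j = 0) → D₂ v i = d₂ i (v i))
    (hD : ∀ u, D₂ (D₁ u) = 0) (hd : ∀ i v, d₂ i v = 0 → ∃ u, d₁ i u = v) (v : ∀ i, V i)
    (hv : D₂ v = 0) : ∃ u, D₁ u = v := by
  classical
  -- The solution is built by well-founded recursion: the component at i must make up for what the
  -- components below i leave of v i. The default value 0 lets the recursion run before solvability
  -- is known; it turns out never to be used.
  let F : ∀ i, (∀ j, r j i → U j) → U i := fun i prev =>
    let t : ∀ j, U j := fun j => if h : r j i then prev j h else 0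
    if h : ∃ u, d₁ i u = v i - D₁ t i then h.choose else 0
  let u : ∀ i, U i := hr.fix F
  let t : I → ∀ j, U j := fun i j => if r j i then u j else 0
  have hu : ∀ i, (∃ y, d₁ i y = v i - D₁ (t i) i) → d₁ i (u i) = v i - D₁ (t i) i := by
    intro i h
    have e : u i = F i fun j _ => u j := hr.fix_eq F i
    have e' : F i (fun j _ => u j) = if h : ∃ y, d₁ i y = v i - D₁ (t i) i then h.choose else 0 :=
      rfl
    rw [e, e', dif_pos h]
    exact h.choose_spec
  have ht : ∀ i, D₁ u i = D₁ (t i) i + d₁ i (u i) := by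
    intro i
    have hz : ∀ j, r j i → (u - t i) j = 0 := by
      intro j hj
      simp [t, hj]
    have h := hD₁ i (u - t i) hz
    have h' : (u - t i) i = u i := by
      have : ¬ r i i := fun h => (hr.irrefl).irrefl i h
      simp [t, this]
    rw [map_sub, Pi.sub_apply, h'] at h
    rw [← h]
    abel
  refine ⟨u, funext fun i => ?_⟩
  induction i using hr.induction with
  | _ i ih =>
    -- By induction v - D₁ (t i) vanishes below i. It is killed by D₂, so by triangularity its
    -- component at i is closed for the diagonal differential, and exactness there gives the
    -- component u i.
    have hz : ∀ j, r j i → (v - D₁ (t i)) j = 0 := by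
      intro j hj
      have hz' : ∀ l, r l j → (u - t i) l = 0 := by
        intro l hl
        simp [t, htr l j i hl hj]
      have h := hD₁ j (u - t i) hz'
      have h' : (u - t i) j = 0 := by simp [t, hj]
      rw [h', map_zero, map_sub, Pi.sub_apply, ih j hj] at h
      exact h
    have h := hD₂ i _ hz
    rw [map_sub, hv, hD, sub_zero] at h
    rw [ht, hu i (hd i _ h.symm)]
    abel

namespace DGCat

variable {k : Type u} [CommRing k] {A : DGCat.{u, u, u} k}

/-! ### Free graded modules -/

section Free

variable {I : Type u} (obj : I → A.Obj) (deg : I → ℤ)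

/-- The elements of degree `n` at `a` of the free graded module with generators of degree `deg i`
at `obj i`. -/
abbrev Free (a : A.Obj) (n : ℤ) : Type u := Π₀ i, A.Hom a (obj i) (n - deg i)

namespace Free

variable {obj deg}

/-- The right action of `A` on a free graded module. -/
def act {a b : A.Obj} {q p n : ℤ} (h : q + p = n) :
    Free obj deg b q →ₗ[k] A.Hom a b p →ₗ[k] Free obj deg a n :=
  LinearMap.mk₂ k
    (fun x f => x.mapRange (fun i y => A.comp (by omega) y f) (fun i => by simp))
    (fun x y f => by ext i; simp) (fun c x f => by ext i; simp)
    (fun x f g => by ext i; simp) (fun c x f => by ext i; simp)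

/-- The coefficient of a generator. -/
def coeff (i : I) {a : A.Obj} {n p : ℤ} (h : deg i + p = n) :
    Free obj deg a n →ₗ[k] A.Hom a (obj i) p :=
  A.castDeg (by omega) ∘ₗ DFinsupp.lapply i

theorem coeff_act {a b : A.Obj} {i : I} {q p n r s : ℤ} (h : q + p = n) (hr : deg i + r = q)
    (hs : deg i + s = n) (h' : r + p = s) (x : Free obj deg b q) (f : A.Hom a b p) :
    coeff i hs (act h x f) = A.comp h' (coeff i hr x) f := by
  obtain rfl : r = q - deg i := by omega
  obtain rfl : s = n - deg i := by omega
  rfl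

theorem act_act {a b c : A.Obj} {r q p rq qp n : ℤ} (h₁ : r + q = rq) (h₂ : rq + p = n)
    (h₃ : q + p = qp) (h₄ : r + qp = n) (x : Free obj deg c r) (g : A.Hom b c q)
    (f : A.Hom a b p) : act h₂ (act h₁ x g) f = act h₄ x (A.comp h₃ g f) := by
  ext i
  exact A.assoc _ _ _ _ _ _ _

theorem act_one {a : A.Obj} {n : ℤ} (x : Free obj deg a n) : act (add_zero n) x (A.one a) = x := by
  ext i
  exact A.comp_one _

variable [DecidableEq I]

/-- The multiples of a generator. -/
def gen (i : I) {a : A.Obj} {n p : ℤ} (h : deg i + p = n) :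
    A.Hom a (obj i) p →ₗ[k] Free obj deg a n :=
  DFinsupp.lsingle i ∘ₗ A.castDeg (by omega)

theorem linearMap_ext {a : A.Obj} {n : ℤ} {M : Type*} [AddCommGroup M] [Module k M]
    {f g : Free obj deg a n →ₗ[k] M}
    (h : ∀ (i : I) (p : ℤ) (hp : deg i + p = n) (x : A.Hom a (obj i) p),
      f (gen i hp x) = g (gen i hp x)) : f = g := by
  refine DFinsupp.lhom_ext fun i x => ?_
  exact h i (n - deg i) (by omega) x

theorem act_gen {a b : A.Obj} {i : I} {q p n r s : ℤ} (h : q + p = n) (hr : deg i + r = q)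
    (hs : deg i + s = n) (h' : r + p = s) (x : A.Hom b (obj i) r) (f : A.Hom a b p) :
    act h (gen (obj := obj) i hr x) f = gen i hs (A.comp h' x f) := by
  obtain rfl : r = q - deg i := by omega
  obtain rfl : s = n - deg i := by omega
  exact DFinsupp.mapRange_single (hf := fun j => by simp)
    (f := fun j (y : A.Hom b (obj j) (q - deg j)) =>
      (A.comp (by omega) y f : A.Hom a (obj j) (n - deg j)))

theorem coeff_gen_self {a : A.Obj} {n p : ℤ} (i : I) (h h' : deg i + p = n)
    (x : A.Hom a (obj i) p) : coeff i h (gen (obj := obj) i h' x) = x := by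
  obtain rfl : p = n - deg i := by omega
  exact DFinsupp.single_eq_same

theorem coeff_gen_of_ne {a : A.Obj} {n p p' : ℤ} {i j : I} (hij : j ≠ i) (h : deg i + p = n)
    (h' : deg j + p' = n) (x : A.Hom a (obj j) p') : coeff i h (gen (obj := obj) j h' x) = 0 := by
  obtain rfl : p = n - deg i := by omega
  exact DFinsupp.single_eq_of_ne hij.symm

/-- The linear map on a free graded module with given restrictions to the multiples of the
generators. -/
def sum {a : A.Obj} {n : ℤ} {M : Type*} [AddCommGroup M] [Module k M]
    (T : ∀ i, A.Hom a (obj i) (n - deg i) →ₗ[k] M) : Free obj deg a n →ₗ[k] M :=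
  DFinsupp.lsum ℕ T

theorem sum_gen {a : A.Obj} {n : ℤ} {M : Type*} [AddCommGroup M] [Module k M]
    (T : ∀ i, A.Hom a (obj i) (n - deg i) →ₗ[k] M) {i : I} {p : ℤ} (h : deg i + p = n)
    (x : A.Hom a (obj i) p) : sum T (gen i h x) = T i (A.castDeg (by omega) x) := by
  refine (DFinsupp.lsum_single ..)

/-- The differential with prescribed values on the generators. -/
def d (q : ∀ i, Free obj deg (obj i) (deg i + 1)) {a : A.Obj} {n m : ℤ} (h : n + 1 = m) :
    Free obj deg a n →ₗ[k] Free obj deg a m :=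
  sum fun i => act (by omega) (q i) + (deg i).negOnePow • gen i (by omega) ∘ₗ A.d rfl

theorem d_gen (q : ∀ i, Free obj deg (obj i) (deg i + 1)) {a : A.Obj} {n m p p' : ℤ}
    (h : n + 1 = m) {i : I} (hp : deg i + p = n) (h' : deg i + 1 + p = m) (hp' : p + 1 = p')
    (h'' : deg i + p' = m) (x : A.Hom a (obj i) p) :
    d q h (gen i hp x) = act h' (q i) x + (deg i).negOnePow • gen i h'' (A.d hp' x) := by
  rw [d, sum_gen]
  subst hp'
  obtain rfl : p = n - deg i := by omega
  rfl

theorem d_act (δ : ∀ i, Free obj deg (obj i) (deg i + 1)) {a b : A.Obj} {q p n q' p' n' : ℤ}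
    (h : q + p = n) (hn : n + 1 = n') (hq : q + 1 = q') (hp : p + 1 = p') (h₁ : q' + p = n')
    (h₂ : q + p' = n') (x : Free obj deg b q) (f : A.Hom a b p) :
    d δ hn (act h x f) = act h₁ (d δ hq x) f + q.negOnePow • act h₂ x (A.d hp f) := by
  have : d δ hn ∘ₗ (act h).flip f =
      (act h₁).flip f ∘ₗ d δ hq + q.negOnePow • (act (obj := obj) (deg := deg) h₂).flip (A.d hp f) := by
    refine linearMap_ext fun i r hr y => ?_
    subst hr
    change d δ hn (act h (gen i rfl y) f) = act h₁ (d δ hq (gen i rfl y)) f +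
      (deg i + r).negOnePow • act h₂ (gen i rfl y) (A.d hp f)
    rw [act_gen h rfl (s := r + p) (by omega) rfl,
      d_gen δ hn _ (by omega) rfl (by omega), d_gen δ hq rfl (by omega) rfl (by omega),
      map_add, LinearMap.add_apply, smul_apply₂,
      act_gen h₁ _ (s := r + p + 1) (by omega) (by omega),
      act_gen h₂ rfl (s := r + p + 1) (by omega) (by omega),
      act_act (rq := q') (by omega) h₁ rfl (by omega),
      A.leibniz rfl rfl rfl hp (by omega) (by omega), map_add, LinearMap.map_smul_of_tower,
      smul_add, smul_smul, ← Int.negOnePow_add]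
    exact (add_assoc _ _ _).symm
  exact LinearMap.congr_fun this x

/-- By the Leibniz rule the square of the differential commutes with the action of A, so it is
enough that it vanishes on generators. -/
theorem d_d (δ : ∀ i, Free obj deg (obj i) (deg i + 1)) (hδ : ∀ i, d δ rfl (δ i) = 0)
    {a : A.Obj} {n m l : ℤ} (h : n + 1 = m) (h' : m + 1 = l) (x : Free obj deg a n) :
    d δ h' (d δ h x) = 0 := by
  have : d δ h' ∘ₗ d δ h = (0 : Free obj deg a n →ₗ[k] Free obj deg a l) := by
    refine linearMap_ext fun i r hr y => ?_
    change d δ h' (d δ h (gen i hr y)) = 0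
    rw [d_gen δ h hr (by omega) rfl (by omega), map_add, LinearMap.map_smul_of_tower,
      d_act δ _ h' rfl rfl (by omega) (by omega), hδ,
      d_gen δ h' _ (by omega) rfl (by omega), A.d_d, map_zero, map_zero, LinearMap.zero_apply,
      smul_zero, add_zero, zero_add, Int.negOnePow_succ, Units.neg_smul, neg_add_cancel]
  exact LinearMap.congr_fun this x

end Free

end Free

/-! ### Semi-free modules -/

variable (A)

/-- A presentation of a semi-free DG module: generators together with their differentials. -/
structure Cells where
  I : Type u
  [dec : DecidableEq I]
  obj : I → A.Obj
  deg : I → ℤ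
  δ : ∀ i, Free obj deg (obj i) (deg i + 1)
  rank : I → ℕ
  rank_lt : ∀ i j, δ i j ≠ 0 → rank j < rank i
  d_δ : ∀ i, Free.d δ rfl (δ i) = 0

attribute [instance] Cells.dec

variable {A}

namespace Cells

variable (S : Cells A)

/-- The semi-free DG module with a given presentation. -/
def sem : DGModule.{u, u, u, u} A where
  X := Free S.obj S.deg
  d := Free.d S.δ
  act := Free.act
  d_d := Free.d_d S.δ S.d_δ
  act_one := Free.act_one
  act_act := Free.act_act
  leibniz := Free.d_act S.δ

/-- The multiples of a generator, in the semi-free module. -/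
def gen (i : S.I) {a : A.Obj} {n p : ℤ} (h : S.deg i + p = n) :
    A.Hom a (S.obj i) p →ₗ[k] S.sem.X a n := Free.gen i h

/-- The coefficient of a generator. -/
def coeff (i : S.I) {a : A.Obj} {n p : ℤ} (h : S.deg i + p = n) :
    S.sem.X a n →ₗ[k] A.Hom a (S.obj i) p := Free.coeff i h

/-- The generators of a semi-free module. -/
def e (i : S.I) : S.sem.X (S.obj i) (S.deg i) := S.gen i (add_zero _) (A.one _)

variable {S}

theorem coeff_gen_self {a : A.Obj} {n p : ℤ} (i : S.I) (h h' : S.deg i + p = n)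
    (x : A.Hom a (S.obj i) p) : S.coeff i h (S.gen i h' x) = x := Free.coeff_gen_self _ _ _ _

theorem coeff_gen_of_ne {a : A.Obj} {n p p' : ℤ} {i j : S.I} (hij : j ≠ i) (h : S.deg i + p = n)
    (h' : S.deg j + p' = n) (x : A.Hom a (S.obj j) p') : S.coeff i h (S.gen j h' x) = 0 :=
  Free.coeff_gen_of_ne hij _ _ _

theorem coeff_act {a b : A.Obj} {i : S.I} {q p n r s : ℤ} (h : q + p = n) (hr : S.deg i + r = q)
    (hs : S.deg i + s = n) (h' : r + p = s) (x : S.sem.X b q) (f : A.Hom a b p) :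
    S.coeff i hs (S.sem.act h x f) = A.comp h' (S.coeff i hr x) f :=
  Free.coeff_act h hr hs h' x f

theorem act_e {a : A.Obj} {n p : ℤ} {i : S.I} (h : S.deg i + p = n) (x : A.Hom a (S.obj i) p) :
    S.sem.act h (S.e i) x = S.gen i h x :=
  (Free.act_gen h (add_zero _) h (zero_add p) (A.one _) x).trans (by rw [A.one_comp]; rfl)

theorem d_gen {a : A.Obj} {n m p p' : ℤ} (h : n + 1 = m) {i : S.I} (hp : S.deg i + p = n)
    (h' : S.deg i + 1 + p = m) (hp' : p + 1 = p') (h'' : S.deg i + p' = m)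
    (x : A.Hom a (S.obj i) p) :
    S.sem.d h (S.gen i hp x) =
      S.sem.act h' (S.δ i) x + (S.deg i).negOnePow • S.gen i h'' (A.d hp' x) :=
  Free.d_gen S.δ h hp h' hp' h'' x

theorem d_e (i : S.I) : S.sem.d rfl (S.e i) = S.δ i := by
  refine (d_gen rfl _ (add_zero _) (zero_add 1) rfl _).trans ?_
  rw [A.d_one, map_zero, smul_zero, add_zero]
  exact Free.act_one _

theorem linearMap_ext {a : A.Obj} {n : ℤ} {M : Type*} [AddCommGroup M] [Module k M]
    {f g : S.sem.X a n →ₗ[k] M}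
    (h : ∀ (i : S.I) (p : ℤ) (hp : S.deg i + p = n) (x : A.Hom a (S.obj i) p),
      f (S.gen i hp x) = g (S.gen i hp x)) : f = g := Free.linearMap_ext h

variable {M : DGModule.{u, u, u, u} A}

open DGModule

theorem homs_ext {n : ℤ} {φ ψ : S.sem.homs M n}
    (h : ∀ i, app φ (S.obj i) rfl (S.e i) = app ψ (S.obj i) rfl (S.e i)) : φ = ψ := by
  refine DGModule.homs_ext fun a p q hq x => ?_
  refine LinearMap.congr_fun (linearMap_ext fun i r hr y => ?_) x
  rw [← act_e, app_act φ rfl hq hr (by omega), app_act ψ rfl hq hr (by omega), h]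

/-- The action on elements of the morphism from a semi-free module with given values on the
generators. -/
def liftMap {n : ℤ} (y : ∀ i, M.X (S.obj i) (S.deg i + n)) {a : A.Obj} {p q : ℤ} (h : p + n = q) :
    S.sem.X a p →ₗ[k] M.X a q := Free.sum fun i => M.act (by omega) (y i)

theorem liftMap_gen {n : ℤ} (y : ∀ i, M.X (S.obj i) (S.deg i + n)) {a : A.Obj} {p q r : ℤ}
    (h : p + n = q) {i : S.I} (hr : S.deg i + r = p) (h' : S.deg i + n + r = q)
    (x : A.Hom a (S.obj i) r) : liftMap y h (S.gen i hr x) = M.act h' (y i) x := by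
  refine (Free.sum_gen _ _ _).trans ?_
  obtain rfl : r = p - S.deg i := by omega
  rfl

theorem gen_act {a b : A.Obj} {i : S.I} {q p n r s : ℤ} (h : q + p = n) (hr : S.deg i + r = q)
    (hs : S.deg i + s = n) (h' : r + p = s) (x : A.Hom b (S.obj i) r) (f : A.Hom a b p) :
    S.sem.act h (S.gen i hr x) f = S.gen i hs (A.comp h' x f) := Free.act_gen h hr hs h' x f

/-- The morphism from a semi-free module with given values on the generators. -/
def lift {n : ℤ} (y : ∀ i, M.X (S.obj i) (S.deg i + n)) : S.sem.homs M n :=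
  mkHom (M := S.sem) (N := M) (fun a p q hq => liftMap y hq)
    (fun a b p q r s t hq hs hr hs' x f => by
      have : liftMap y hs ∘ₗ (S.sem.act hr).flip f = (M.act hs').flip f ∘ₗ liftMap y hq := by
        refine linearMap_ext fun i j hj z => ?_
        change liftMap y hs (S.sem.act hr (S.gen i hj z) f) =
          M.act hs' (liftMap y hq (S.gen i hj z)) f
        rw [gen_act hr hj (s := r - S.deg i) (by omega) (by omega),
          liftMap_gen y hs _ (by omega), liftMap_gen y hq _ (by omega),
          M.act_act _ _ (by omega : j + t = r - S.deg i)]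
      exact LinearMap.congr_fun this x)

theorem app_lift_gen {n : ℤ} (y : ∀ i, M.X (S.obj i) (S.deg i + n)) {a : A.Obj} {p q r : ℤ}
    (h : p + n = q) {i : S.I} (hr : S.deg i + r = p) (h' : S.deg i + n + r = q)
    (x : A.Hom a (S.obj i) r) : app (lift y) a h (S.gen i hr x) = M.act h' (y i) x :=
  liftMap_gen y h hr h' x

theorem app_lift_e {n : ℤ} (y : ∀ i, M.X (S.obj i) (S.deg i + n)) (i : S.I) :
    app (lift y) (S.obj i) rfl (S.e i) = y i := by
  exact (app_lift_gen y rfl (add_zero _) (add_zero _) _).trans (M.act_one _)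

theorem lift_app {n : ℤ} (φ : S.sem.homs M n) :
    lift (fun i => app φ (S.obj i) rfl (S.e i)) = φ :=
  homs_ext fun i => app_lift_e _ i

theorem lift_add {n : ℤ} (y z : ∀ i, M.X (S.obj i) (S.deg i + n)) :
    lift (S := S) (y + z) = lift y + lift z :=
  homs_ext fun i => by rw [app_add, app_lift_e, app_lift_e, app_lift_e, Pi.add_apply]

/-- The values of a morphism on an element only depend on its values on the generators that
occur. -/
theorem app_eq_zero {n : ℤ} (φ : S.sem.homs M n) {a : A.Obj} {p q : ℤ} (hq : p + n = q)
    (x : S.sem.X a p)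
    (h : ∀ i, (∃ (r : ℤ) (hr : S.deg i + r = p), S.coeff i hr x ≠ 0) →
      app φ (S.obj i) rfl (S.e i) = 0) : app φ a hq x = 0 := by
  classical
  have hx : x = ∑ i ∈ (show Free S.obj S.deg a p from x).support,
      S.gen i (by omega : S.deg i + (p - S.deg i) = p) (S.coeff i (by omega) x) :=
    (DFinsupp.sum_single (f := (show Free S.obj S.deg a p from x))).symm
  rw [hx, map_sum]
  refine Finset.sum_eq_zero fun i hi => ?_
  rw [← act_e, app_act φ rfl hq _ (by omega : S.deg i + n + (p - S.deg i) = q), h i, map_zero,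
    LinearMap.zero_apply]
  exact ⟨p - S.deg i, by omega, (DFinsupp.mem_support_iff).1 hi⟩

theorem lift_zero {n : ℤ} : lift (S := S) (0 : ∀ i, M.X (S.obj i) (S.deg i + n)) = 0 :=
  homs_ext fun i => by rw [app_lift_e, app_zero, Pi.zero_apply]

/-- The differential of the i-th generator involves only generators of smaller rank, on which φ
vanishes. The term φ(d e_i) therefore drops out, leaving the diagonal part of a triangular
differential. -/
theorem homsD_app_e {n m : ℤ} (hn : n + 1 = m) (i : S.I) (φ : S.sem.homs M n)
    (hφ : ∀ j, S.rank j < S.rank i → app φ (S.obj j) rfl (S.e j) = 0) :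
    app (homsD _ _ hn φ) (S.obj i) rfl (S.e i) =
      M.d (by omega) (app φ (S.obj i) rfl (S.e i)) := by
  rw [homsD_apply hn φ rfl rfl (by omega) rfl (by omega), d_e,
    app_eq_zero φ _ (S.δ i : S.sem.X (S.obj i) (S.deg i + 1)), smul_zero, sub_zero]
  rintro j ⟨r, hr, hj⟩
  refine hφ j (S.rank_lt i j fun h => hj ?_)
  obtain rfl : r = S.deg i + 1 - S.deg j := by omega
  exact h

variable (S M) in
/-- The differential of morphisms from a semi-free module, in terms of their values on the
generators. -/
def diff {n m : ℤ} (hn : n + 1 = m) :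
    (∀ i, M.X (S.obj i) (S.deg i + n)) →+ ∀ i, M.X (S.obj i) (S.deg i + m) where
  toFun y i := app (homsD _ _ hn (lift y)) (S.obj i) rfl (S.e i)
  map_zero' := by
    funext i
    rw [lift_zero, map_zero, app_zero, Pi.zero_apply]
  map_add' y z := by
    funext i
    rw [lift_add, map_add, app_add, Pi.add_apply]

theorem lift_diff {n m : ℤ} (hn : n + 1 = m) (y : ∀ i, M.X (S.obj i) (S.deg i + n)) :
    lift (diff S M hn y) = homsD _ _ hn (lift y) :=
  homs_ext fun i => app_lift_e _ i

theorem lift_injective {n : ℤ} {y z : ∀ i, M.X (S.obj i) (S.deg i + n)}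
    (h : lift y = lift z) : y = z := by
  funext i
  rw [← app_lift_e y i, h, app_lift_e]

/-- Morphisms from a semi-free module form an exact complex, if the target is exact at the objects
of the generators. -/
theorem orth_sem (h : ∀ i, M.ExactAt (S.obj i)) : Orth S.sem M := by
  intro l n m hl hn φ hφ
  have htri : ∀ {n m : ℤ} (hn : n + 1 = m) (i : S.I) (y : ∀ i, M.X (S.obj i) (S.deg i + n)),
      (∀ j, S.rank j < S.rank i → y j = 0) → diff S M hn y i =
        (M.d (by omega : S.deg i + n + 1 = S.deg i + m)).toAddMonoidHom (y i) := by
    intro n m hn i y hy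
    refine (homsD_app_e hn i (lift y) fun j hj => ?_).trans ?_
    · rw [app_lift_e, hy j hj]
    · rw [app_lift_e]
      rfl
  -- Through values on generators, Hom(S, M) becomes the product of the shifted complexes M(obj i),
  -- with a differential triangular for the rank.
  obtain ⟨y, hy⟩ := exists_of_triangular (fun i j => S.rank i < S.rank j)
    (InvImage.wf S.rank wellFounded_lt) (fun _ _ _ => lt_trans) (diff S M hl) (diff S M hn)
    (fun i => (M.d (by omega : S.deg i + l + 1 = S.deg i + n)).toAddMonoidHom)
    (fun i => (M.d (by omega : S.deg i + n + 1 = S.deg i + m)).toAddMonoidHom)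
    (htri hl) (htri hn)
    (fun y => lift_injective (by rw [lift_diff, lift_diff, homsD_homsD, lift_zero]))
    (fun i v hv => h i _ _ _ (by omega) (by omega) v hv)
    (fun i => app φ (S.obj i) rfl (S.e i))
    (lift_injective (by rw [lift_diff, lift_app, hφ, lift_zero]))
  exact ⟨lift y, by rw [← lift_diff, hy, lift_app]⟩

theorem hProj_sem : HProj S.sem := fun _ hM => orth_sem fun i => hM (S.obj i)

end Cells

end DGCat

namespace DGModule

section

variable {k : Type w} [CommRing k] {A : DGCat.{w, u, v} k} {M N P : DGModule.{w, u, v, u₁} A}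

/-! ### Quasi-isomorphisms -/

/-- The morphism of complexes `M(a) → N(a)` induces isomorphisms in cohomology. -/
structure QIsoAt (φ : (dgCat A).cocycles M N 0) (a : A.Obj) : Prop where
  inj : ∀ (l n m : ℤ) (hl : l + 1 = n) (hn : n + 1 = m) (x : M.X a n) (y : N.X a l),
    M.d hn x = 0 → N.d hl y = app (toHom φ) a (add_zero n) x → ∃ x', M.d hl x' = x
  surj : ∀ (l n m : ℤ) (hl : l + 1 = n) (hn : n + 1 = m) (y : N.X a n), N.d hn y = 0 →
    ∃ (x : M.X a n) (y' : N.X a l), M.d hn x = 0 ∧ app (toHom φ) a (add_zero n) x + N.d hl y' = y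

/-- The long exact cohomology sequence of a cone, chased on elements. -/
theorem exactAt_cone_iff (φ : (dgCat A).cocycles M N 0) (a : A.Obj) :
    (cone φ).ExactAt a ↔ QIsoAt φ a := by
  refine ⟨fun h => ⟨?_, ?_⟩, fun h => ?_⟩
  · intro l n m hl hn x y hx hy
    have hz : (cone φ).d hl (inr φ hl x - inl φ y) = 0 := by
      rw [map_sub, d_inr hl hn, hx, map_zero, sub_zero, d_inl, hy, sub_self]
    obtain ⟨z, hz⟩ := h (l - 1) l n (by omega) hl _ hz
    refine ⟨-snd φ (by omega) z, ?_⟩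
    have e := congrArg (snd φ hl) hz
    rw [snd_d _ hl, map_sub, snd_inr, snd_inl, sub_zero] at e
    rw [map_neg, e]
  · intro l n m hl hn y hy
    obtain ⟨z, hz⟩ := h l n m hl hn (inl φ y) (by rw [d_inl, hy, map_zero])
    refine ⟨snd φ hl z, fst φ z, ?_, ?_⟩
    · have e := congrArg (snd φ hn) hz
      rw [snd_d _ hn, snd_inl, neg_eq_zero] at e
      exact e
    · have e := congrArg (fst φ) hz
      rw [fst_d, fst_inl] at e
      rw [← e, add_comm]
  · intro l n m hl hn z hz
    obtain ⟨r, hr⟩ : ∃ r, m + 1 = r := ⟨_, rfl⟩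
    have e₁ := congrArg (fst φ) hz
    have e₂ := congrArg (snd φ hr) hz
    rw [fst_d, map_zero] at e₁
    rw [snd_d _ hr, map_zero, neg_eq_zero] at e₂
    -- For closed (y, x) one has dx = 0 and φx = -dy, so x = dx₁ by injectivity. Then y + φx₁ is
    -- closed, and surjectivity writes it as φx₂ + dy'; the pair (y', x₂ - x₁) bounds (y, x).
    obtain ⟨x₁, hx₁⟩ := h.inj _ _ _ hn hr _ (-fst φ z) e₂ (by
      rw [map_neg, neg_eq_iff_add_eq_zero, e₁])
    obtain ⟨x₂, y', hx₂, hy'⟩ := h.surj _ _ _ hl hn (fst φ z + app (toHom φ) a (add_zero n) x₁) (by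
      rw [map_add, toHom_d, hx₁, e₁])
    refine ⟨inl φ y' + inr φ hl (x₂ - x₁), ?_⟩
    have e : fst φ z = app (toHom φ) a (add_zero n) x₂ + N.d hl y' -
      app (toHom φ) a (add_zero n) x₁ := by rw [hy']; abel
    refine cone_ext hn ?_ ?_
    · rw [fst_d, map_add, fst_inl, fst_inr, map_add (snd φ hl), snd_inl, snd_inr, e, add_zero,
        zero_add, map_sub]
      abel
    · rw [snd_d hl hn, map_add, snd_inl, snd_inr, map_add, map_zero, map_sub, hx₂, hx₁]
      abel

theorem isAcyclic_cone_iff (φ : (dgCat A).cocycles M N 0) :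
    (cone φ).IsAcyclic ↔ ∀ a, QIsoAt φ a :=
  forall_congr' fun a => exactAt_cone_iff φ a

end

end DGModule

namespace DGCat

variable {k : Type u} [CommRing k] {A : DGCat.{u, u, u} k}

open DGModule

/-! ### Semi-free resolutions -/

/-- Trees of generators of a semi-free module over `N`: a tree consists of an element `y` of `N` and
a finite linear combination of smaller trees, the prospective differential. -/
inductive CellTree (N : DGModule.{u, u, u, u} A) : A.Obj → ℤ → Type u
  | mk {b : A.Obj} {m : ℤ} (y : N.X b m) (r : ℕ) (o : Fin r → A.Obj) (e : Fin r → ℤ)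
      (c : ∀ j, CellTree N (o j) (e j)) (f : ∀ j, A.Hom b (o j) (m + 1 - e j)) : CellTree N b m

namespace CellTree

variable {N : DGModule.{u, u, u, u} A}

/-- The height of a tree. -/
def height : ∀ {b : A.Obj} {m : ℤ}, CellTree N b m → ℕ
  | _, _, mk _ _ _ _ c _ => (Finset.univ.sup fun j => (c j).height) + 1

variable (N) in
/-- The set of all trees. -/
abbrev Total : Type u := Σ p : A.Obj × ℤ, CellTree N p.1 p.2

/-- The object of a tree. -/
abbrev tobj (i : Total N) : A.Obj := i.1.1

/-- The degree of a tree. -/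
abbrev tdeg (i : Total N) : ℤ := i.1.2

noncomputable instance : DecidableEq (Total N) := Classical.decEq _

open Classical in
/-- The differential of the generator given by a tree, and its image in `N`. Both vanish
unless the prospective differential is closed with the image `d y`. -/
noncomputable def val : ∀ {b : A.Obj} {m : ℤ}, CellTree N b m →
    Free (tobj (N := N)) tdeg b (m + 1) × N.X b m
  | b, m, mk y _ o e c f =>
    -- The first condition is closedness of the prospective differential, the second its
    -- compatibility with dy. A tree failing either still counts as a generator, but a closed one
    -- mapped to zero, which is harmless; this avoids defining trees and their differentials by
    -- simultaneous recursion.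
    if ∑ j, (Free.act (by omega : e j + 1 + (m + 1 - e j) = m + 1 + 1) (c j).val.1 (f j) +
          (e j).negOnePow • Free.gen (obj := tobj) (deg := tdeg) ⟨(o j, e j), c j⟩
            (by omega : e j + (m + 1 - e j + 1) = m + 1 + 1) (A.d rfl (f j))) =
            (0 : Free (tobj (N := N)) tdeg b (m + 1 + 1)) ∧
        N.d rfl y = ∑ j, N.act (by omega : e j + (m + 1 - e j) = m + 1) (c j).val.2 (f j) then
      (∑ j, Free.gen (obj := tobj) (deg := tdeg) ⟨(o j, e j), c j⟩
        (by omega : e j + (m + 1 - e j) = m + 1) (f j), y)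
    else 0

theorem val_mk {b : A.Obj} {m : ℤ} (y : N.X b m) (r : ℕ) (o : Fin r → A.Obj) (e : Fin r → ℤ)
    (c : ∀ j, CellTree N (o j) (e j)) (f : ∀ j, A.Hom b (o j) (m + 1 - e j))
    (h : ∑ j, (Free.act (by omega : e j + 1 + (m + 1 - e j) = m + 1 + 1) (c j).val.1 (f j) +
          (e j).negOnePow • Free.gen (obj := tobj) (deg := tdeg) ⟨(o j, e j), c j⟩
            (by omega : e j + (m + 1 - e j + 1) = m + 1 + 1) (A.d rfl (f j))) =
            (0 : Free (tobj (N := N)) tdeg b (m + 1 + 1)))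
    (h' : N.d rfl y = ∑ j, N.act (by omega : e j + (m + 1 - e j) = m + 1) (c j).val.2 (f j)) :
    (mk y r o e c f).val = (∑ j, Free.gen (obj := tobj) (deg := tdeg) ⟨(o j, e j), c j⟩
        (by omega : e j + (m + 1 - e j) = m + 1) (f j), y) := by
  rw [val, if_pos ⟨h, h'⟩]

/-- The tree with vanishing prospective differential. -/
def leaf {b : A.Obj} {m : ℤ} (y : N.X b m) : CellTree N b m :=
  mk y 0 (fun j => j.elim0) (fun j => j.elim0) (fun j => j.elim0) (fun j => j.elim0)

theorem val_leaf {b : A.Obj} {m : ℤ} (y : N.X b m) (h : N.d rfl y = 0) : (leaf y).val = (0, y) := by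
  refine (val_mk y 0 _ _ _ _ ?_ ?_).trans ?_
  · exact Finset.sum_of_isEmpty _
  · exact h.trans (Finset.sum_of_isEmpty _).symm
  · rw [Finset.univ_eq_empty, Finset.sum_empty]

/-- The two conditions tested in `val` are what makes d² = 0 and makes the map to N commute with d
on the generator; in the default case both are trivial. The map g stands for the resolution
morphism, which can only be defined once d² = 0 is known. -/
theorem val_snd_d_and {b : A.Obj} {m : ℤ} (c : CellTree N b m) :
    Free.d (fun i : Total N => i.2.val.1) rfl c.val.1 = 0 ∧
      ∀ (g : ∀ {a : A.Obj} {p : ℤ}, Free (tobj (N := N)) tdeg a p →ₗ[k] N.X a p),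
        (∀ (i : Total N) {a : A.Obj} {p q : ℤ} (h : tdeg i + p = q) (x : A.Hom a (tobj i) p),
          g (Free.gen i h x) = N.act h i.2.val.2 x) → N.d rfl c.val.2 = g c.val.1 := by
  cases c with
  | mk y r o e c f =>
    rw [val]
    split_ifs with h
    · refine ⟨?_, fun g hg => ?_⟩
      · rw [map_sum, ← h.1]
        refine Finset.sum_congr rfl fun j _ => ?_
        exact Free.d_gen _ _ _ _ rfl _ _
      · rw [h.2, map_sum]
        refine Finset.sum_congr rfl fun j _ => ?_
        exact (hg ⟨(o j, e j), c j⟩ _ _).symm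
    · refine ⟨map_zero _, fun g _ => ?_⟩
      change N.d rfl (0 : N.X _ _) = g 0
      rw [map_zero, map_zero]

/-- Only immediate subtrees of a tree occur in its differential, so the height can serve as the
rank; it is finite because branching is. -/
theorem height_lt (i j : Total N) (h : i.2.val.1 j ≠ 0) : j.2.height < i.2.height := by
  classical
  obtain ⟨⟨b, m⟩, c⟩ := i
  cases c with
  | mk y r o e c f =>
    rw [val] at h
    split_ifs at h with hc
    · change DFinsupp.lapply (R := k) j (∑ l, Free.gen (obj := tobj) (deg := tdeg)
        (⟨(o l, e l), c l⟩ : Total N) _ (f l)) ≠ 0 at h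
      rw [map_sum] at h
      obtain ⟨l, -, hl⟩ := Finset.exists_ne_zero_of_sum_ne_zero h
      have : j = ⟨(o l, e l), c l⟩ := by
        by_contra hne
        exact hl (DFinsupp.single_eq_of_ne hne)
      subst this
      rw [height]
      exact Nat.lt_succ_of_le (Finset.le_sup (f := fun l => (c l).height) (Finset.mem_univ l))
    · exact absurd rfl h

end CellTree

open CellTree

section Resolution

variable (N : DGModule.{u, u, u, u} A)

/-- The generators of a semi-free resolution. -/
noncomputable def resolutionCells : Cells A where
  I := CellTree.Total N
  obj := tobj
  deg := tdeg
  δ i := i.2.val.1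
  rank i := i.2.height
  rank_lt i j h := CellTree.height_lt i j h
  d_δ i := i.2.val_snd_d_and.1

/-- The morphism from the semi-free resolution. -/
noncomputable def resolutionHom : (resolutionCells N).sem.homs N 0 :=
  Cells.lift (S := resolutionCells N) fun i : CellTree.Total N =>
    N.castDeg (add_zero i.1.2).symm i.2.val.2

theorem resolutionHom_gen {i : (resolutionCells N).I} {a : A.Obj} {p q : ℤ}
    (h : (resolutionCells N).deg i + p = q) (x : A.Hom a ((resolutionCells N).obj i) p) :
    app (resolutionHom N) a (add_zero q) ((resolutionCells N).gen i h x) =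
      N.act h (i.2.val.2 : N.X _ ((resolutionCells N).deg i)) x := by
  refine (Cells.app_lift_gen (S := resolutionCells N) _ (add_zero q) h (by omega) x).trans ?_
  have : ∀ (r : ℤ) (hr : (resolutionCells N).deg i = r) (h' : r + p = q),
      N.act h' (N.castDeg hr i.2.val.2) x =
        N.act h (i.2.val.2 : N.X _ ((resolutionCells N).deg i)) x := by
    rintro _ rfl _
    rfl
  exact this _ (add_zero _).symm _

theorem resolutionHom_e (i : (resolutionCells N).I) :
    app (resolutionHom N) _ (add_zero _) ((resolutionCells N).e i) = i.2.val.2 :=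
  (resolutionHom_gen N _ _).trans (N.act_one _)

theorem d_e_resolutionCells {a : A.Obj} {n m : ℤ} (h : n + 1 = m) (c : CellTree N a n)
    {x : (resolutionCells N).sem.X a m} (hx : ∀ h : m = n + 1, DGModule.castDeg _ h x = c.val.1) :
    (resolutionCells N).sem.d h ((resolutionCells N).e ⟨(a, n), c⟩) = x := by
  subst h
  exact (Cells.d_e _).trans (hx rfl).symm

theorem homsD_resolutionHom : homsD _ _ (zero_add 1) (resolutionHom N) = 0 :=
  Cells.homs_ext fun i => by
    rw [homsD_apply (zero_add 1) _ rfl (add_zero _) rfl rfl (add_zero _), Int.negOnePow_zero,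
      one_smul, resolutionHom_e, Cells.d_e, app_zero, sub_eq_zero]
    exact i.2.val_snd_d_and.2 (fun {a p} => app (resolutionHom N) a (add_zero p))
      fun i a p q h x => resolutionHom_gen N h x

/-- The semi-free resolution of a DG module. -/
noncomputable def resolution : (dgCat A).cocycles (resolutionCells N).sem N 0 :=
  ofHom (resolutionHom N) (homsD_resolutionHom N)

theorem exists_sum_gen {a : A.Obj} {n : ℤ} (x : (resolutionCells N).sem.X a n) :
    ∃ (r : ℕ) (i : Fin r → CellTree.Total N) (f : ∀ j, A.Hom a (tobj (i j)) (n - tdeg (i j))),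
      x = ∑ j, (resolutionCells N).gen (i j) (by
        change tdeg (i j) + _ = n
        omega) (f j) := by
  classical
  let x' : Free (tobj (N := N)) tdeg a n := x
  let E := x'.support.equivFin
  refine ⟨_, fun j => (E.symm j).1, fun j => x' (E.symm j).1, ?_⟩
  have h : x' = ∑ i ∈ x'.support, DFinsupp.single i (x' i) := (DFinsupp.sum_single (f := x')).symm
  rw [← Finset.sum_coe_sort, ← Equiv.sum_comp E.symm] at h
  exact h

/-- All cells are present from the start, so no iteration is needed. A closed y in N is hit by the
generator of `leaf y`. A closed combination x of generators whose image is dy is the differential of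
the generator of the tree formed by y and x. -/
theorem qIsoAt_resolution (a : A.Obj) : QIsoAt (resolution N) a := by
  refine ⟨fun l n m hl hn x y hx hy => ?_, fun l n m hl hn y hy => ?_⟩
  · subst hl hn
    obtain ⟨r, i, f, rfl⟩ := exists_sum_gen N x
    let c : CellTree N a l := .mk y r (fun j => (i j).1.1) (fun j => (i j).1.2)
      (fun j => (i j).2) f
    have hc := val_mk y r (fun j => (i j).1.1) (fun j => (i j).1.2) (fun j => (i j).2) f (by
        refine Eq.trans ?_ hx
        rw [map_sum]
        refine Finset.sum_congr rfl fun j _ => ?_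
        refine (Cells.d_gen (S := resolutionCells N) (i := i j) _ _ ?_ rfl _ (f j)).symm
        change tdeg (i j) + 1 + (l + 1 - tdeg (i j)) = l + 1 + 1
        omega) (by
        refine hy.trans ((map_sum _ _ _).trans ?_)
        exact Finset.sum_congr rfl fun j _ => resolutionHom_gen N _ _)
    exact ⟨(resolutionCells N).e ⟨(a, l), c⟩,
      d_e_resolutionCells N rfl c fun _ => (congrArg Prod.fst hc).symm⟩
  · have hc := val_leaf y (by subst hn; exact hy)
    refine ⟨(resolutionCells N).e ⟨(a, n), leaf y⟩, 0, ?_, ?_⟩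
    · refine d_e_resolutionCells N hn (leaf y) fun _ => ?_
      rw [map_zero, hc]
      rfl
    · rw [map_zero, add_zero]
      exact (resolutionHom_e N _).trans (congrArg Prod.snd hc)

end Resolution

end DGCat

/-! ### Morphisms in the homotopy category and in the derived category -/

/-- The localization functor is bijective on morphisms from an object `P` such that `Hom(P, -)`
inverts the morphisms which are localized. -/
theorem MorphismProperty.Q_map_bijective {C : Type*} [Category C] (W : MorphismProperty C)
    (P : C) (hP : ∀ ⦃X Y : C⦄ (w : X ⟶ Y), W w → Function.Bijective fun f : P ⟶ X => f ≫ w)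
    (X : C) : Function.Bijective fun f : P ⟶ X => W.Q.map f := by
  constructor
  · intro f g h
    -- The functor Hom(P, -) factors through the localization, so a morphism f out of P, as the
    -- image of the identity of P, is recovered from its class.
    have hF : W.IsInvertedBy (coyoneda.obj (Opposite.op P)) := fun X Y w hw => by
      rw [isIso_iff_bijective]
      exact hP w hw
    have e := Localization.fac (coyoneda.obj (Opposite.op P)) hF W.Q
    have h' : (W.Q ⋙ Localization.lift _ hF W.Q).map f = (W.Q ⋙ Localization.lift _ hF W.Q).map g :=
      congrArg (Localization.lift _ hF W.Q).map h
    have h'' : (coyoneda.obj (Opposite.op P)).map f = (coyoneda.obj (Opposite.op P)).map g := by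
      rw [← cancel_epi (e.hom.app _), ← e.hom.naturality, ← e.hom.naturality, h']
    have := ConcreteCategory.congr_hom h'' (𝟙 P)
    simpa using this
  -- T collects the morphisms g such that following a class from P by g again gives a class from P.
  -- It is stable under composition and contains the images of morphisms and the formal inverses,
  -- hence everything; applied to the identity of P this is surjectivity.
  · let T : MorphismProperty W.Localization := fun Y Z g =>
      ∀ f : P ⟶ (Localization.Construction.objEquiv W).symm Y,
        ∃ f' : P ⟶ (Localization.Construction.objEquiv W).symm Z,
          (W.Q.map f ≫ g : W.Q.obj P ⟶ Z) = W.Q.map f'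
    have : T.IsStableUnderComposition := ⟨fun {X Y Z} g g' hg hg' f => by
      obtain ⟨f', hf'⟩ := hg f
      obtain ⟨f'', hf''⟩ := hg' f'
      exact ⟨f'', (Category.assoc (X := X) (W := W.Q.obj P) (W.Q.map f) g g').symm.trans
        ((congrArg (· ≫ g') hf').trans hf'')⟩⟩
    have hT : T = ⊤ := Localization.Construction.morphismProperty_eq_top T
      (fun Y Z g f => ⟨f ≫ g, (W.Q.map_comp f g).symm⟩)
      (fun Y Z w hw f => by
        obtain ⟨f', hf'⟩ := (hP w hw).2 f
        refine ⟨f', ?_⟩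
        have : W.Q.map f = W.Q.map f' ≫ W.Q.map w := by
          rw [← W.Q.map_comp]
          exact congrArg W.Q.map hf'.symm
        change W.Q.map f ≫ (Localization.Construction.wIso w hw).inv = W.Q.map f'
        exact (congrArg (· ≫ (Localization.Construction.wIso w hw).inv) this).trans
          ((Category.assoc _ _ _).trans
            ((congrArg (W.Q.map f' ≫ ·) (Localization.Construction.wIso w hw).hom_inv_id).trans
              (Category.comp_id _))))
    intro g
    have hg : T g := hT ▸ MorphismProperty.top_apply g
    obtain ⟨f', hf'⟩ := hg (𝟙 P)
    refine ⟨f', ?_⟩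
    have h1 : W.Q.map (𝟙 P) ≫ g = g := by rw [W.Q.map_id, Category.id_comp]
    exact hf'.symm.trans h1

namespace DGModule

section

variable {k : Type w} [CommRing k] {A : DGCat.{w, u, v} k} {M N P : DGModule.{w, u, v, u₁} A}

theorem coneLift_inj (φ : (dgCat A).cocycles M N 0) {n m : ℤ} (h : n + 1 = m) {t t' : P.homs N n}
    {s s' : P.homs M m} (e : coneLift φ h t s = coneLift φ h t' s') : t = t' ∧ s = s' := by
  constructor
  · refine homs_ext fun a p q hq x => ?_
    have := congrArg (fun γ => fst φ (app γ a hq x)) e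
    simpa only [app_coneLift φ h _ _ hq rfl (by omega : p + m = q + 1), map_add, fst_inl, fst_inr,
      add_zero] using this
  · refine homs_ext fun a p q hq x => ?_
    have hq' : p + n = q - 1 := by omega
    have hq'' : q - 1 + 1 = q := by omega
    have := congrArg (fun γ => snd φ hq'' (app γ a hq' x)) e
    simpa only [app_coneLift φ h _ _ hq' hq'' hq, map_add, snd_inl, snd_inr,
      zero_add] using this

theorem coneLift_zero (φ : (dgCat A).cocycles M N 0) {n m : ℤ} (h : n + 1 = m) :
    coneLift φ h (0 : P.homs N n) (0 : P.homs M m) = 0 :=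
  homs_ext fun a p q hq x => by
    rw [app_coneLift φ h _ _ hq rfl (by omega), app_zero, app_zero, app_zero, map_zero, map_zero,
      add_zero]

/-- A closed morphism to the target of a morphism with `P`-acyclic cone lifts up to homotopy. -/
theorem exists_lift_of_orth {φ : (dgCat A).cocycles M N 0} (h : Orth P (cone φ)) {l n m : ℤ}
    (hl : l + 1 = n) (hn : n + 1 = m) (g : P.homs N n) (hg : homsD _ _ hn g = 0) :
    ∃ (s : P.homs M n) (t : P.homs N l), homsD _ _ hn s = 0 ∧
      homsComp (zero_add n) (toHom φ) s + homsD _ _ hl t = g := by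
  have e : homsD _ _ hn (coneLift φ hn g (0 : P.homs M m)) = 0 := by
    rw [homsD_coneLift φ hn rfl, hg, map_zero, map_zero, add_zero, neg_zero, coneLift_zero]
  obtain ⟨z, hz⟩ := h l n m hl hn _ e
  obtain ⟨t, s, rfl⟩ := exists_coneLift φ hl z
  rw [homsD_coneLift φ hl hn] at hz
  obtain ⟨h₁, h₂⟩ := coneLift_inj φ hn hz
  exact ⟨s, t, neg_eq_zero.1 h₂, by rw [add_comm, h₁]⟩

/-- A closed morphism to the source of a morphism with `P`-acyclic cone is exact if its composite
with the morphism is. -/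
theorem exact_of_comp_exact {φ : (dgCat A).cocycles M N 0} (h : Orth P (cone φ)) {l n m : ℤ}
    (hl : l + 1 = n) (hn : n + 1 = m) (s : P.homs M n) (hs : homsD _ _ hn s = 0) (t : P.homs N l)
    (ht : homsD _ _ hl t = homsComp (zero_add n) (toHom φ) s) :
    ∃ s', homsD _ _ hl s' = s := by
  have e : homsD _ _ hl (coneLift φ hl (-t) s) = 0 := by
    rw [homsD_coneLift φ hl hn, hs, map_neg, ht, neg_add_cancel, neg_zero, coneLift_zero]
  obtain ⟨i, hi⟩ : ∃ i, i + 1 = l := ⟨l - 1, by omega⟩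
  obtain ⟨z, hz⟩ := h i l n hi hl _ e
  obtain ⟨t', s', rfl⟩ := exists_coneLift φ hi z
  rw [homsD_coneLift φ hi hl] at hz
  obtain ⟨h₁, h₂⟩ := coneLift_inj φ hl hz
  exact ⟨-s', by rw [map_neg, h₂]⟩

end

end DGModule

namespace DGCat

open DGModule

section

variable {k : Type w} [CommRing k] {A : DGCat.{w, u, v} k}

/-- Equality of homotopy classes. -/
theorem homMk_eq_iff {X Y : A.Obj} (f g : A.cocycles X Y 0) :
    homMk f = homMk g ↔ ∃ β : A.Hom X Y (-1), A.d (neg_add_cancel 1) β = f.1 - g.1 :=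
  (cls_eq_iff f g).trans (mem_coboundaries _)

theorem homMk_surjective {X Y : A.Obj} (f : (⟨X⟩ : Ho A) ⟶ ⟨Y⟩) : ∃ φ, homMk φ = f :=
  cls_surjective f

theorem homMk_comp {X Y Z : A.Obj} (f : A.cocycles X Y 0) (g : A.cocycles Y Z 0) :
    homMk f ≫ homMk g = homMk (zcomp (zero_add 0) g f) := rfl

variable {M N P : DGModule.{w, u, v, u₁} A}

theorem homMk_eq_iff_homsD (f g : (dgCat A).cocycles M N 0) :
    homMk f = homMk g ↔ ∃ β : M.homs N (-1), homsD _ _ (neg_add_cancel 1) β = toHom f - toHom g :=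
  homMk_eq_iff f g

theorem toHom_zcomp (f : (dgCat A).cocycles M N 0) (g : (dgCat A).cocycles N P 0) :
    toHom (zcomp (A := dgCat A) (zero_add 0) g f) = homsComp (zero_add 0) (toHom g) (toHom f) := rfl

theorem app_toHom_zcomp (f : (dgCat A).cocycles M N 0) (g : (dgCat A).cocycles N P 0) {a : A.Obj}
    {p : ℤ} (x : M.X a p) :
    app (toHom (zcomp (A := dgCat A) (zero_add 0) g f)) a (add_zero p) x =
      app (toHom g) a (add_zero p) (app (toHom f) a (add_zero p) x) :=
  homsComp_apply (zero_add 0) _ _ _ _ _ _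

/-- The long exact sequence of Hom(P, -) for φ: exactness of Hom(P, cone φ) makes composition with φ
bijective on homotopy classes. -/
theorem bijective_comp_of_orth {φ : (dgCat A).cocycles M N 0} (h : Orth P (cone φ)) :
    Function.Bijective fun f : (⟨P⟩ : Ho (dgCat A)) ⟶ ⟨M⟩ => f ≫ homMk φ := by
  constructor
  · intro f g hfg
    obtain ⟨f, rfl⟩ := homMk_surjective f
    obtain ⟨g, rfl⟩ := homMk_surjective g
    obtain ⟨β, hβ⟩ := (homMk_eq_iff_homsD _ _).1 hfg
    rw [toHom_zcomp, toHom_zcomp, ← map_sub] at hβ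
    obtain ⟨s, hs⟩ := exact_of_comp_exact h (neg_add_cancel 1) (zero_add 1) (toHom f - toHom g)
      (by rw [map_sub, homsD_toHom, homsD_toHom, sub_zero]) β hβ
    exact (homMk_eq_iff_homsD _ _).2 ⟨s, hs⟩
  · intro g
    obtain ⟨g, rfl⟩ := homMk_surjective g
    obtain ⟨s, t, hs, ht⟩ := exists_lift_of_orth h (neg_add_cancel 1) (zero_add 1) (toHom g)
      (homsD_toHom _ _)
    refine ⟨homMk (ofHom s hs), (homMk_eq_iff_homsD _ _).2 ⟨-t, ?_⟩⟩
    rw [map_neg, ← ht, toHom_zcomp, toHom_ofHom]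
    abel

end

section

variable {k : Type u} [CommRing k] {A : DGCat.{u, u, u} k} {M N P : DGModule.{u, u, u, u} A}

/-- Morphisms from a homotopically projective module are the same in the homotopy category and in
the derived category. -/
theorem _root_.DGModule.HProj.bijective_Q_map (hP : HProj P) (M : DGModule.{u, u, u, u} A) :
    Function.Bijective fun f : (⟨P⟩ : K A) ⟶ ⟨M⟩ => (acyclicCone A).Q.map f := by
  refine MorphismProperty.Q_map_bijective _ _ ?_ _
  rintro ⟨X⟩ ⟨Y⟩ w ⟨φ, rfl, hφ⟩
  exact bijective_comp_of_orth (hP _ hφ)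

theorem isIso_Q_map {φ : (dgCat A).cocycles M N 0} (h : ∀ a, QIsoAt φ a) :
    IsIso ((acyclicCone A).Q.map (homMk φ)) :=
  (acyclicCone A).Q_inverts _ ⟨φ, rfl, (isAcyclic_cone_iff φ).2 h⟩

/-- The presentation with a single closed generator. -/
def cell (a : A.Obj) (n : ℤ) : Cells A where
  I := PUnit
  obj _ := a
  deg _ := n
  δ _ := 0
  rank _ := 0
  rank_lt _ _ h := absurd rfl h
  d_δ _ := map_zero _

/-- The free module with a single closed generator. -/
def cellMod (a : A.Obj) (n : ℤ) : DGModule.{u, u, u, u} A := (cell a n).sem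

/-- The generator of the free module with a single generator. -/
def cellGen (a : A.Obj) (n : ℤ) : (cellMod a n).X a n := (cell a n).e PUnit.unit

theorem hProj_cellMod (a : A.Obj) (n : ℤ) : HProj (cellMod a n) := Cells.hProj_sem (S := cell a n)

theorem d_cellGen (a : A.Obj) {n m : ℤ} (h : n + 1 = m) : (cellMod a n).d h (cellGen a n) = 0 := by
  subst h
  exact Cells.d_e (S := cell a n) _

theorem cellMod_homs_ext {a : A.Obj} {n r q : ℤ} (h : n + r = q) {φ ψ : (cellMod a n).homs M r}
    (e : app φ a h (cellGen a n) = app ψ a h (cellGen a n)) : φ = ψ := by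
  subst h
  exact Cells.homs_ext (S := cell a n) fun _ => e

theorem exists_app_cellGen {a : A.Obj} {n r q : ℤ} (h : n + r = q) (x : M.X a q) :
    ∃ φ : (cellMod a n).homs M r, app φ a h (cellGen a n) = x := by
  subst h
  exact ⟨Cells.lift (S := cell a n) fun _ => x,
    Cells.app_lift_e (S := cell a n) (fun _ => x) PUnit.unit⟩

theorem homsD_app_cellGen {a : A.Obj} {n r s q q' : ℤ} (h : n + r = q) (h' : n + s = q')
    (hr : r + 1 = s) (hq : q + 1 = q') (φ : (cellMod a n).homs M r) :
    app (homsD _ _ hr φ) a h' (cellGen a n) = M.d hq (app φ a h (cellGen a n)) := by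
  rw [homsD_apply hr φ h' h hq rfl (by omega), d_cellGen, map_zero, smul_zero, sub_zero]

theorem exists_cell_hom {a : A.Obj} {n m : ℤ} (h : n + 1 = m) (x : M.X a n) (hx : M.d h x = 0) :
    ∃ φ : (dgCat A).cocycles (cellMod a n) M 0,
      app (toHom φ) a (add_zero n) (cellGen a n) = x := by
  obtain ⟨φ, hφ⟩ := exists_app_cellGen (add_zero n) x
  refine ⟨ofHom φ (cellMod_homs_ext h ?_), hφ⟩
  rw [homsD_app_cellGen (add_zero n) h (zero_add 1) h, hφ, hx, app_zero]

/-- A morphism of DG modules which becomes invertible in the derived category is a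
quasi-isomorphism. -/
theorem qIsoAt_of_isIso {φ : (dgCat A).cocycles M N 0}
    (h : IsIso ((acyclicCone A).Q.map (homMk φ))) (a : A.Obj) : QIsoAt φ a := by
  -- For homotopically projective P, invertibility of φ in the derived category is already visible
  -- on homotopy classes of maps from P. The free module on one closed generator of degree n at a
  -- then detects the n-th cohomology at a.
  have hb : ∀ P : DGModule.{u, u, u, u} A, HProj P →
      Function.Bijective fun f : (⟨P⟩ : K A) ⟶ ⟨M⟩ => f ≫ homMk φ := by
    intro P hP
    have e : (fun f : (⟨P⟩ : K A) ⟶ ⟨N⟩ => (acyclicCone A).Q.map f) ∘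
        (fun f : (⟨P⟩ : K A) ⟶ ⟨M⟩ => f ≫ homMk φ) =
        (fun g => g ≫ (acyclicCone A).Q.map (homMk φ)) ∘ fun f => (acyclicCone A).Q.map f :=
      funext fun f => (acyclicCone A).Q.map_comp _ _
    have : Function.Bijective fun g : (acyclicCone A).Q.obj ⟨P⟩ ⟶ (acyclicCone A).Q.obj ⟨M⟩ =>
        g ≫ (acyclicCone A).Q.map (homMk φ) :=
      ⟨fun f g hfg => (cancel_mono ((acyclicCone A).Q.map (homMk φ))).1 hfg,
        fun g => ⟨g ≫ inv ((acyclicCone A).Q.map (homMk φ)), by simp⟩⟩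
    have := this.comp (hP.bijective_Q_map M)
    rw [← e] at this
    exact (Function.Bijective.of_comp_iff' (hP.bijective_Q_map N) _).1 this
  refine ⟨fun l n m hl hn x y hx hy => ?_, fun l n m hl hn y hy => ?_⟩
  · have hl' : n + -1 = l := by omega
    obtain ⟨f, hf⟩ := exists_cell_hom hn x hx
    obtain ⟨g, hg⟩ := exists_cell_hom hn (0 : M.X a n) (map_zero _)
    obtain ⟨β, hβ⟩ := exists_app_cellGen hl' y
    have := (hb _ (hProj_cellMod a n)).1 (a₁ := homMk f) (a₂ := homMk g)
      ((homMk_eq_iff_homsD _ _).2 ⟨β, cellMod_homs_ext (add_zero n) (by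
        rw [homsD_app_cellGen hl' _ _ hl, hβ, app_sub, app_toHom_zcomp, app_toHom_zcomp, hf, hg,
          hy, map_zero, sub_zero])⟩)
    obtain ⟨γ, hγ⟩ := (homMk_eq_iff_homsD _ _).1 this
    refine ⟨app γ a hl' (cellGen a n), ?_⟩
    rw [← homsD_app_cellGen hl' (add_zero n) (neg_add_cancel 1) hl, hγ, app_sub, hf, hg, sub_zero]
  · have hl' : n + -1 = l := by omega
    obtain ⟨g, hg⟩ := exists_cell_hom hn y hy
    obtain ⟨f, hf⟩ := (hb _ (hProj_cellMod a n)).2 (homMk g)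
    obtain ⟨f, rfl⟩ := homMk_surjective f
    obtain ⟨β, hβ⟩ := (homMk_eq_iff_homsD _ _).1 hf
    refine ⟨app (toHom f) a (add_zero n) (cellGen a n), -app β a hl' (cellGen a n), ?_, ?_⟩
    · rw [toHom_d, d_cellGen, map_zero]
    · rw [map_neg, ← homsD_app_cellGen hl' (add_zero n) (neg_add_cancel 1) hl, hβ, app_sub,
        app_toHom_zcomp, hg]
      abel

end

end DGCat

/-! ### Adjoints and counits from universal arrows -/

section Adjunction

variable {C : Type u₁} [Category.{v₁} C] {D : Type u₂} [Category.{v₂} D] {G : C ⥤ D}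

/-- A functor for which all objects have universal arrows has a left adjoint. -/
theorem Functor.isRightAdjoint_of_universal (h : ∀ Y : D, ∃ (L : C) (η : Y ⟶ G.obj L),
    ∀ X, Function.Bijective fun f : L ⟶ X => η ≫ G.map f) : G.IsRightAdjoint := by
  have : ∀ Y, Limits.HasInitial (StructuredArrow Y G) := fun Y => by
    obtain ⟨L, η, hη⟩ := h Y
    exact Limits.IsInitial.hasInitial (X := StructuredArrow.mk η) <|
      Limits.IsInitial.ofUniqueHom
        (fun Z => StructuredArrow.homMk ((hη Z.right).2 Z.hom).choose
          ((hη Z.right).2 Z.hom).choose_spec)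
        (fun Z m => StructuredArrow.ext _ _ <| (hη Z.right).1 <|
          (StructuredArrow.w m).trans ((hη Z.right).2 Z.hom).choose_spec.symm)
  exact isRightAdjointOfStructuredArrowInitials G

/-- Comparison of the counit of an adjunction with a universal arrow. -/
theorem Adjunction.exists_iso_of_universal {F : D ⥤ C} (adj : F ⊣ G) {X L : C}
    (η : G.obj X ⟶ G.obj L) (h : ∀ T, Function.Bijective fun f : L ⟶ T => η ≫ G.map f)
    (σ : L ⟶ X) (hσ : η ≫ G.map σ = 𝟙 _) :
    ∃ e : F.obj (G.obj X) ≅ L, e.hom ≫ σ = adj.counit.app X := by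
  let e := (adj.homEquiv _ _).symm η
  obtain ⟨e', he'⟩ := (h (F.obj (G.obj X))).2 (adj.unit.app (G.obj X))
  have hη : adj.unit.app (G.obj X) ≫ G.map e = η := by
    simp [e, Adjunction.homEquiv_counit]
  have h₁ : e ≫ e' = 𝟙 _ := by
    apply (adj.homEquiv _ _).injective
    rw [adj.homEquiv_unit, adj.homEquiv_unit, G.map_comp, ← Category.assoc, hη]
    simpa using he'
  have h₂ : e' ≫ e = 𝟙 _ := by
    apply (h L).1
    simp only [G.map_comp, G.map_id, Category.comp_id] at he' ⊢
    rw [← Category.assoc, he', hη]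
  refine ⟨⟨e, e', h₁, h₂⟩, ?_⟩
  apply (adj.homEquiv _ _).injective
  rw [adj.homEquiv_unit, adj.homEquiv_unit, G.map_comp, ← Category.assoc, hη, hσ]
  simp

end Adjunction

/-! ### Derived induction from a full DG subcategory -/

namespace DGCat

open DGModule

section

variable {k : Type u} [CommRing k] {A C : DGCat.{u, u, u} k}

theorem exists_toDerived (X : Derived A) : ∃ M, toDerived A M = X :=
  ⟨((Localization.Construction.objEquiv (acyclicCone A)).symm X).as, rfl⟩

/-- Closed morphisms of degree `0`, in the derived category. -/
noncomputable def dmap {M N : DGModule.{u, u, u, u} A} (φ : (dgCat A).cocycles M N 0) :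
    toDerived A M ⟶ toDerived A N := (acyclicCone A).Q.map (homMk φ)

theorem dmap_comp {M N P : DGModule.{u, u, u, u} A} (φ : (dgCat A).cocycles M N 0)
    (ψ : (dgCat A).cocycles N P 0) :
    dmap φ ≫ dmap ψ = dmap (zcomp (A := dgCat A) (zero_add 0) ψ φ) :=
  ((acyclicCone A).Q.map_comp _ _).symm

theorem resDerived_map (F : DGFunctor A C) {M N : K C} (f : M ⟶ N) :
    (resDerived F).map ((acyclicCone C).Q.map f) =
      (acyclicCone A).Q.map ((res F).ho.map f) := by
  have := Functor.congr_hom (Localization.Construction.fac _ (acyclicCone_res F)) f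
  exact this.trans ((Category.id_comp _).trans (Category.comp_id _))

theorem resDerived_dmap (F : DGFunctor A C) {M N : DGModule.{u, u, u, u} C}
    (φ : (dgCat C).cocycles M N 0) :
    (resDerived F).map (dmap φ) = dmap ((res F).zmap φ) := resDerived_map F _

variable {B : Set A.Obj}

/-- A presentation of a semi-free module over a full DG subcategory, regarded over the ambient DG
category. -/
def Cells.incl (S : Cells (A.full B)) : Cells A where
  I := S.I
  obj i := (S.obj i).1
  deg := S.deg
  δ := S.δ
  rank := S.rank
  rank_lt := S.rank_lt
  d_δ := S.d_δ

namespace Cells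

variable (S : Cells (A.full B)) (M : DGModule.{u, u, u, u} A)

/-- The underived adjunction Hom_A(Ind S, M) = Hom_B(S, Res M): either side is a free choice of
values on the generators, and these sit at objects of B. -/
theorem bijective_restrictHom (n : ℤ) :
    Function.Bijective (restrictHom (A.incl B) S.incl.sem M n) := by
  constructor
  · intro φ ψ h
    exact homs_ext (S := S.incl) fun i =>
      congrArg (fun γ : S.sem.homs (restrict (A.incl B) M) n => app γ (S.obj i) rfl (S.e i)) h
  · intro φ
    refine ⟨lift (S := S.incl) fun i =>
      app (show S.sem.homs (restrict (A.incl B) M) n from φ) (S.obj i) rfl (S.e i), ?_⟩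
    exact homs_ext (S := S) fun i => app_lift_e (S := S.incl) _ i

theorem homsD_restrictHom {N : DGModule.{u, u, u, u} A} {n m : ℤ} (h : n + 1 = m)
    (φ : N.homs M n) :
    restrictHom (A.incl B) N M m (homsD _ _ h φ) =
      homsD _ _ h (restrictHom (A.incl B) N M n φ) := rfl

variable {M} in
theorem exists_zmap_eq (φ : (dgCat (A.full B)).cocycles S.sem (restrict (A.incl B) M) 0) :
    ∃ ψ : (dgCat A).cocycles S.incl.sem M 0, (res (A.incl B)).zmap ψ = φ := by
  obtain ⟨ψ, hψ⟩ := (S.bijective_restrictHom M 0).2 (toHom φ)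
  refine ⟨ofHom ψ ((S.bijective_restrictHom M 1).1 ?_), Subtype.ext hψ⟩
  rw [homsD_restrictHom, hψ, map_zero]
  exact homsD_toHom φ _

theorem bijective_res_ho : Function.Bijective
    fun f : (⟨S.incl.sem⟩ : K A) ⟶ ⟨M⟩ => (res (A.incl B)).ho.map f := by
  constructor
  · intro f g h
    obtain ⟨f, rfl⟩ := homMk_surjective f
    obtain ⟨g, rfl⟩ := homMk_surjective g
    obtain ⟨β, hβ⟩ := (homMk_eq_iff_homsD ((res (A.incl B)).zmap f) ((res (A.incl B)).zmap g)).1 h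
    obtain ⟨γ, rfl⟩ := (S.bijective_restrictHom M (-1)).2 β
    exact (homMk_eq_iff_homsD _ _).2 ⟨γ, (S.bijective_restrictHom M 0).1 hβ⟩
  · intro f
    obtain ⟨f, rfl⟩ := homMk_surjective f
    obtain ⟨g, rfl⟩ := S.exists_zmap_eq f
    exact ⟨homMk g, rfl⟩

/-- Both the semi-free B-module and its induction are homotopically projective, so morphisms out of
them in the derived categories are homotopy classes and the underived adjunction applies. -/
theorem bijective_resDerived (X : Derived A) : Function.Bijective
    fun f : toDerived A S.incl.sem ⟶ X => (resDerived (A.incl B)).map f := by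
  obtain ⟨M, rfl⟩ := exists_toDerived X
  have h₁ := (S.incl.hProj_sem).bijective_Q_map M
  have h₂ := (S.hProj_sem).bijective_Q_map (restrict (A.incl B) M)
  have h₃ := h₂.comp (S.bijective_res_ho M)
  refine (Function.Bijective.of_comp_iff _ h₁).1 ?_
  exact (congrArg Function.Bijective (funext fun f => resDerived_map (A.incl B) f)).mpr h₃

end Cells

variable (B) in
/-- Restriction to a full DG subcategory has a left adjoint. -/
theorem isRightAdjoint_resDerived : (resDerived (A.incl B)).IsRightAdjoint := by
  refine Functor.isRightAdjoint_of_universal fun Y => ?_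
  obtain ⟨N, rfl⟩ := exists_toDerived Y
  let S := resolutionCells N
  have : IsIso (dmap (resolution N)) := isIso_Q_map (qIsoAt_resolution N)
  let η : toDerived (A.full B) N ⟶ toDerived (A.full B) S.sem := inv (dmap (resolution N))
  refine ⟨toDerived A S.incl.sem, η, fun X => ?_⟩
  have : Function.Bijective fun f : toDerived (A.full B) S.sem ⟶ (resDerived (A.incl B)).obj X => η ≫ f :=
    ⟨fun f g h => (cancel_epi η).1 h, fun f => ⟨inv η ≫ f, by simp⟩⟩
  exact this.comp (S.bijective_resDerived X)

/-- A DG module has a resolution relative to a full DG subcategory. -/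
theorem exists_relative_resolution (B : Set A.Obj) (M : DGModule.{u, u, u, u} A) :
    ∃ (S : Cells (A.full B)) (σ : (dgCat A).cocycles S.incl.sem M 0), ∀ b ∈ B, QIsoAt σ b := by
  obtain ⟨σ, hσ⟩ := (resolutionCells (restrict (A.incl B) M)).exists_zmap_eq
    (resolution (restrict (A.incl B) M))
  refine ⟨_, σ, fun b hb => ?_⟩
  have h := qIsoAt_resolution (restrict (A.incl B) M) ⟨b, hb⟩
  rw [← hσ] at h
  exact ⟨h.inj, h.surj⟩

/-- The counit of derived induction and restriction is a relative resolution. -/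
theorem exists_iso_counit {F : Derived (A.full B) ⥤ Derived A}
    (adj : F ⊣ resDerived (A.incl B)) {M : DGModule.{u, u, u, u} A} {S : Cells (A.full B)}
    (σ : (dgCat A).cocycles S.incl.sem M 0) (hσ : ∀ b ∈ B, QIsoAt σ b) :
    ∃ e : F.obj ((resDerived (A.incl B)).obj (toDerived A M)) ≅ toDerived A S.incl.sem,
      e.hom ≫ dmap σ = adj.counit.app (toDerived A M) := by
  -- Restricted to B, σ becomes invertible, and its inverse is a universal arrow from Res M; the
  -- morphism corresponding to the identity of Res M is then σ itself, which is therefore the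
  -- counit.
  have : IsIso ((resDerived (A.incl B)).map (dmap σ)) := by
    rw [resDerived_dmap]
    exact isIso_Q_map fun b => ⟨(hσ b.1 b.2).inj, (hσ b.1 b.2).surj⟩
  refine Adjunction.exists_iso_of_universal adj (inv ((resDerived (A.incl B)).map (dmap σ)))
    (fun T => ?_) (dmap σ) (by simp)
  have h : Function.Bijective fun f : (resDerived (A.incl B)).obj (toDerived A S.incl.sem) ⟶
      (resDerived (A.incl B)).obj T => inv ((resDerived (A.incl B)).map (dmap σ)) ≫ f :=
    ⟨fun f g h => (cancel_epi (inv ((resDerived (A.incl B)).map (dmap σ)))).1 h,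
      fun f => ⟨(resDerived (A.incl B)).map (dmap σ) ≫ f, by simp⟩⟩
  exact h.comp (S.bijective_resDerived T)

end

end DGCat

namespace DGModule

section Extension

variable {k : Type u} [CommRing k]

/-! ### Extension of DG modules to one-sided twisted complexes -/

theorem d_castDeg {A : DGCat.{u, u, u} k} (M : DGModule.{u, u, u, u} A) {a : A.Obj}
    {n m n' m' : ℤ} (h : n = m) (h' : n' = m') (hn : n + 1 = n') (hm : m + 1 = m') (x : M.X a n) :
    M.d hm (M.castDeg h x) = M.castDeg h' (M.d hn x) := by
  subst h h'
  rfl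

theorem act_castDeg {A : DGCat.{u, u, u} k} (M : DGModule.{u, u, u, u} A) {a b : A.Obj}
    {q p n q' p' n' : ℤ} (hq : q = q') (hp : p = p') (hn : n = n') (h : q + p = n)
    (h' : q' + p' = n') (x : M.X b q) (f : A.Hom a b p) :
    M.act h' (M.castDeg hq x) (A.castDeg hp f) = M.castDeg hn (M.act h x f) := by
  subst hq hp hn
  rfl

/-- The extension of a right DG module to formal direct sums of shifts. -/
def extSum {A : DGCat.{u, u, u} k} (M : DGModule.{u, u, u, u} A) :
    DGModule.{u, u, u, u} A.formalSums where
  X z n := ∀ j : Fin z.n, M.X (z.obj j) (n - z.deg j)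
  d h :=
    { toFun := fun x j => M.d (by omega) (x j)
      map_add' := fun x y => by
        funext j
        simp
      map_smul' := fun c x => by
        funext j
        simp }
  act {y z q p n} h :=
    LinearMap.mk₂ k
      (fun x f j => ∑ i : Fin z.n, M.act (by omega) (x i) (f i j))
      (fun x x' f => by
        funext j
        simp [Finset.sum_add_distrib])
      (fun c x f => by
        funext j
        simp [Finset.smul_sum])
      (fun x f f' => by
        funext j
        refine (Finset.sum_congr rfl fun i _ => map_add (M.act _ (x i)) (f i j) (f' i j)).trans ?_
        exact Finset.sum_add_distrib)
      (fun c x f => by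
        funext j
        refine (Finset.sum_congr rfl fun i _ => map_smul (M.act _ (x i)) c (f i j)).trans ?_
        exact Finset.smul_sum.symm)
  d_d h h' x := by
    funext j
    exact M.d_d _ _ _
  act_one {z n} x := by
    funext j
    change ∑ i : Fin z.n, M.act _ (x i)
      (if h : j = i then A.eqHom (congrArg z.obj h) (by rw [h]; omega) else 0) = x j
    rw [Finset.sum_eq_single j]
    · rw [dif_pos rfl]
      have : ∀ (p : ℤ) (hp : p = 0) (h : n - z.deg j + p = n - z.deg j),
          M.act h (x j) (A.eqHom rfl hp) = x j := by
        rintro _ rfl _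
        exact M.act_one _
      exact this _ _ _
    · intro i _ hi
      rw [dif_neg (Ne.symm hi), map_zero]
    · simp
  act_act {x y z r q p rq qp n} h₁ h₂ h₃ h₄ e g f := by
    funext j
    change ∑ i, M.act _ (∑ l, M.act _ (e l) (g l i)) (f i j) =
      ∑ l, M.act _ (e l) (∑ i, A.comp _ (g l i) (f i j))
    simp only [map_sum, LinearMap.sum_apply]
    rw [Finset.sum_comm]
    exact Finset.sum_congr rfl fun l _ => Finset.sum_congr rfl fun i _ => M.act_act _ _ _ _ _ _ _
  leibniz {y z q p n q' p' n'} h hn hq hp h₁ h₂ x f := by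
    funext j
    change M.d _ (∑ i, M.act _ (x i) (f i j)) = ∑ i, M.act _ (M.d _ (x i)) (f i j) +
      q.negOnePow • ∑ i, M.act _ (x i) ((z.deg i).negOnePow • A.d _ (f i j))
    rw [map_sum, Finset.smul_sum, ← Finset.sum_add_distrib]
    refine Finset.sum_congr rfl fun i _ => ?_
    rw [M.leibniz (q' := q' - z.deg i) (p' := p' + z.deg i - y.deg j) _ _ (by omega) (by omega)
      (by omega) (by omega), DGCat.apply_smul₂, smul_smul, ← Int.negOnePow_add]
    congr 2
    rw [Int.negOnePow_eq_iff]
    exact ⟨-z.deg i, by ring⟩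

/-- The two occurrences of x q_Z f, one from the twisted differential of x and one from that of f,
cancel; the rest is the Leibniz rule of M. -/
theorem leibniz_twist {E : DGCat.{u, u, u} k} (M : DGModule.{u, u, u, u} E) {Y Z : E.Obj} {q p : ℤ}
    (qY : E.Hom Y Y 1) (qZ : E.Hom Z Z 1) (x : M.X Z q) (f : E.Hom Y Z p) :
    M.d (rfl : q + p + 1 = q + p + 1) (M.act rfl x f) -
      (q + p).negOnePow • M.act rfl (M.act (rfl : q + p = q + p) x f) qY =
    M.act (by omega) (M.d (rfl : q + 1 = q + 1) x - q.negOnePow • M.act rfl x qZ) f +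
      q.negOnePow • M.act (by omega) x (E.d (rfl : p + 1 = p + 1) f + E.comp (by omega) qZ f -
        p.negOnePow • E.comp rfl f qY) := by
  simp only [map_add, map_sub, LinearMap.sub_apply, DGCat.smul_apply₂, DGCat.apply_smul₂,
    smul_add, smul_sub, smul_smul]
  rw [M.leibniz rfl rfl rfl rfl (by omega : q + 1 + p = q + p + 1)
    (by omega : q + (p + 1) = q + p + 1) x f,
    M.act_act rfl (by omega : q + 1 + p = q + p + 1) (by omega : (1 : ℤ) + p = p + 1)
    (by omega : q + (p + 1) = q + p + 1),
    M.act_act rfl (by omega : q + p + 1 = q + p + 1) (rfl : p + 1 = p + 1) (by omega),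
    Int.negOnePow_add]
  abel

/-- The extension of a right DG module to objects with a twisting morphism. -/
def extTwist {E : DGCat.{u, u, u} k} (M : DGModule.{u, u, u, u} E) :
    DGModule.{u, u, u, u} E.twist where
  X z n := M.X z.X n
  d {z n m} h := M.d h - n.negOnePow • (M.act (by omega : n + 1 = m)).flip z.q
  act h := M.act h
  d_d {z n m l} h h' x := by
    subst h
    obtain rfl : l = n + 2 := by omega
    have hz := z.maurerCartan
    rw [add_eq_zero_iff_eq_neg] at hz
    simp only [LinearMap.sub_apply, LinearMap.smul_apply,
      LinearMap.flip_apply, map_sub, M.d_d, LinearMap.map_smul_of_tower]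
    rw [M.leibniz rfl (by omega) rfl (rfl : (1 : ℤ) + 1 = 2) (by omega : n + 1 + 1 = n + 2) rfl,
      hz, M.act_act rfl (by omega : n + 1 + 1 = n + 2) (by omega : (1 : ℤ) + 1 = 2) (by omega)]
    simp only [Int.negOnePow_succ, map_neg, smul_add,
      smul_neg, smul_smul, neg_mul, Units.neg_smul, Int.units_mul_self, one_smul]
    abel
  act_one := M.act_one
  act_act := M.act_act
  leibniz {y z q p n q' p' n'} h hn hq hp h₁ h₂ x f := by
    subst hq hp hn h
    exact M.leibniz_twist _ _ _ _

end Extension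

end DGModule

namespace DGCat

open DGModule

variable {k : Type u} [CommRing k] {A : DGCat.{u, u, u} k}

/-- The extension of a right DG module to one-sided twisted complexes. -/
def ext (M : DGModule.{u, u, u, u} A) : DGModule.{u, u, u, u} A.pretr :=
  restrict (A.formalSums.twist.incl _) M.extSum.extTwist

section

variable {M N : DGModule.{u, u, u, u} A} {z z' : A.pretr.Obj}

/-- The coordinates of an element of the extension of a DG module to a twisted complex. -/
def coord {n : ℤ} (j : Fin z.1.X.n) : (ext M).X z n →ₗ[k] M.X (z.1.X.obj j) (n - z.1.X.deg j) :=
  LinearMap.proj (R := k) (φ := fun j : Fin z.1.X.n => M.X (z.1.X.obj j) (n - z.1.X.deg j)) j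

/-- The element with given coordinates. -/
def extMk {n : ℤ} (x : ∀ j : Fin z.1.X.n, M.X (z.1.X.obj j) (n - z.1.X.deg j)) :
    (ext M).X z n := x

theorem coord_ext {n : ℤ} {x y : (ext M).X z n} (h : ∀ j, coord j x = coord j y) : x = y := funext h

theorem coord_d {n m : ℤ} (h : n + 1 = m) (x : (ext M).X z n) (j : Fin z.1.X.n) :
    coord j ((ext M).d h x) = M.d (by omega) (coord j x) -
      n.negOnePow • ∑ i, M.act (by omega) (coord i x) (z.1.q i j) := rfl

theorem coord_act {q p n : ℤ} (h : q + p = n) (x : (ext M).X z q) (f : A.pretr.Hom z' z p)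
    (j : Fin z'.1.X.n) :
    coord j ((ext M).act h x f) = ∑ i, M.act (by omega) (coord i x) (f i j) := rfl

end

end DGCat

namespace DGModule

section

variable {k : Type w} [CommRing k] {A : DGCat.{w, u, v} k} {M N : DGModule.{w, u, v, u₁} A}

theorem castDeg_castDeg (M : DGModule.{w, u, v, u₁} A) {a : A.Obj} {n m l : ℤ} (h : n = m)
    (h' : m = l) (x : M.X a n) : M.castDeg h' (M.castDeg h x) = M.castDeg (h.trans h') x := by
  subst h h'
  rfl

theorem castDeg_act (M : DGModule.{w, u, v, u₁} A) {a b : A.Obj} {q p n q' p' n' : ℤ} (hq : q = q')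
    (hp : p' = p) (hn : n = n') (h : q + p = n) (h' : q' + p' = n') (x : M.X b q)
    (f : A.Hom a b p') :
    M.castDeg hn (M.act h x (A.castDeg hp f)) = M.act h' (M.castDeg hq x) f := by
  subst hq hp hn
  rfl

theorem app_castDeg {n : ℤ} (φ : M.homs N n) {a : A.Obj} {p q p' q' : ℤ} (hp : p = p')
    (hq : q = q') (h : p + n = q) (h' : p' + n = q') (x : M.X a p) :
    app φ a h' (M.castDeg hp x) = N.castDeg hq (app φ a h x) := by
  subst hp hq
  rfl

/-- A morphism of degree `0` commuting with the differentials is closed. -/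
theorem homsD_eq_zero {φ : M.homs N 0} (hφ : ∀ (a : A.Obj) (p q : ℤ) (h : p + 1 = q) (x : M.X a p),
    N.d h (app φ a (add_zero p) x) = app φ a (add_zero q) (M.d h x)) :
    homsD M N (zero_add 1) φ = 0 :=
  homs_ext fun a p q hq x => by
    rw [homsD_apply (zero_add 1) φ hq (add_zero p) hq hq (add_zero q), hφ, Int.negOnePow_zero,
      one_smul, sub_self, app_zero]

/-- Exactness of a right DG module at an object is invariant under homotopy equivalence. -/
theorem ExactAt.of_iso {M : DGModule.{w, u, v, u₁} A} {X Y : A.Obj}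
    (e : DGCat.Ho.mk X ≅ DGCat.Ho.mk Y) (hM : M.ExactAt X) : M.ExactAt Y := by
  intro l n m hl hn x hx
  obtain ⟨f, hf⟩ := DGCat.homMk_surjective e.hom
  obtain ⟨g, hg⟩ := DGCat.homMk_surjective e.inv
  have hfg : DGCat.homMk g ≫ DGCat.homMk f = DGCat.homMk ⟨A.one Y, DGCat.one_mem_cocycles Y⟩ := by
    rw [hf, hg]
    exact e.inv_hom_id
  obtain ⟨h, hh⟩ := (DGCat.homMk_eq_iff _ _).1 hfg
  have hf' := (DGCat.mem_cocycles (zero_add 1)).1 f.2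
  have hg' := (DGCat.mem_cocycles (zero_add 1)).1 g.2
  obtain ⟨y, hy⟩ := hM l n m hl hn (M.act (add_zero n) x f.1) (by
    rw [M.leibniz (add_zero n) hn hn (zero_add 1) (add_zero m) hn, hx, hf', map_zero,
      LinearMap.zero_apply, map_zero, smul_zero, add_zero])
  refine ⟨M.act (add_zero l) y g.1 - n.negOnePow • M.act (by omega : n + -1 = l) x h, ?_⟩
  have hh' : A.d (neg_add_cancel 1) h = A.comp (add_zero 0) f.1 g.1 - A.one Y := hh
  rw [map_sub, M.leibniz (add_zero l) hl hl (zero_add 1) (add_zero n) hl, hy, hg', map_zero,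
    smul_zero, add_zero, LinearMap.map_smul_of_tower,
    M.leibniz (by omega : n + -1 = l) hl hn (neg_add_cancel 1) (by omega) (add_zero n), hx,
    map_zero, LinearMap.zero_apply, zero_add, hh', smul_smul, Int.units_mul_self, one_smul, map_sub,
    M.act_one, M.act_act (add_zero n) (add_zero n) (add_zero 0) (add_zero n)]
  abel

end

end DGModule

namespace DGCat

open DGModule

section

variable {k : Type u} [CommRing k] {A : DGCat.{u, u, u} k} {M N : DGModule.{u, u, u, u} A}
  {X Y z : A.pretr.Obj}

/-! ### Functoriality and exactness of the extension -/

/-- The extension of a closed morphism of degree `0` to twisted complexes, as a family of maps. -/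
def extHom (φ : (dgCat A).cocycles M N 0) : (ext M).homs (ext N) 0 :=
  mkHom (M := ext M) (N := ext N)
    (fun z p q hq =>
      { toFun := fun x => extMk fun j => app (toHom φ) _ (by omega) (coord j x)
        map_add' := fun x y => coord_ext fun j => map_add (app (toHom φ) _ _) (coord j x) (coord j y)
        map_smul' := fun c x => coord_ext fun j => map_smul (app (toHom φ) _ _) c (coord j x) })
    (fun z z' p q r s t hq hs hr hs' x f => coord_ext fun j =>
      (map_sum (app (toHom φ) (z.1.X.obj j) (p := r - z.1.X.deg j) (q := s - z.1.X.deg j) (by omega))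
        (fun i => M.act (by omega) (coord i x) (f i j)) Finset.univ).trans
        (Finset.sum_congr rfl fun i _ =>
          app_act (toHom φ) _ _ _ _ (coord i x) (f i j)))

theorem coord_extHom (φ : (dgCat A).cocycles M N 0) {p q : ℤ} (hq : p + 0 = q) (x : (ext M).X z p)
    (j : Fin z.1.X.n) :
    coord j (app (extHom φ) z hq x) = app (toHom φ) _ (by omega) (coord j x) := rfl

/-- The extension of a closed morphism of degree `0` to twisted complexes. -/
def extMap (φ : (dgCat A).cocycles M N 0) : (dgCat A.pretr).cocycles (ext M) (ext N) 0 :=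
  ofHom (extHom φ) (homsD_eq_zero fun z p q h x => coord_ext fun j => by
    rw [coord_d, coord_extHom, coord_extHom, coord_d, map_sub, toHom_d φ,
      LinearMap.map_smul_of_tower, map_sum]
    congr 2
    refine Finset.sum_congr rfl fun i _ => ?_
    rw [coord_extHom]
    exact (app_act (toHom φ) _ _ _ _ (coord i x) (z.1.q i j)).symm)

theorem coord_extMap (φ : (dgCat A).cocycles M N 0) {p : ℤ} (x : (ext M).X z p)
    (j : Fin z.1.X.n) :
    coord j (app (toHom (extMap φ)) z (add_zero p) x) =
      app (toHom φ) _ (add_zero _) (coord j x) := rfl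

/-- The extension of a DG module is exact at a twisted complex if the module is exact at all the
summands. -/
theorem exactAt_ext (h : ∀ j, M.ExactAt (z.1.X.obj j)) : (ext M).ExactAt z := by
  intro l n m hl hn x hx
  -- One-sidedness of the twisted complex makes the differential triangular for the order on the
  -- summands, with that of M on the diagonal.
  have key : ∀ {p q : ℤ} (h : p + 1 = q) (j : Fin z.1.X.n) (y : (ext M).X z p),
      (∀ i < j, coord i y = 0) → coord j ((ext M).d h y) = M.d (by omega) (coord j y) := by
    intro p q h j y hy
    rw [coord_d, Finset.sum_eq_zero, smul_zero, sub_zero]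
    intro i _
    rcases lt_or_ge i j with hij | hij
    · rw [hy i hij, map_zero, LinearMap.zero_apply]
    · rw [z.2 i j hij]
      exact map_zero _
  exact exists_of_triangular (I := Fin z.1.X.n) (· < ·) wellFounded_lt (fun _ _ _ => lt_trans)
    (U := fun j => M.X (z.1.X.obj j) (l - z.1.X.deg j))
    (V := fun j => M.X (z.1.X.obj j) (n - z.1.X.deg j))
    (W := fun j => M.X (z.1.X.obj j) (m - z.1.X.deg j))
    ((ext M).d hl).toAddMonoidHom ((ext M).d hn).toAddMonoidHom
    (fun j => (M.d (by omega)).toAddMonoidHom) (fun j => (M.d (by omega)).toAddMonoidHom)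
    (fun j y hy => key hl j y hy) (fun j y hy => key hn j y hy)
    (fun y => (ext M).d_d hl hn y) (fun j y hy => h j _ _ _ _ _ y hy) x hx

/-! ### The extension at a cone of twisted complexes -/

variable (f : A.pretr.cocycles X Y 0)

/-- Coordinates on the extension of a DG module to the cone of a morphism of twisted complexes. -/
def coneEquiv (M : DGModule.{u, u, u, u} A) (n : ℤ) :
    (∀ s : Fin Y.1.X.n ⊕ Fin X.1.X.n, M.X (Sum.elim Y.1.X.obj X.1.X.obj s)
      (n - Sum.elim Y.1.X.deg (fun i => X.1.X.deg i + 1) s)) ≃ₗ[k] (ext M).X (pretrCone f) n :=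
  LinearEquiv.piCongrLeft' k _ finSumFinEquiv

/-- The coordinates on the cone of a morphism of twisted complexes. -/
def sumCoord {n : ℤ} (s : Fin Y.1.X.n ⊕ Fin X.1.X.n) :
    (ext M).X (pretrCone f) n →ₗ[k] M.X (Sum.elim Y.1.X.obj X.1.X.obj s)
      (n - Sum.elim Y.1.X.deg (fun i => X.1.X.deg i + 1) s) :=
  LinearMap.proj s ∘ₗ (coneEquiv f M n).symm.toLinearMap

theorem coord_eq_sumCoord {n : ℤ} (x : (ext M).X (pretrCone f) n) (j : Fin (pretrCone f).1.X.n) :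
    coord j x = sumCoord f (finSumFinEquiv.symm j) x :=
  (congrFun ((coneEquiv f M n).apply_symm_apply x) j).symm

theorem sumCoord_d {n m : ℤ} (h : n + 1 = m) (x : (ext M).X (pretrCone f) n)
    (s : Fin Y.1.X.n ⊕ Fin X.1.X.n) :
    sumCoord f s ((ext M).d h x) = M.d (by omega) (sumCoord f s x) -
      n.negOnePow • ∑ t, M.act (by omega) (sumCoord f t x) (coneMatrix X.1.q Y.1.q f.1 t s) := by
  obtain ⟨j, rfl⟩ := finSumFinEquiv.symm.surjective s
  refine (coord_eq_sumCoord f _ j).symm.trans ((coord_d h x j).trans ?_)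
  refine congrArg₂ (· - ·) (congrArg _ (coord_eq_sumCoord f x j)) (congrArg _ ?_)
  rw [← Equiv.sum_comp (finSumFinEquiv (m := Y.1.X.n) (n := X.1.X.n)).symm]
  refine Finset.sum_congr rfl fun i _ => ?_
  rw [coord_eq_sumCoord f x i]
  rfl

/-- The first component of an element of the extension to a cone. -/
def cfst {n : ℤ} : (ext M).X (pretrCone f) n →ₗ[k] (ext M).X Y n :=
  LinearMap.pi fun j => sumCoord f (.inl j)

/-- The second component of an element of the extension to a cone. -/
def csnd {l n : ℤ} (h : l + 1 = n) : (ext M).X (pretrCone f) n →ₗ[k] (ext M).X X l :=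
  LinearMap.pi fun j =>
    M.castDeg (by change n - (X.1.X.deg j + 1) = l - X.1.X.deg j; omega) ∘ₗ sumCoord f (.inr j)

theorem coord_cfst {n : ℤ} (x : (ext M).X (pretrCone f) n) (j : Fin Y.1.X.n) :
    coord j (cfst f x) = sumCoord f (.inl j) x := rfl

theorem coord_csnd {l n : ℤ} (h : l + 1 = n) (x : (ext M).X (pretrCone f) n) (j : Fin X.1.X.n) :
    coord j (csnd f h x) =
      M.castDeg (by simp only [Sum.elim_inr]; omega) (sumCoord f (.inr j) x) := rfl

theorem exists_cpair {l n : ℤ} (h : l + 1 = n) (y : (ext M).X Y n) (x : (ext M).X X l) :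
    ∃ w : (ext M).X (pretrCone f) n, cfst f w = y ∧ csnd f h w = x := by
  let w' : ∀ s : Fin Y.1.X.n ⊕ Fin X.1.X.n, M.X (Sum.elim Y.1.X.obj X.1.X.obj s)
      (n - Sum.elim Y.1.X.deg (fun i => X.1.X.deg i + 1) s) := fun
    | .inl j => coord j y
    | .inr j => M.castDeg (by change _ = n - (X.1.X.deg j + 1); omega) (coord j x)
  have hw : ∀ s, sumCoord f s (coneEquiv f M n w') = w' s := fun s =>
    congrFun ((coneEquiv f M n).symm_apply_apply w') s
  refine ⟨coneEquiv f M n w', coord_ext fun j => hw (.inl j), coord_ext fun j => ?_⟩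
  refine (congrArg _ (hw (.inr j))).trans ?_
  exact M.castDeg_castDeg _ _ (coord j x)

theorem cpair_ext {l n : ℤ} (h : l + 1 = n) {w w' : (ext M).X (pretrCone f) n}
    (h₁ : cfst f w = cfst f w') (h₂ : csnd f h w = csnd f h w') : w = w' := by
  have : ∀ s, sumCoord f s w = sumCoord f s w' := by
    rintro (j | j)
    · exact congrArg (coord j) h₁
    · have e := congrArg (coord j) h₂
      rw [coord_csnd, coord_csnd] at e
      have e' := congrArg (M.castDeg
        (by change _ = n - (X.1.X.deg j + 1); omega : l - X.1.X.deg j =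
          n - Sum.elim Y.1.X.deg (fun i => X.1.X.deg i + 1) (.inr j))) e
      rwa [castDeg_castDeg, castDeg_castDeg] at e'
  exact coord_ext fun j => by rw [coord_eq_sumCoord, coord_eq_sumCoord, this]

theorem cfst_d {n m : ℤ} (h : n + 1 = m) (w : (ext M).X (pretrCone f) n) :
    cfst f ((ext M).d h w) = (ext M).d h (cfst f w) := by
  refine coord_ext fun j => ?_
  rw [coord_cfst, coord_d, sumCoord_d, Fintype.sum_sum_type,
    Finset.sum_eq_zero (s := (Finset.univ : Finset (Fin X.1.X.n))) fun i _ => ?_, add_zero]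
  · rfl
  · exact map_zero _

/-- With `cfst_d`, this exhibits ext M at the cone of f as an extension of ext M at Y by the shift
by -1 of ext M at X; up to sign, the connecting map is the action of f. -/
theorem csnd_d {l n m : ℤ} (hl : l + 1 = n) (h : n + 1 = m) (w : (ext M).X (pretrCone f) n) :
    csnd f h ((ext M).d h w) = (ext M).d hl (csnd f hl w) -
      n.negOnePow • (ext M).act (add_zero n) (cfst f w) f.1 := by
  refine coord_ext fun j => ?_
  have hj : m - Sum.elim Y.1.X.deg (fun i => X.1.X.deg i + 1) (.inr j) = n - X.1.X.deg j := by
    change m - (X.1.X.deg j + 1) = _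
    omega
  have aux : ∀ {G : Type u} [AddCommGroup G] (a b c : G) (t : ℤˣ),
      a - -(t • (b + -c)) = a - t • c - -(t • b) := fun a b c t => by
    rw [smul_add, smul_neg]
    abel
  have h₁ : M.castDeg hj (M.d (n := n - (X.1.X.deg j + 1))
      (by change _ = m - (X.1.X.deg j + 1); omega) (sumCoord f (.inr j) w)) =
      M.d (by omega) (coord j (csnd f hl w)) :=
    (M.d_castDeg _ hj _ _ _).symm
  have h₂ : ∀ i, M.castDeg hj (M.act (p := 1 + Y.1.X.deg i - (X.1.X.deg j + 1))
        (by change n - Y.1.X.deg i + _ = m - (X.1.X.deg j + 1); omega) (sumCoord f (.inl i) w)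
        (A.castDeg (by omega) (f.1 i j))) =
      M.act (by omega) (coord i (cfst f w)) (f.1 i j) := fun i =>
    M.castDeg_act rfl _ hj _ _ (sumCoord f (.inl i) w) (f.1 i j)
  have h₃ : ∀ i, M.castDeg hj (M.act (p := 1 + (X.1.X.deg i + 1) - (X.1.X.deg j + 1))
        (by change n - (X.1.X.deg i + 1) + _ = m - (X.1.X.deg j + 1); omega) (sumCoord f (.inr i) w)
        (-A.castDeg (by omega) (X.1.q i j))) =
      -M.act (by omega) (coord i (csnd f hl w)) (X.1.q i j) := fun i =>
    (congrArg (M.castDeg hj) (map_neg (M.act _ _) _)).trans ((map_neg (M.castDeg hj) _).trans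
      (congrArg Neg.neg (M.castDeg_act _ _ hj _ _ (sumCoord f (.inr i) w) (X.1.q i j))))
  rw [coord_csnd, sumCoord_d, map_sub, LinearMap.map_smul_of_tower, map_sum,
    Fintype.sum_sum_type, map_sub, coord_d, LinearMap.map_smul_of_tower, coord_act]
  refine (congrArg₂ (· - ·) h₁ (congrArg _ (congrArg₂ (· + ·)
    (Finset.sum_congr rfl fun i _ => h₂ i) (Finset.sum_congr rfl fun i _ => h₃ i)))).trans ?_
  subst hl
  rw [Finset.sum_neg_distrib, Int.negOnePow_succ, Units.neg_smul, Units.neg_smul]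
  exact aux _ _ _ _

theorem sumCoord_extMap (φ : (dgCat A).cocycles M N 0) {n : ℤ} (w : (ext M).X (pretrCone f) n)
    (s : Fin Y.1.X.n ⊕ Fin X.1.X.n) :
    sumCoord f s (app (toHom (extMap φ)) _ (add_zero n) w) =
      app (toHom φ) _ (add_zero _) (sumCoord f s w) := by
  obtain ⟨j, rfl⟩ := finSumFinEquiv.symm.surjective s
  exact (coord_eq_sumCoord f _ j).symm.trans ((coord_extMap φ w j).trans
    (congrArg (app (toHom φ) _ (add_zero _)) (coord_eq_sumCoord f w j)))

theorem cfst_extMap (φ : (dgCat A).cocycles M N 0) {n : ℤ} (w : (ext M).X (pretrCone f) n) :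
    cfst f (app (toHom (extMap φ)) _ (add_zero n) w) =
      app (toHom (extMap φ)) _ (add_zero n) (cfst f w) :=
  coord_ext fun j => sumCoord_extMap f φ w (.inl j)

theorem csnd_extMap (φ : (dgCat A).cocycles M N 0) {l n : ℤ} (h : l + 1 = n)
    (w : (ext M).X (pretrCone f) n) :
    csnd f h (app (toHom (extMap φ)) _ (add_zero n) w) =
      app (toHom (extMap φ)) _ (add_zero l) (csnd f h w) := by
  refine coord_ext fun j => ?_
  rw [coord_csnd, coord_extMap, coord_csnd, sumCoord_extMap]
  exact (app_castDeg (toHom φ) _ _ _ _ (sumCoord f (.inr j) w)).symm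

/-- A property of homogeneous elements holds for the coordinates of an element of the extension to
a cone if it holds for the coordinates of both components. -/
theorem forall_coord_of_cpair (P : ∀ (a : A.Obj) (n : ℤ), M.X a n → Prop) {l n : ℤ} (h : l + 1 = n)
    (w : (ext M).X (pretrCone f) n) (h₁ : ∀ j, P _ _ (coord j (cfst f w)))
    (h₂ : ∀ j, P _ _ (coord j (csnd f h w))) (j : Fin (pretrCone f).1.X.n) : P _ _ (coord j w) := by
  have hP : ∀ (a : A.Obj) (n m : ℤ) (h : n = m) (x : M.X a n), P a m (M.castDeg h x) → P a n x := by
    rintro a n _ rfl x hx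
    exact hx
  have : ∀ s, P _ _ (sumCoord f s w) := by
    rintro (j | j)
    · exact h₁ j
    · exact hP _ _ _ _ _ (h₂ j)
  rw [coord_eq_sumCoord]
  exact this (finSumFinEquiv.symm j)

end

end DGCat

/-! ### Presheaves factoring through a localization -/

section Presheaf

variable {E : Type*} [Category E] {D : Type*} [Category.{v} D] (F : E ⥤ D)
  (W : MorphismProperty E) [F.IsLocalization W] {G : Eᵒᵖ ⥤ Type v}

/-- A presheaf inverting `W` does not distinguish morphisms identified by the localization. -/
theorem Localization.presheaf_map_eq (hG : W.op.IsInvertedBy G) {X Y : E} {f g : X ⟶ Y}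
    (h : F.map f = F.map g) : G.map f.op = G.map g.op := by
  let e := Localization.fac G hG F.op
  have h' : (F.op ⋙ Localization.lift G hG F.op).map f.op =
      (F.op ⋙ Localization.lift G hG F.op).map g.op :=
    congrArg (fun t => (Localization.lift G hG F.op).map (Quiver.Hom.op t)) h
  rw [← cancel_epi (e.hom.app _), ← e.hom.naturality, ← e.hom.naturality, h']

/-- A transformation from a presheaf inverting `W` to a presheaf represented by the localization is
surjective if its image contains the identity. -/
theorem Localization.surjective_of_id (hG : W.op.IsInvertedBy G) {Y : E}
    (τ : G ⟶ F.op ⋙ yoneda.obj (F.obj Y)) (ι : G.obj (Opposite.op Y))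
    (hι : τ.app (Opposite.op Y) ι = 𝟙 (F.obj Y)) (X : E) :
    Function.Surjective (τ.app (Opposite.op X)) := by
  let e := Localization.fac G hG F.op
  -- τ descends to the localization, where its target is representable. There the preimage of the
  -- identity may be pulled back along any g between images under F, including those that do not
  -- come from E.
  let τ' := Localization.liftNatTrans F.op W.op (F.op ⋙ Localization.lift G hG F.op)
    (F.op ⋙ yoneda.obj (F.obj Y)) (Localization.lift G hG F.op) (yoneda.obj (F.obj Y)) (e.hom ≫ τ)
  have hτ' : ∀ Z : E, τ'.app (Opposite.op (F.obj Z)) = e.hom.app (Opposite.op Z) ≫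
      τ.app (Opposite.op Z) := fun Z =>
    (Localization.liftNatTrans_app F.op W.op _ _ _ _ (e.hom ≫ τ) (Opposite.op Z)).trans (by
      change 𝟙 _ ≫ _ ≫ 𝟙 _ = _
      rw [Category.id_comp, Category.comp_id]
      rfl)
  intro (g : F.obj X ⟶ F.obj Y)
  let ι' := e.inv.app (Opposite.op Y) ι
  have hι' : τ'.app (Opposite.op (F.obj Y)) ι' = 𝟙 (F.obj Y) := by
    have h₁ : e.hom.app (Opposite.op Y) ι' = ι :=
      ConcreteCategory.congr_hom (e.inv_hom_id_app (Opposite.op Y)) ι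
    rw [hτ']
    change τ.app (Opposite.op Y) (e.hom.app (Opposite.op Y) ι') = _
    rw [h₁, hι]
  refine ⟨e.hom.app (Opposite.op X) ((Localization.lift G hG F.op).map g.op ι'), ?_⟩
  have h₁ := ConcreteCategory.congr_hom (hτ' X) ((Localization.lift G hG F.op).map g.op ι')
  have h₂ := ConcreteCategory.congr_hom (τ'.naturality g.op) ι'
  refine h₁.symm.trans (h₂.trans ?_)
  change (yoneda.obj (F.obj Y)).map g.op (τ'.app (Opposite.op (F.obj Y)) ι') = g
  rw [hι']
  exact Category.comp_id g

end Presheaf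

/-! ### The long exact sequence of a cone of twisted complexes -/

namespace DGCat

open DGModule

section

variable {k : Type u} [CommRing k] {A : DGCat.{u, u, u} k} {N : DGModule.{u, u, u, u} A}
  {X Y : A.pretr.Obj} {f : A.pretr.cocycles X Y 0}

/-- Precomposition with a morphism with acyclic cone is injective on cohomology. -/
theorem exact_of_act_exact (h : (ext N).ExactAt (pretrCone f)) {l n m : ℤ} (hl : l + 1 = n)
    (hn : n + 1 = m) (y : (ext N).X Y n) (hy : (ext N).d hn y = 0) (x : (ext N).X X l)
    (hx : (ext N).d hl x = (ext N).act (add_zero n) y f.1) : ∃ y', (ext N).d hl y' = y := by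
  -- The sign is the one that makes the pair (y, ±x) closed on the cone of f; the first component of
  -- a primitive then bounds y.
  obtain ⟨w, hw₁, hw₂⟩ := exists_cpair f hl y (n.negOnePow • x)
  obtain ⟨w', hw'⟩ := h l n m hl hn w (cpair_ext f hn
    (by rw [cfst_d, hw₁, hy, map_zero])
    (by rw [csnd_d f hl hn, hw₁, hw₂, LinearMap.map_smul_of_tower, hx, sub_self, map_zero]))
  exact ⟨cfst f w', by rw [← cfst_d, hw', hw₁]⟩

/-- Precomposition with a morphism with acyclic cone is surjective on cohomology. -/
theorem exists_act_sub_exact (h : (ext N).ExactAt (pretrCone f)) {l n m : ℤ} (hl : l + 1 = n)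
    (hn : n + 1 = m) (x : (ext N).X X n) (hx : (ext N).d hn x = 0) :
    ∃ (y : (ext N).X Y n) (v : (ext N).X X l), (ext N).d hn y = 0 ∧
      (ext N).act (add_zero n) y f.1 - x = (ext N).d hl v := by
  -- The pair (0, x) is closed on the cone, hence the boundary of some w'. The first component of w'
  -- is, up to sign, the required class on Y, and the second gives the homotopy.
  obtain ⟨w, hw₁, hw₂⟩ := exists_cpair f hn 0 x
  obtain ⟨w', hw'⟩ := h n m (m + 1) hn rfl w (cpair_ext f rfl
    (by rw [cfst_d, hw₁, map_zero, map_zero])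
    (by rw [csnd_d f hn rfl, hw₁, hw₂, hx, map_zero, LinearMap.zero_apply, smul_zero, sub_zero,
      map_zero]))
  have h₁ := cfst_d f hn w'
  have h₂ := csnd_d f hl hn w'
  rw [hw', hw₁] at h₁
  rw [hw', hw₂] at h₂
  refine ⟨-(n.negOnePow • cfst f w'), -csnd f hl w', ?_, ?_⟩
  · rw [map_neg, LinearMap.map_smul_of_tower, ← h₁, smul_zero, neg_zero]
  · rw [h₂, map_neg, map_neg, LinearMap.neg_apply, smul_apply₂]
    abel

end

end DGCat

namespace DGModule

section

variable {k : Type u} [CommRing k] {E : DGCat.{u, u, u} k} (M : DGModule.{u, u, u, u} E)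

/-! ### The cohomology presheaf of a DG module -/

/-- Cohomologous closed elements. -/
def cohSetoid (z : E.Obj) (n : ℤ) : Setoid {x : M.X z n // M.d rfl x = 0} where
  r x y := ∃ w : M.X z (n - 1), M.d (sub_add_cancel n 1) w = x.1 - y.1
  iseqv :=
    { refl := fun x => ⟨0, by rw [map_zero, sub_self]⟩
      symm := fun ⟨w, hw⟩ => ⟨-w, by rw [map_neg, hw, neg_sub]⟩
      trans := fun ⟨w, hw⟩ ⟨w', hw'⟩ => ⟨w + w', by rw [map_add, hw, hw', sub_add_sub_cancel]⟩ }

/-- The cohomology of `M(z)`. -/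
def Coh (z : E.Obj) (n : ℤ) : Type u := Quotient (M.cohSetoid z n)

variable {M}

/-- The class of a closed element. -/
def cohMk {z : E.Obj} {n m : ℤ} (h : n + 1 = m) (x : M.X z n) (hx : M.d h x = 0) : M.Coh z n :=
  Quotient.mk (M.cohSetoid z n) ⟨x, by subst h; exact hx⟩

theorem cohMk_surjective {z : E.Obj} {n m : ℤ} (h : n + 1 = m) (y : M.Coh z n) :
    ∃ x hx, cohMk h x hx = y := by
  subst h
  obtain ⟨x, rfl⟩ := Quotient.exists_rep y
  exact ⟨x.1, x.2, rfl⟩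

theorem cohMk_eq_iff {z : E.Obj} {l n m : ℤ} (hl : l + 1 = n) (h : n + 1 = m) {x y : M.X z n}
    (hx : M.d h x = 0) (hy : M.d h y = 0) :
    cohMk h x hx = cohMk h y hy ↔ ∃ w, M.d hl w = x - y := by
  obtain rfl : l = n - 1 := by omega
  exact Quotient.eq

theorem d_act_cocycle {X Y : E.Obj} {n m : ℤ} (h : n + 1 = m) (x : M.X Y n)
    (f : E.cocycles X Y 0) :
    M.d h (M.act (add_zero n) x f.1) = M.act (add_zero m) (M.d h x) f.1 := by
  rw [M.leibniz (add_zero n) h h (zero_add 1) (add_zero m) h,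
    (DGCat.mem_cocycles (zero_add 1)).1 f.2, map_zero, smul_zero, add_zero]

variable (M) in
/-- The action of the homotopy category on the cohomology of a DG module. -/
def cohMap {X Y : E.Obj} {n : ℤ} : M.Coh Y n → E.H X Y 0 → M.Coh X n :=
  Quotient.map₂ (sa := M.cohSetoid Y n) (sc := M.cohSetoid X n)
    (fun x f => ⟨M.act (add_zero n) x.1 f.1, by
      rw [d_act_cocycle, x.2, map_zero, LinearMap.zero_apply]⟩) (by
    rintro ⟨x, hx⟩ ⟨x', hx'⟩ ⟨v, hv⟩ f f' hf
    rw [← Quotient.eq_iff_equiv] at hf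
    obtain ⟨β, hβ⟩ := (DGCat.mem_coboundaries (neg_add_cancel 1)).1 ((DGCat.cls_eq_iff _ _).1 hf)
    have hv' : M.d (sub_add_cancel n 1) v = x - x' := hv
    refine ⟨M.act (add_zero _) v f.1 + n.negOnePow • M.act (by omega : n + -1 = n - 1) x' β, ?_⟩
    change _ = M.act (add_zero n) x f.1 - M.act (add_zero n) x' f'.1
    rw [map_add, d_act_cocycle, hv', LinearMap.map_smul_of_tower,
      M.leibniz (by omega : n + -1 = n - 1) (sub_add_cancel n 1) rfl (neg_add_cancel 1) (by omega)
        (add_zero n), hx', map_zero, LinearMap.zero_apply, zero_add, hβ, smul_smul,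
      Int.units_mul_self, one_smul, map_sub, map_sub, LinearMap.sub_apply]
    abel)

variable (M) in
theorem cohMap_hcomp {X Y Z : E.Obj} {n : ℤ} (x : M.Coh Z n) (f : E.H Y Z 0) (g : E.H X Y 0) :
    M.cohMap x (DGCat.hcomp (zero_add 0) f g) = M.cohMap (M.cohMap x f) g := by
  obtain ⟨x, hx, rfl⟩ := cohMk_surjective rfl x
  obtain ⟨f, rfl⟩ := DGCat.cls_surjective f
  obtain ⟨g, rfl⟩ := DGCat.cls_surjective g
  exact congrArg (Quotient.mk _) (Subtype.ext
    (M.act_act (add_zero n) (add_zero n) (add_zero 0) (add_zero n) x f.1 g.1).symm)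

variable (M) in
/-- The presheaf `z ↦ H^n(M(z))` on the homotopy category. -/
def coh (n : ℤ) : (DGCat.Ho E)ᵒᵖ ⥤ Type u where
  obj z := M.Coh z.unop.as n
  map f := ↾fun x => M.cohMap x f.unop
  map_id z := by
    ext x
    obtain ⟨x, hx, rfl⟩ := cohMk_surjective rfl x
    exact congrArg (Quotient.mk _) (Subtype.ext (M.act_one x))
  map_comp f g := by
    ext x
    exact M.cohMap_hcomp x f.unop g.unop

theorem d_app_eq_zero {N : DGModule.{u, u, u, u} E} {r p q p' q' s : ℤ} {ψ : M.homs N r}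
    (h : p + r = q) (h' : p' + r = q') (hp : p + 1 = p') (hq : q + 1 = q') {hr : r + 1 = s}
    (hψ : homsD _ _ hr ψ = 0) {z : E.Obj} (x : M.X z p) (hx : M.d hp x = 0) :
    N.d hq (app ψ z h x) = 0 := by
  have e := homsD_apply hr ψ (by omega : p + s = q') h hq hp h' x
  rw [hψ, app_zero, hx, map_zero, smul_zero, sub_zero] at e
  exact e.symm

theorem exists_d_eq_app {N : DGModule.{u, u, u, u} E} {r p q p' q' s : ℤ} {ψ : M.homs N r}
    (h : p + r = q) (h' : p' + r = q') (hp : p + 1 = p') (hq : q + 1 = q') {hr : r + 1 = s}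
    (hψ : homsD _ _ hr ψ = 0) {z : E.Obj} (x : M.X z p) :
    ∃ y, N.d hq y = app ψ z h' (M.d hp x) := by
  have e := homsD_apply hr ψ (by omega : p + s = q') h hq hp h' x
  rw [hψ, app_zero] at e
  refine ⟨r.negOnePow • app ψ z h x, ?_⟩
  rw [LinearMap.map_smul_of_tower, sub_eq_zero.1 e.symm, smul_smul, Int.units_mul_self, one_smul]

/-- The transformation from a cohomology presheaf to a representable presheaf given by a closed
morphism. -/
def cohDesc {E' : DGCat.{u, u, u} k} (F : DGFunctor E E') {c : E'.Obj} {r n : ℤ} (h : n + r = 0)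
    (ψ : M.homs (restrict F (representable c)) r) (hψ : homsD _ _ rfl ψ = 0) :
    M.coh n ⟶ F.ho.op ⋙ CategoryTheory.yoneda.obj (DGCat.Ho.mk c) where
  app z := ↾(Quotient.lift (s := M.cohSetoid z.unop.as n)
    (fun x => DGCat.cls (⟨app ψ z.unop.as h x.1, (DGCat.mem_cocycles (zero_add 1)).2
      (d_app_eq_zero h (by omega) rfl (zero_add 1) hψ x.1 x.2)⟩ :
        E'.cocycles (F.obj z.unop.as) c 0)) (by
    rintro ⟨x, hx⟩ ⟨y, hy⟩ ⟨w, hw⟩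
    obtain ⟨v, hv⟩ := exists_d_eq_app (by omega : n - 1 + r = -1) h (sub_add_cancel n 1)
      (neg_add_cancel 1) hψ w
    refine (DGCat.cls_eq_iff _ _).2 ((DGCat.mem_coboundaries (neg_add_cancel 1)).2 ⟨v, hv.trans ?_⟩)
    rw [hw]
    exact map_sub (app ψ z.unop.as h) x y))
  naturality z z' f := by
    ext x
    obtain ⟨f, rfl⟩ : ∃ g, f = Quiver.Hom.op g := ⟨f.unop, rfl⟩
    obtain ⟨f, rfl⟩ := DGCat.homMk_surjective f
    obtain ⟨x, hx, rfl⟩ := cohMk_surjective rfl x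
    refine congrArg DGCat.cls (Subtype.ext ?_)
    exact app_act ψ h h (add_zero n) (add_zero 0) x f.1

end

end DGModule

/-! ### Cohomology presheaves on the Verdier quotient -/

namespace DGCat

open DGModule

section

variable {k : Type u} [CommRing k] {A C : DGCat.{u, u, u} k} {B : Set A.Obj}

/-- Exactness on B spreads to twisted complexes over B by triangularity, and to homotopy equivalent
ones. So ext N is exact at the cone of each morphism to be inverted, and the long exact sequence
does the rest. -/
theorem inverts_coh_ext {N : DGModule.{u, u, u, u} A} (hN : ∀ b ∈ B, N.ExactAt b) (n : ℤ) :
    (A.quotientMorphisms B).op.IsInvertedBy ((ext N).coh n) := by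
  rintro ⟨Y⟩ ⟨X⟩ ⟨g⟩ ⟨φ, Z, hφ, hZ, ⟨e⟩⟩
  obtain rfl : homMk φ = g := hφ
  have h : (ext N).ExactAt (pretrCone φ) := (exactAt_ext fun j => hN _ (hZ j)).of_iso e.symm
  have hd : ∀ {x : (ext N).X Y.as n}, (ext N).d rfl x = 0 →
      (ext N).d rfl ((ext N).act (add_zero n) x φ.1) = 0 := fun {x} hx => by
    rw [d_act_cocycle, hx, map_zero, LinearMap.zero_apply]
  rw [isIso_iff_bijective]
  constructor
  · intro x y hxy
    obtain ⟨x, hx, rfl⟩ := cohMk_surjective rfl x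
    obtain ⟨y, hy, rfl⟩ := cohMk_surjective rfl y
    obtain ⟨v, hv⟩ := (cohMk_eq_iff (sub_add_cancel n 1) rfl (hd hx) (hd hy)).1 hxy
    refine (cohMk_eq_iff (sub_add_cancel n 1) rfl _ _).2 ?_
    refine exact_of_act_exact h (sub_add_cancel n 1) rfl (x - y) (by rw [map_sub, hx, hy, sub_self])
      v (hv.trans ?_)
    rw [map_sub, LinearMap.sub_apply]
  · intro x
    obtain ⟨x, hx, rfl⟩ := cohMk_surjective rfl x
    obtain ⟨y, v, hy, hv⟩ := exists_act_sub_exact h (sub_add_cancel n 1) rfl x hx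
    exact ⟨cohMk rfl y hy, (cohMk_eq_iff (sub_add_cancel n 1) rfl
      (hd hy) hx).2 ⟨v, hv.symm⟩⟩

/-! ### Twisted complexes with a single summand -/

/-- The twisted complex with a single summand `c[n]`. -/
def single (c : A.Obj) (n : ℤ)
    (q : FormalSum.Mat (A := A) ⟨1, fun _ => c, fun _ => n⟩ ⟨1, fun _ => c, fun _ => n⟩ 1)
    (hq : q = 0) : A.pretr.Obj where
  val :=
    { X := (⟨1, fun _ => c, fun _ => n⟩ : FormalSum A)
      q := q
      maurerCartan := by
        subst hq
        have : ∀ (E : DGCat.{u, u, u} k) (X : E.Obj),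
            E.d (by norm_num : (1 : ℤ) + 1 = 2) (0 : E.Hom X X 1) +
              E.comp (by norm_num) (0 : E.Hom X X 1) (0 : E.Hom X X 1) = 0 := by
          intro E X
          rw [map_zero, map_zero, add_zero]
        exact this A.formalSums _ }
  property i j _ := congrFun₂ hq i j

variable {c : A.Obj} {n : ℤ}
  {q : FormalSum.Mat (A := A) ⟨1, fun _ => c, fun _ => n⟩ ⟨1, fun _ => c, fun _ => n⟩ 1}
  {hq : q = 0}

/-- The element of the extension of a module to `c[n]` given by an element of the module. -/
def singleElt {M : DGModule.{u, u, u, u} A} {p p' : ℤ} (h : p' = p - n) :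
    M.X c p' →ₗ[k] (ext M).X (single c n q hq) p :=
  LinearMap.pi (φ := fun _ : Fin 1 => M.X c (p - n)) fun _ => M.castDeg h

theorem singleElt_injective {M : DGModule.{u, u, u, u} A} {p p' : ℤ} (h : p' = p - n) :
    Function.Injective (singleElt (M := M) (hq := hq) h) := fun x y e => by
  subst h
  exact congrArg (coord (z := single c n q hq) (0 : Fin 1)) e

theorem singleElt_surjective {M : DGModule.{u, u, u, u} A} {p p' : ℤ} (h : p' = p - n) :
    Function.Surjective (singleElt (M := M) (hq := hq) h) := fun x => by
  subst h
  refine ⟨coord (z := single c n q hq) (0 : Fin 1) x, coord_ext (z := single c n q hq) fun j => ?_⟩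
  have hj : j = (0 : Fin 1) := Subsingleton.elim (α := Fin 1) j 0
  rw [hj]
  rfl

theorem single_coord_d {M : DGModule.{u, u, u, u} A} {p p' : ℤ} (h : p + 1 = p')
    (x : (ext M).X (single c n q hq) p) (i : Fin 1) :
    coord (z := single c n q hq) i ((ext M).d h x) =
      M.d (by omega : p - n + 1 = p' - n) (coord (z := single c n q hq) i x) := by
  subst hq
  refine (coord_d h x i).trans (sub_eq_self.2 ?_)
  refine (congrArg (p.negOnePow • ·) (Finset.sum_eq_zero fun j _ => ?_)).trans (smul_zero _)
  exact map_zero _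

theorem d_singleElt {M : DGModule.{u, u, u, u} A} {p p' s s' : ℤ} (h : s = p - n)
    (h' : s' = p' - n) (hp : p + 1 = p') (hs : s + 1 = s') (x : M.X c s) :
    (ext M).d hp (singleElt (hq := hq) h x) = singleElt (hq := hq) h' (M.d hs x) :=
  coord_ext (z := single c n q hq) fun i =>
    (single_coord_d hp _ i).trans (M.d_castDeg h h' hs _ x)

theorem exactAt_of_single {M : DGModule.{u, u, u, u} A}
    (h : (ext M).ExactAt (single c n q hq)) : M.ExactAt c := by
  intro l p m hl hp x hx
  obtain ⟨y, hy⟩ := h (l + n) (p + n) (m + n) (by omega) (by omega) (singleElt (by omega) x) (by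
    rw [d_singleElt (s' := m) (by omega) (by omega) _ hp, hx, map_zero])
  obtain ⟨y, rfl⟩ := singleElt_surjective (by omega : l = l + n - n) y
  rw [d_singleElt (s' := p) (by omega) (by omega) _ hl] at hy
  exact ⟨y, singleElt_injective _ hy⟩

/-- A DG quotient annihilates the objects of the subcategory. -/
theorem IsDGQuotient.exactAt_restrict {ξ : DGFunctor A C} (hξ : IsDGQuotient ξ B)
    (M : DGModule.{u, u, u, u} C) {b : A.Obj} (hb : b ∈ B) : (restrict ξ M).ExactAt b := by
  -- z is the empty sum. The cone of z → b has b as its only summand, so ξ makes z → b invertible;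
  -- every extended module is exact at an empty sum, hence also at ξ b.
  let z : A.pretr.Obj :=
    { val :=
        { X := (⟨0, Fin.elim0, Fin.elim0⟩ : FormalSum A)
          q := fun i => i.elim0
          maurerCartan := funext fun i => i.elim0 }
      property := fun i => i.elim0 }
  let y : A.pretr.Obj := single b 0 0 rfl
  let φ : A.pretr.cocycles z y 0 := 0
  have hφ : A.quotientMorphisms B (homMk φ) := by
    refine ⟨φ, pretrCone φ, rfl, fun i => ?_, ⟨Iso.refl _⟩⟩
    have : ∀ s : Fin 1 ⊕ Fin 0, Sum.elim y.1.X.obj z.1.X.obj s ∈ B := by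
      rintro (s | s)
      · exact hb
      · exact s.elim0
    exact this (finSumFinEquiv.symm i)
  have := hξ.isLocalization
  have : IsIso (ξ.pretr.ho.map (homMk φ)) :=
    Localization.inverts ξ.pretr.ho (A.quotientMorphisms B) _ hφ
  have h : (ext M).ExactAt (ξ.pretr.obj z) := exactAt_ext fun j => Fin.elim0 j
  have h' : (ext M).ExactAt (ξ.pretr.obj y) := h.of_iso (@asIso _ _ _ _ _ this)
  have h'' : M.ExactAt (ξ.obj b) := exactAt_of_single (c := ξ.obj b)
    (hq := funext₂ fun _ _ => map_zero ξ.map) h'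
  exact h''

/-- The identification of the extension of `h_c` with the module represented by `c[n]`. -/
def singleHom (c : A.Obj) (n : ℤ)
    (q : FormalSum.Mat (A := A) ⟨1, fun _ => c, fun _ => n⟩ ⟨1, fun _ => c, fun _ => n⟩ 1)
    (hq : q = 0) : (ext (representable c)).homs (representable (single c n q hq)) (-n) :=
  mkHom (M := ext (representable c)) (N := representable (single c n q hq))
    (fun z p s hs =>
      { toFun := fun x _ j => A.castDeg (by omega : p - z.1.X.deg j = s + n - z.1.X.deg j)
          (coord (M := representable c) j x)
        map_add' := fun x y => funext₂ fun _ j => map_add (A.castDeg _) _ _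
        map_smul' := fun a x => funext₂ fun _ j => map_smul (A.castDeg _) a _ })
    (fun z z' p s r t i hs hr ht hr' x f => funext₂ fun _ j =>
      (map_sum (A.castDeg _) (fun l => A.comp _ (coord (M := representable c) l x) (f l j))
        Finset.univ).trans (Finset.sum_congr rfl fun l _ =>
          (A.comp_castDeg _ rfl _ _ _ (coord (M := representable c) l x) (f l j)).symm))

/-- The entries of a matrix with a single row. -/
def entry {z : A.pretr.Obj} {s : ℤ} (f : A.pretr.Hom z (single c n q hq) s) (j : Fin z.1.X.n) :
    A.Hom (z.1.X.obj j) c (s + n - z.1.X.deg j) := f (0 : Fin 1) j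

theorem entry_ext {z : A.pretr.Obj} {s : ℤ} {f g : A.pretr.Hom z (single c n q hq) s}
    (h : ∀ j, entry f j = entry g j) : f = g :=
  funext₂ fun i j => by
    have hi : i = (0 : Fin 1) := Subsingleton.elim (α := Fin 1) i 0
    rw [hi]
    exact h j

theorem entry_d {z : A.pretr.Obj} {s s' : ℤ} (h : s + 1 = s')
    (f : A.pretr.Hom z (single c n q hq) s) (j : Fin z.1.X.n) :
    entry (A.pretr.d h f : A.pretr.Hom z (single c n q hq) s') j =
      (n.negOnePow • A.d (by omega : s + n - z.1.X.deg j + 1 = s' + n - z.1.X.deg j) (entry f j) -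
        s.negOnePow • ∑ l, A.comp (p := 1 + z.1.X.deg l - z.1.X.deg j) (by omega) (entry f l)
          (z.1.q l j) : A.Hom (z.1.X.obj j) c (s' + n - z.1.X.deg j)) := by
  subst hq
  have e : ∀ (t : A.Hom (z.1.X.obj j) c (s' + n - z.1.X.deg j))
      (f : Fin 1 → A.Hom (z.1.X.obj j) c (s + n - z.1.X.deg j)),
      n.negOnePow • A.d (by omega) (f 0) + ∑ l : Fin 1, A.comp (by omega)
        (0 : A.Hom c c (1 + n - n)) (f l) - t = n.negOnePow • A.d (by omega) (f 0) - t := by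
    intro t f
    simp
  exact e _ fun l => f l j

/-- The shift [n] of the summand multiplies the differential by (-1)^n, which is the sign required
of a closed morphism of degree -n. -/
theorem homsD_singleHom {m : ℤ} (h : -n + 1 = m) :
    homsD _ _ h (singleHom c n q hq) = 0 :=
  homs_ext fun z p s hs x => by
    rw [homsD_apply h _ hs (q' := p + -n) rfl (by omega) rfl (by omega), app_zero, sub_eq_zero]
    refine entry_ext fun j => (entry_d _ _ j).trans ?_
    let x' : ∀ l, A.Hom (z.1.X.obj l) c (p - z.1.X.deg l) := fun l =>
      coord (M := representable c) l x
    have hj : p + 1 - z.1.X.deg j = s + n - z.1.X.deg j := by omega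
    have e : n.negOnePow • A.d (by omega) (A.castDeg (by omega :
          p - z.1.X.deg j = p + -n + n - z.1.X.deg j) (x' j)) -
        (p + -n).negOnePow • ∑ l, A.comp (p := 1 + z.1.X.deg l - z.1.X.deg j) (by omega)
          (A.castDeg (by omega : p - z.1.X.deg l = p + -n + n - z.1.X.deg l) (x' l)) (z.1.q l j) =
        (-n).negOnePow • A.castDeg hj (A.d (by omega) (x' j) -
          p.negOnePow • ∑ l, A.comp (p := 1 + z.1.X.deg l - z.1.X.deg j) (by omega)
            (x' l) (z.1.q l j)) := by
      rw [map_sub, LinearMap.map_smul_of_tower, map_sum, smul_sub, smul_smul, ← Int.negOnePow_add,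
        add_comm (-n) p, Int.negOnePow_neg, A.d_castDeg _ hj _ _]
      refine congrArg _ (congrArg _ (Finset.sum_congr rfl fun l _ => ?_))
      exact A.comp_castDeg _ rfl hj _ _ (x' l) (z.1.q l j)
    exact e

end

end DGCat

namespace DGModule

section

variable {k : Type w} [CommRing k] {A : DGCat.{w, u, v} k} {M : DGModule.{w, u, v, v} A} {a : A.Obj}

/-- The closed morphism `h_a → M` given by a closed element of `M(a)` of degree `0`. -/
def eltMap (x : M.X a 0) (hx : M.d (zero_add 1) x = 0) : (dgCat A).cocycles (representable a) M 0 :=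
  ofHom (eltHom x) (by
    rw [homsD_eltHom, hx]
    exact homs_ext fun b p q hq f => LinearMap.congr_fun (map_zero (M.act _)) f)

theorem homsD_homsComp_eq_zero {L N P : DGModule.{w, u, v, u₁} A} {q p n q' p' n' : ℤ}
    (h : q + p = n) (hn : n + 1 = n') (hq : q + 1 = q') (hp : p + 1 = p') {g : N.homs P q}
    {f : L.homs N p} (hg : homsD _ _ hq g = 0) (hf : homsD _ _ hp f = 0) :
    homsD _ _ hn (homsComp h g f) = 0 := by
  rw [homsD_homsComp h hn hq hp (by omega) (by omega), hg, hf, map_zero, map_zero,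
    LinearMap.zero_apply, smul_zero, add_zero]

theorem d_app_of_homsD_eq_zero {L N : DGModule.{w, u, v, u₁} A} {n m : ℤ} {h : n + 1 = m}
    {φ : L.homs N n} (hφ : homsD L N h φ = 0) {b : A.Obj} {p q p' q' : ℤ} (h₁ : p + n = q)
    (h₂ : q + 1 = q') (h₃ : p + 1 = p') (h₄ : p' + n = q') (x : L.X b p) :
    N.d h₂ (app φ b h₁ x) = n.negOnePow • app φ b h₄ (L.d h₃ x) := by
  have e := homsD_apply h φ (by omega : p + m = q') h₁ h₂ h₃ h₄ x
  rw [hφ, app_zero] at e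
  exact sub_eq_zero.1 e.symm

theorem exists_d_eq_of_app {L N : DGModule.{w, u, v, u₁} A} {n m : ℤ} {h : n + 1 = m}
    {φ : L.homs N n} (hφ : homsD L N h φ = 0) {b : A.Obj} {p q p' q' : ℤ} (h₁ : p + n = q)
    (h₂ : q + 1 = q') (h₃ : p + 1 = p') (h₄ : p' + n = q')
    (hi : Function.Injective (app φ b h₄)) (hs : Function.Surjective (app φ b h₁)) (x : L.X b p')
    (y : N.X b q) (e : N.d h₂ y = app φ b h₄ x) : ∃ v, L.d h₃ v = x := by
  obtain ⟨v, rfl⟩ := hs y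
  refine ⟨n.negOnePow • v, hi ?_⟩
  rw [LinearMap.map_smul_of_tower, LinearMap.map_smul_of_tower,
    ← d_app_of_homsD_eq_zero hφ h₁ h₂ h₃ h₄, e]

theorem app_eltMap (x : M.X a 0) (hx : M.d (zero_add 1) x = 0) {b : A.Obj} {p : ℤ}
    (f : A.Hom b a p) :
    app (toHom (eltMap x hx)) b (add_zero p) f = M.act (zero_add p) x f := rfl

end

end DGModule

/-! ### Modules exact on B compared with represented modules -/

namespace DGCat

open DGModule

section

variable {k : Type u} [CommRing k] {A C : DGCat.{u, u, u} k} {B : Set A.Obj}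

theorem castDeg_one {X : A.Obj} {n : ℤ} (h : 0 = n) :
    A.castDeg h (A.one X) = A.eqHom rfl h.symm := by
  subst h
  rfl

theorem castDeg_castDeg {X Y : A.Obj} {n m l : ℤ} (h : n = m) (h' : m = l) (f : A.Hom X Y n) :
    A.castDeg h' (A.castDeg h f) = A.castDeg (h.trans h') f := by
  subst h h'
  rfl

theorem _root_.DGFunctor.map_castDeg (F : DGFunctor A C) {X Y : A.Obj} {n m : ℤ} (h : n = m)
    (f : A.Hom X Y n) : F.map (A.castDeg h f) = C.castDeg h (F.map f) := by
  subst h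
  rfl

theorem one_single_entry {c : A.Obj} {n : ℤ}
    {q : FormalSum.Mat (A := A) ⟨1, fun _ => c, fun _ => n⟩ ⟨1, fun _ => c, fun _ => n⟩ 1}
    {hq : q = 0} (j : Fin 1) :
    entry (A.pretr.one (single c n q hq)) j = A.eqHom rfl (by change 0 + n - n = 0; omega) := by
  obtain rfl : j = 0 := Subsingleton.elim _ _
  have e : (if h : (0 : Fin 1) = 0 then A.eqHom (congrArg (fun _ : Fin 1 => c) h) (by omega) else 0 :
      A.Hom c c (0 + n - n)) = A.eqHom rfl (by omega) := dif_pos rfl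
  exact e

section

variable {c : A.Obj} {n : ℤ}
  {q : FormalSum.Mat (A := A) ⟨1, fun _ => c, fun _ => n⟩ ⟨1, fun _ => c, fun _ => n⟩ 1}
  {hq : q = 0}

theorem singleHom_injective {z : A.pretr.Obj} {p s : ℤ} (h : p + -n = s)
    {x y : (ext (representable c)).X z p}
    (e : app (singleHom c n q hq) z h x = app (singleHom c n q hq) z h y) : x = y := by
  refine coord_ext fun j => ?_
  have e' := congrArg (A.castDeg (by omega : s + n - z.1.X.deg j = p - z.1.X.deg j))
    (congrArg (entry (hq := hq) · j) e)
  exact (castDeg_castDeg _ _ _).symm.trans (e'.trans (castDeg_castDeg _ _ _))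

theorem singleHom_surjective {z : A.pretr.Obj} {p s : ℤ} (h : p + -n = s)
    (f : A.pretr.Hom z (single c n q hq) s) :
    ∃ x, app (singleHom c n q hq) z h x = f :=
  ⟨extMk (M := representable c) fun j =>
    A.castDeg (by omega : s + n - z.1.X.deg j = p - z.1.X.deg j) (entry f j),
    entry_ext fun j => castDeg_castDeg _ _ _⟩

theorem extMap_singleElt {M N : DGModule.{u, u, u, u} A} (φ : (dgCat A).cocycles M N 0) {p s : ℤ}
    (h : s = p - n) (x : M.X c s) :
    app (toHom (extMap φ)) (single c n q hq) (add_zero p) (singleElt h x) =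
      singleElt h (app (toHom φ) c (add_zero s) x) :=
  coord_ext (z := single c n q hq) fun _ => app_castDeg (toHom φ) h h (add_zero s) _ x

theorem d_singleElt_eq_zero {M : DGModule.{u, u, u, u} A} {p p' s s' : ℤ} (h : s = p - n)
    (hp : p + 1 = p') (hs : s + 1 = s') (x : M.X c s) (hx : M.d hs x = 0) :
    (ext M).d hp (singleElt (hq := hq) h x) = 0 := by
  rw [d_singleElt (s' := s') h (by omega) hp hs, hx, map_zero]

theorem act_singleElt {M : DGModule.{u, u, u, u} A} {z : A.pretr.Obj} (x : M.X c 0)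
    (hx : M.d (zero_add 1) x = 0) (y : (ext (representable c)).X z n) :
    (ext M).act (add_zero n) (singleElt (hq := hq) (sub_self n).symm x)
      (app (singleHom c n q hq) z (add_neg_cancel n) y) =
      app (toHom (extMap (eltMap x hx))) z (add_zero n) y := by
  refine coord_ext fun j => ?_
  refine (coord_act (z := single c n q hq) _ _ _ j).trans ?_
  refine (Fin.sum_univ_one _).trans ?_
  exact M.act_castDeg _ _ rfl _ _ x (coord (M := representable c) j y)

end

/-- The image of a DG functor in the restriction of a represented module. -/
def unitMap (ξ : DGFunctor A C) (a : A.Obj) :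
    (dgCat A).cocycles (representable a) (restrict ξ (representable (ξ.obj a))) 0 :=
  eltMap (M := restrict ξ (representable (ξ.obj a))) (C.one (ξ.obj a)) (C.d_one _)

theorem app_unitMap (ξ : DGFunctor A C) {a b : A.Obj} {p : ℤ} (f : A.Hom b a p) :
    app (toHom (unitMap ξ a)) b (add_zero p) f = ξ.map f := C.one_comp _

/-- A module over the extension, with values in the shifts of a represented module. -/
def singleRes (ξ : DGFunctor A C) (a : A.Obj) (n : ℤ) :
    (ext (restrict ξ (representable (ξ.obj a)))).homs
      (restrict ξ.pretr (representable (ξ.pretr.obj (single a n 0 rfl)))) (-n) :=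
  restrictHom ξ.pretr (ext (representable (ξ.obj a))) _ (-n)
    (singleHom (ξ.obj a) n _ (funext₂ fun _ _ => map_zero ξ.map))

theorem homsD_singleRes (ξ : DGFunctor A C) (a : A.Obj) (n : ℤ) {m : ℤ} (h : -n + 1 = m) :
    homsD _ _ h (singleRes ξ a n) = 0 :=
  congrArg (restrictHom ξ.pretr (ext (representable (ξ.obj a))) _ m) (homsD_singleHom h)

theorem singleRes_injective (ξ : DGFunctor A C) {a : A.Obj} {n : ℤ} {z : A.pretr.Obj} {p s : ℤ}
    (h : p + -n = s) {x y : (ext (restrict ξ (representable (ξ.obj a)))).X z p}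
    (e : app (singleRes ξ a n) z h x = app (singleRes ξ a n) z h y) : x = y :=
  singleHom_injective (z := ξ.pretr.obj z) h e

theorem singleRes_surjective (ξ : DGFunctor A C) {a : A.Obj} {n : ℤ} {z : A.pretr.Obj} {p s : ℤ}
    (h : p + -n = s) (f : C.pretr.Hom (ξ.pretr.obj z) (ξ.pretr.obj (single a n 0 rfl)) s) :
    ∃ x, app (singleRes ξ a n) z h x = f :=
  singleHom_surjective (z := ξ.pretr.obj z) (hq := funext₂ fun _ _ => map_zero ξ.map) h f

/-- Once both extensions are identified with modules represented by a[n] and ξ(a)[n], the unit h_a →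
ξ^* h_{ξ a} is the action of ξ on morphisms. A primitive of its value can thus be read as a
null-homotopy in C^pretr. -/
theorem singleRes_unitMap (ξ : DGFunctor A C) {a : A.Obj} {n : ℤ} {z : A.pretr.Obj} {s : ℤ}
    (h : n + -n = s) (x : (ext (representable a)).X z n) :
    app (singleRes ξ a n) z h (app (toHom (extMap (unitMap ξ a))) z (add_zero n) x) =
      ξ.pretr.map (show A.pretr.Hom z (single a n 0 rfl) s from
        app (singleHom a n 0 rfl) z h x) :=
  entry_ext (c := ξ.obj a) (hq := funext₂ fun _ _ => map_zero ξ.map) fun j => by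
    have e : C.castDeg (by omega : n - z.1.X.deg j = s + n - z.1.X.deg j)
        (app (toHom (unitMap ξ a)) _ (add_zero _) (coord (M := representable a) j x)) =
        ξ.map (A.castDeg (by omega : n - z.1.X.deg j = s + n - z.1.X.deg j)
          (coord (M := representable a) j x)) :=
      (congrArg _ (app_unitMap ξ _)).trans (ξ.map_castDeg _ _).symm
    exact e

theorem singleRes_singleElt (ξ : DGFunctor A C) (a : A.Obj) (n : ℤ) :
    app (singleRes ξ a n) (single a n 0 rfl) (add_neg_cancel n)
      (singleElt (M := restrict ξ (representable (ξ.obj a))) (sub_self n).symm (C.one (ξ.obj a))) =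
    C.pretr.one (ξ.pretr.obj (single a n 0 rfl)) :=
  entry_ext (c := ξ.obj a) (hq := funext₂ fun _ _ => map_zero ξ.map) fun j =>
    (castDeg_castDeg (sub_self n).symm (by omega : n - n = 0 + n - n) (C.one (ξ.obj a))).trans
      ((castDeg_one _).trans (one_single_entry (c := ξ.obj a)
        (hq := funext₂ fun _ _ => map_zero ξ.map) j).symm)

variable {ξ : DGFunctor A C}

/-- If `ξ` is a DG quotient, an extension acyclic on the subcategory sees only the images of
morphisms under `ξ`. -/
theorem IsDGQuotient.exact_of_unitMap_exact (hξ : IsDGQuotient ξ B) {N : DGModule.{u, u, u, u} A}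
    (hN : ∀ b ∈ B, N.ExactAt b) {a : A.Obj} (ι : N.X a 0) (hι : N.d (zero_add 1) ι = 0)
    {z : A.pretr.Obj} {l n m : ℤ} (hl : l + 1 = n) (hn : n + 1 = m)
    (x : (ext (representable a)).X z n) (hx : (ext (representable a)).d hn x = 0)
    (v : (ext (restrict ξ (representable (ξ.obj a)))).X z l)
    (hv : (ext (restrict ξ (representable (ξ.obj a)))).d hl v =
      app (toHom (extMap (unitMap ξ a))) z (add_zero n) x) :
    ∃ y, (ext N).d hl y = app (toHom (extMap (eltMap ι hι))) z (add_zero n) x := by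
  have := hξ.isLocalization
  have hg : (representable (single a n 0 rfl)).d (zero_add 1)
      (app (singleHom a n 0 rfl) z (add_neg_cancel n) x) = 0 :=
    d_app_eq_zero (add_neg_cancel n) (by omega) hn (zero_add 1) (homsD_singleHom rfl) x hx
  let g : A.pretr.cocycles z (single a n 0 rfl) 0 :=
    ⟨app (singleHom a n 0 rfl) z (add_neg_cancel n) x, (mem_cocycles (zero_add 1)).2 hg⟩
  -- The element x is a closed morphism g : z → a[n], and v turns into a null-homotopy of ξ g.
  have hFg : ξ.pretr.ho.map (homMk g) = ξ.pretr.ho.map (homMk 0) := by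
    obtain ⟨w, hw⟩ := exists_d_eq_app (r := -n) (by omega : l + -n = -1) (add_neg_cancel n) hl
      (neg_add_cancel 1) (homsD_singleRes ξ a n rfl) v
    rw [hv, singleRes_unitMap] at hw
    refine (homMk_eq_iff (ξ.pretr.zmap g) (ξ.pretr.zmap 0)).2 ⟨w, hw.trans ?_⟩
    exact (sub_eq_self.2 (map_zero ξ.pretr.map)).symm
  -- Since g and 0 agree in the localization, they act equally on the cohomology of ext N; this is
  -- applied to ι, placed in degree n at a[n].
  have key := ConcreteCategory.congr_hom (Localization.presheaf_map_eq ξ.pretr.ho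
    (A.quotientMorphisms B) (inverts_coh_ext hN n) hFg)
    (cohMk hn (singleElt (hq := rfl) (sub_self n).symm ι)
      (d_singleElt_eq_zero _ hn (zero_add 1) ι hι))
  have h₀ := act_singleElt (hq := rfl) ι hι x
  have h₁ : (ext N).d hn (app (toHom (extMap (eltMap ι hι))) z (add_zero n) x) = 0 := by
    rw [toHom_d, hx, map_zero]
  have h₂ : (ext N).act (add_zero n) (singleElt (c := a) (n := n) (hq := rfl) (sub_self n).symm ι)
      (0 : A.pretr.cocycles z (single a n 0 rfl) 0).1 = 0 := map_zero _
  have key' : cohMk hn (app (toHom (extMap (eltMap ι hι))) z (add_zero n) x) h₁ =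
      cohMk hn 0 (map_zero _) :=
    (congrArg (Quotient.mk _) (Subtype.ext h₀.symm)).trans
      (key.trans (congrArg (Quotient.mk _) (Subtype.ext h₂)))
  obtain ⟨y, hy⟩ := (cohMk_eq_iff hl hn _ _).1 key'
  exact ⟨y, hy.trans (sub_zero _)⟩

/-- A morphism from the extension of a module acyclic on the subcategory to the restriction of a
represented module is surjective on cohomology if the universal element is in the image. -/
theorem IsDGQuotient.exists_app_sub_exact (hξ : IsDGQuotient ξ B)
    {N : DGModule.{u, u, u, u} A} (hN : ∀ b ∈ B, N.ExactAt b) {y z : A.pretr.Obj} {n m r : ℤ}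
    (hr : n + r = 0) (hn : n + 1 = m)
    (ψ : (ext N).homs (restrict ξ.pretr (representable (ξ.pretr.obj y))) r)
    (hψ : homsD _ _ rfl ψ = 0) (ι : (ext N).X y n) (hι : (ext N).d hn ι = 0)
    (hι' : app ψ y hr ι = C.pretr.one (ξ.pretr.obj y))
    (g : (restrict ξ.pretr (representable (ξ.pretr.obj y))).X z 0)
    (hg : (restrict ξ.pretr (representable (ξ.pretr.obj y))).d (zero_add 1) g = 0) :
    ∃ (x : (ext N).X z n) (β : (restrict ξ.pretr (representable (ξ.pretr.obj y))).X z (-1)),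
      (ext N).d hn x = 0 ∧
        (restrict ξ.pretr (representable (ξ.pretr.obj y))).d (neg_add_cancel 1) β =
          app ψ z hr x - g := by
  have := hξ.isLocalization
  let g' : C.pretr.cocycles (ξ.pretr.obj z) (ξ.pretr.obj y) 0 :=
    ⟨g, (mem_cocycles (zero_add 1)).2 hg⟩
  obtain ⟨x, hx⟩ := Localization.surjective_of_id ξ.pretr.ho (A.quotientMorphisms B)
    (inverts_coh_ext hN n) (Y := Ho.mk y) (cohDesc ξ.pretr hr ψ hψ)
    (cohMk hn ι hι) (congrArg cls (Subtype.ext hι')) (Ho.mk z)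
    (homMk g')
  obtain ⟨x, hx', rfl⟩ := cohMk_surjective hn x
  have hx'' := d_app_eq_zero hr (by omega) hn (zero_add 1) hψ x hx'
  obtain ⟨β, hβ⟩ := (homMk_eq_iff ⟨_, (mem_cocycles (zero_add 1)).2 hx''⟩ g').1 hx
  exact ⟨x, β, hx', hβ⟩

/-- If `ξ` is a DG quotient, a morphism from a module acyclic on the subcategory to the restriction
of a represented module is surjective on cohomology if the universal element is in the image. -/
theorem IsDGQuotient.exists_extMap_sub_exact (hξ : IsDGQuotient ξ B)
    {N : DGModule.{u, u, u, u} A} (hN : ∀ b ∈ B, N.ExactAt b) {a : A.Obj} (ι : N.X a 0)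
    (hι : N.d (zero_add 1) ι = 0)
    (θ : (dgCat A).cocycles N (restrict ξ (representable (ξ.obj a))) 0)
    (hθ : app (toHom θ) a (add_zero 0) ι = C.one (ξ.obj a))
    {z : A.pretr.Obj} {l n m : ℤ} (hl : l + 1 = n) (hn : n + 1 = m)
    (y : (ext (restrict ξ (representable (ξ.obj a)))).X z n)
    (hy : (ext (restrict ξ (representable (ξ.obj a)))).d hn y = 0) :
    ∃ x v, (ext N).d hn x = 0 ∧ app (toHom (extMap θ)) z (add_zero n) x - y =
      (ext (restrict ξ (representable (ξ.obj a)))).d hl v := by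
  have hψ : homsD _ _ rfl (homsComp (add_zero (-n)) (singleRes ξ a n) (toHom (extMap θ))) = 0 :=
    homsD_homsComp_eq_zero (add_zero (-n)) rfl rfl (zero_add 1) (homsD_singleRes ξ a n rfl)
      (homsD_toHom _ _)
  -- The universal element, moved to degree n at a[n], is sent to the identity of ξ(a)[n], so the
  -- criterion for maps to a represented presheaf applies.
  let ι' : (ext N).X (single a n 0 rfl) n := singleElt (hq := rfl) (sub_self n).symm ι
  have hι' : (ext N).d hn ι' = 0 := d_singleElt_eq_zero _ hn (zero_add 1) ι hι
  have hι'' : app (homsComp (add_zero (-n)) (singleRes ξ a n) (toHom (extMap θ)))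
      (single a n 0 rfl) (add_neg_cancel n) ι' = C.pretr.one (ξ.pretr.obj (single a n 0 rfl)) := by
    rw [homsComp_apply _ _ _ _ (add_zero n) (add_neg_cancel n), extMap_singleElt, hθ]
    exact singleRes_singleElt ξ a n
  have hg := d_app_eq_zero (r := -n) (add_neg_cancel n) (by omega) hn (zero_add 1)
    (homsD_singleRes ξ a n rfl) y hy
  obtain ⟨x, β, hx', hβ⟩ := hξ.exists_app_sub_exact hN (add_neg_cancel n) hn _ hψ ι' hι' hι'' _ hg
  rw [homsComp_apply _ _ _ _ (add_zero n) (add_neg_cancel n), ← map_sub] at hβ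
  obtain ⟨v, hv⟩ := exists_d_eq_of_app (homsD_singleRes ξ a n rfl) (by omega : l + -n = -1)
    (neg_add_cancel 1) hl (add_neg_cancel n) (fun _ _ => singleRes_injective ξ _)
    (singleRes_surjective ξ _) _ β hβ
  exact ⟨x, v, hx', hv.symm⟩

end

end DGCat

/-! ### Injectivity on cohomology by induction over the generators of the resolution -/

namespace DGCat

open DGModule

variable {k : Type u} [CommRing k]

theorem neg_sub_eq_zero_aux {G : Type*} [AddCommGroup G] {x y : G} {t s r : ℤˣ} (ht : t = -(s * r))
    (h : -(r • x) - s • y = 0) : t • x - Int.negOnePow 0 • y = 0 := by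
  have e : t • x - Int.negOnePow 0 • y = s • (-(r • x) - s • y) := by
    rw [ht, smul_sub, smul_neg, smul_smul, smul_smul, Int.units_mul_self, Int.negOnePow_zero,
      Units.neg_smul]
  rw [e, h, smul_zero]

namespace Cells

variable {A : DGCat.{u, u, u} k} (S : Cells A)

/-- All the generators occurring in an element of a semi-free module satisfy `Q`. -/
def SuppIn (Q : S.I → Prop) {a : A.Obj} {n : ℤ} (x : S.sem.X a n) : Prop :=
  ∀ i, ¬Q i → ∀ (p : ℤ) (h : S.deg i + p = n), S.coeff i h x = 0

variable {S}

theorem SuppIn.mono {Q Q' : S.I → Prop} (hQ : ∀ i, Q i → Q' i) {a : A.Obj} {n : ℤ}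
    {x : S.sem.X a n} (hx : S.SuppIn Q x) : S.SuppIn Q' x := fun i hi => hx i (mt (hQ i) hi)

theorem exists_eq_sum_gen_coeff {a : A.Obj} {n : ℤ} (x : S.sem.X a n) :
    ∃ T : Finset S.I, x = ∑ i ∈ T, S.gen i (by omega : S.deg i + (n - S.deg i) = n)
      (S.coeff i (by omega) x) := by
  classical
  exact ⟨(show Free S.obj S.deg a n from x).support,
    (DFinsupp.sum_single (f := (show Free S.obj S.deg a n from x))).symm⟩

theorem exists_suppIn {a : A.Obj} {n : ℤ} (x : S.sem.X a n) : ∃ T : Finset S.I, S.SuppIn (· ∈ T) x := by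
  classical
  refine ⟨(show Free S.obj S.deg a n from x).support, fun i hi p hp => ?_⟩
  obtain rfl : p = n - S.deg i := by omega
  exact DFinsupp.notMem_support_iff.1 hi

theorem eq_zero_of_suppIn {a : A.Obj} {n : ℤ} {x : S.sem.X a n} (h : S.SuppIn (fun _ => False) x) :
    x = 0 :=
  DFinsupp.ext fun i => h i id (n - S.deg i) (by omega)

theorem suppIn_d_e (i : S.I) {n : ℤ} (h : S.deg i + 1 = n) :
    S.SuppIn (fun j => S.rank j < S.rank i) (S.sem.d h (S.e i)) := by
  subst h
  rw [d_e]
  intro j hj p hp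
  obtain rfl : p = S.deg i + 1 - S.deg j := by omega
  exact not_not.1 (mt (S.rank_lt i j) hj)

/-- The differential of the leading coefficients. -/
theorem coeff_d {a : A.Obj} {n m p p' : ℤ} (h : n + 1 = m) {i : S.I} (hp : S.deg i + p = n)
    (hp' : p + 1 = p') (h' : S.deg i + p' = m) {x : S.sem.X a n}
    (hx : S.SuppIn (fun j => S.rank j ≤ S.rank i) x) :
    S.coeff i h' (S.sem.d h x) = (S.deg i).negOnePow • A.d hp' (S.coeff i hp x) := by
  obtain ⟨T, hT⟩ := exists_eq_sum_gen_coeff x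
  rw [hT]
  simp only [map_sum, Finset.smul_sum]
  refine Finset.sum_congr rfl fun j _ => ?_
  have hgen : ∀ y : A.Hom a (S.obj j) (n - S.deg j), S.sem.d h (S.gen j (by omega) y) =
      S.sem.act (by omega : S.deg j + 1 + (n - S.deg j) = m) (S.sem.d rfl (S.e j)) y +
        (S.deg j).negOnePow • S.gen j (by omega) (A.d rfl y) := fun y => by
    rw [d_e]
    exact d_gen h _ _ rfl _ y
  rw [hgen, map_add, LinearMap.map_smul_of_tower,
    coeff_act _ (by omega : S.deg i + (S.deg j + 1 - S.deg i) = S.deg j + 1) _ (by omega)]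
  -- A generator j occurring in x has rank at most that of i, and its differential involves only
  -- strictly smaller ranks; so it cannot contribute to the i-th coefficient.
  have hδ : A.comp (by omega : S.deg j + 1 - S.deg i + (n - S.deg j) = p')
      (S.coeff i (by omega) (S.sem.d rfl (S.e j))) (S.coeff j (by omega : S.deg j + (n - S.deg j) = n) x) = 0 := by
    by_cases hj : S.rank j ≤ S.rank i
    · rw [suppIn_d_e j rfl i (not_lt.2 hj), map_zero, LinearMap.zero_apply]
    · rw [hx j hj, map_zero]
  rw [hδ, zero_add]
  by_cases hij : j = i
  · subst hij
    obtain rfl : p = n - S.deg j := by omega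
    subst hp'
    rw [coeff_gen_self, coeff_gen_self]
  · rw [coeff_gen_of_ne hij, coeff_gen_of_ne hij, map_zero, smul_zero, smul_zero]

end Cells

section Injectivity

variable {A C : DGCat.{u, u, u} k} {B : Set A.Obj} {S : Cells A} {a : A.Obj}
  {σ : (dgCat A).cocycles S.sem (representable a) 0} {z : A.pretr.Obj}

/-- All the generators occurring in the coordinates of an element of the extension of the cone of a
morphism from a semi-free module satisfy `Q`. -/
def ExtSuppIn (Q : S.I → Prop) {n : ℤ} (w : (ext (cone σ)).X z n) : Prop :=
  ∀ (j) (p : ℤ) (h : n - z.1.X.deg j + 1 = p), S.SuppIn Q (snd σ h (coord j w))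

theorem ExtSuppIn.mono {Q Q' : S.I → Prop} (hQ : ∀ i, Q i → Q' i) {n : ℤ}
    {w : (ext (cone σ)).X z n} (hw : ExtSuppIn Q w) : ExtSuppIn Q' w := fun j p h =>
  (hw j p h).mono hQ

theorem exists_extSuppIn {n : ℤ} (w : (ext (cone σ)).X z n) :
    ∃ T : Finset S.I, ExtSuppIn (· ∈ T) w := by
  choose T hT using fun j => Cells.exists_suppIn (snd σ rfl (coord j w))
  exact ⟨Finset.univ.biUnion T, fun j p h => by
    subst h
    exact (hT j).mono fun i hi => Finset.mem_biUnion.2 ⟨j, Finset.mem_univ _, hi⟩⟩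

/-- The coefficients of a generator, as a morphism of twisted complexes. -/
def coeffHom (i : S.I) {n s : ℤ} (hs : s + S.deg i = n + 1) (w : (ext (cone σ)).X z n) :
    A.pretr.Hom z (single (S.obj i) s 0 rfl) 0 :=
  fun _ j => S.coeff i (by change S.deg i + (0 + s - z.1.X.deg j) = n - z.1.X.deg j + 1; omega)
    (snd σ rfl (coord j w))

theorem entry_coeffHom (i : S.I) {n s p : ℤ} (hs : s + S.deg i = n + 1)
    (w : (ext (cone σ)).X z n) (j : Fin z.1.X.n) (h : n - z.1.X.deg j + 1 = p) :
    entry (coeffHom i hs w) j = S.coeff i (by omega) (snd σ h (coord j w)) := by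
  subst h
  rfl

/-- As i has the top rank among the generators occurring in w, the i-th coefficient of dw = 0
involves only the i-th coefficients of w. It says that these form a closed morphism z → b[s] of
twisted complexes. -/
theorem coeffHom_mem (i : S.I) {n m s : ℤ} (hs : s + S.deg i = n + 1) (hm : n + 1 = m)
    (w : (ext (cone σ)).X z n) (hw : (ext (cone σ)).d hm w = 0)
    (hw' : ExtSuppIn (fun j => S.rank j ≤ S.rank i) w) :
    coeffHom i hs w ∈ A.pretr.cocycles z (single (S.obj i) s 0 rfl) 0 := by
  refine (mem_cocycles (zero_add 1)).2 (entry_ext fun j => (entry_d _ _ j).trans ?_)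
  have hj : S.deg i + (1 + s - z.1.X.deg j) = m - z.1.X.deg j + 1 := by omega
  have h₁ : S.coeff i hj (snd σ rfl (coord j ((ext (cone σ)).d hm w))) = 0 := by
    rw [hw, map_zero, map_zero, map_zero]
  have h₂ : S.coeff i hj (S.sem.d rfl (snd σ (by omega) (coord j w))) =
      (S.deg i).negOnePow • A.d (by omega) (entry (coeffHom i hs w) j) := by
    rw [Cells.coeff_d _ (by omega : S.deg i + (0 + s - z.1.X.deg j) = m - z.1.X.deg j) (by omega) _
      (hw' j _ _), entry_coeffHom]
  have h₃ : ∀ l, S.coeff i hj (S.sem.act (by omega) (snd σ rfl (coord l w)) (z.1.q l j)) =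
        A.comp (by omega) (entry (coeffHom i hs w) l) (z.1.q l j) := fun l => by
    rw [entry_coeffHom i hs w l rfl]
    exact Cells.coeff_act _ _ _ _ _ _
  rw [coord_d, map_sub, map_sub, snd_d _ rfl, map_neg, h₂, LinearMap.map_smul_of_tower,
    LinearMap.map_smul_of_tower, map_sum, map_sum,
    Finset.sum_congr rfl fun l _ => (congrArg (S.coeff i hj) (snd_act _ rfl rfl (by omega)
      (coord l w) (z.1.q l j))).trans (h₃ l)] at h₁
  exact neg_sub_eq_zero_aux (by
    obtain rfl : s = n + 1 - S.deg i := by omega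
    rw [Int.negOnePow_sub, Int.negOnePow_succ, neg_mul]) h₁

theorem coord_act_singleElt {M : DGModule.{u, u, u, u} A} {b : A.Obj} {s p p' r n' : ℤ}
    (h : p' = p - s) (h' : p + r = n') (x : M.X b p')
    (f : A.pretr.Hom z (single b s 0 rfl) r) (j : Fin z.1.X.n) :
    coord j ((ext M).act h' (singleElt (hq := rfl) h x) f) = M.act (by omega) x (entry f j) := by
  subst h
  refine (coord_act (z := single b s 0 rfl) _ _ _ j).trans ?_
  exact Fin.sum_univ_one _

theorem suppIn_snd_castDeg {Q : S.I → Prop} {b : A.Obj} {n n' p p' : ℤ} (e : n = n')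
    (h : n + 1 = p) (h' : n' + 1 = p') {x : (cone σ).X b n} (hx : S.SuppIn Q (snd σ h x)) :
    S.SuppIn Q (snd σ h' ((cone σ).castDeg e x)) := by
  subst e
  obtain rfl : p = p' := by omega
  exact hx

theorem suppIn_snd_d_inr {Q : S.I → Prop} (i : S.I) (hQ : ∀ j, S.rank j < S.rank i → Q j) (t : ℤˣ) :
    S.SuppIn Q (snd σ rfl (t • (cone σ).d (sub_add_cancel (S.deg i) 1)
      (inr σ (sub_add_cancel _ 1) (S.e i)))) := by
  intro j hj p hp
  have h := snd_d (φ := σ) (sub_add_cancel (S.deg i) 1) rfl (inr σ (sub_add_cancel _ 1) (S.e i))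
  rw [snd_inr] at h
  rw [LinearMap.map_smul_of_tower, h, LinearMap.map_smul_of_tower, map_neg,
    Cells.suppIn_d_e i rfl j (mt (hQ j) hj), neg_zero, smul_zero]

/-- A class in the cohomology of the extension of the cone killed by `θ` is zero, if only generators
satisfying `Q` occur. -/
def InjOnSupp {X : DGModule.{u, u, u, u} A} (θ : (dgCat A).cocycles (cone σ) X 0) (Q : S.I → Prop) :
    Prop :=
  ∀ (z : A.pretr.Obj) (l n m : ℤ) (hl : l + 1 = n) (hn : n + 1 = m) (w : (ext (cone σ)).X z n)
    (v : (ext X).X z l), (ext (cone σ)).d hn w = 0 →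
    (ext X).d hl v = app (toHom (extMap θ)) z (add_zero n) w → ExtSuppIn Q w →
    ∃ w', (ext (cone σ)).d hl w' = w

/-- The i-th coefficients of w form a closed f : z → y = b[s] with b = S.obj i. On the cone of f,
the pullback (0, w) is cohomologous to (± d e_i, w - e_i f): in w the generator i has been
cancelled, and d e_i involves only lower ranks. So the hypothesis applies at the cone of f, and (0,
w) is exact. By the long exact sequence, w is then of the form y'f up to a boundary with y' closed
at y, where the module is exact. -/
theorem InjOnSupp.insert {X : DGModule.{u, u, u, u} A} {θ : (dgCat A).cocycles (cone σ) X 0}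
    {Q : S.I → Prop} (h : InjOnSupp θ Q) (i : S.I) (hi : (cone σ).ExactAt (S.obj i))
    (hQ : ∀ j, S.rank j < S.rank i → Q j) (hQ' : ∀ j, Q j → S.rank j ≤ S.rank i) :
    InjOnSupp θ (fun j => Q j ∨ j = i) := by
  intro z l n m hl hn w v hw hv hsupp
  -- With this shift the coefficients of i become a morphism z → b[s] of degree 0.
  obtain ⟨s, hs⟩ : ∃ s, s + S.deg i = n + 1 := ⟨n + 1 - S.deg i, by omega⟩
  let y : A.pretr.Obj := single (S.obj i) s 0 rfl
  let f : A.pretr.cocycles z y 0 := ⟨coeffHom i hs w, coeffHom_mem i hs hn w hw (hsupp.mono (by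
    rintro j (hj | rfl)
    exacts [hQ' j hj, le_rfl]))⟩
  -- The i-th generator, in the shifted summand of the cone of σ, viewed as an element at y; acting
  -- on it by f gives the part of w involving i.
  let u₀ : (ext (cone σ)).X y n := singleElt (by omega : S.deg i - 1 = n - s)
    (inr σ (sub_add_cancel _ 1) (S.e i))
  obtain ⟨w₁, hw₁, hw₁'⟩ := exists_cpair f hn (0 : (ext (cone σ)).X y m) w
  obtain ⟨t₀, ht₀, ht₀'⟩ := exists_cpair f hl u₀ (0 : (ext (cone σ)).X z l)
  obtain ⟨v₁, hv₁, hv₁'⟩ := exists_cpair f hl (0 : (ext X).X y n) v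
  have hd₀ : csnd f hn ((ext (cone σ)).d hn t₀) = -(n.negOnePow • (ext (cone σ)).act (add_zero n) u₀ f.1) := by
    rw [csnd_d f hl hn, ht₀, ht₀', map_zero, zero_sub]
  have hd₀' : cfst f ((ext (cone σ)).d hn t₀) = (ext (cone σ)).d hn u₀ := by rw [cfst_d, ht₀]
  have hclosed : (ext (cone σ)).d rfl (w₁ + n.negOnePow • (ext (cone σ)).d hn t₀) = 0 := by
    rw [map_add, LinearMap.map_smul_of_tower, (ext (cone σ)).d_d, smul_zero, add_zero]
    refine cpair_ext f rfl ?_ ?_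
    · rw [cfst_d, hw₁, map_zero, map_zero]
    · rw [csnd_d f hn rfl, hw₁', hw, hw₁, map_zero, LinearMap.zero_apply, smul_zero, sub_zero,
        map_zero]
  -- Adding a boundary to (0, w) preserves exactness of the image under θ; the primitive is (0, v)
  -- corrected by the image of t₀.
  have hθ : (ext X).d hn (v₁ + n.negOnePow • app (toHom (extMap θ)) _ (add_zero n) t₀) =
      app (toHom (extMap θ)) _ (add_zero m) (w₁ + n.negOnePow • (ext (cone σ)).d hn t₀) := by
    rw [map_add, map_add, LinearMap.map_smul_of_tower, LinearMap.map_smul_of_tower, toHom_d]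
    refine congrArg (· + _) (cpair_ext f hn ?_ ?_)
    · rw [cfst_d, hv₁, cfst_extMap, hw₁, map_zero, map_zero]
    · rw [csnd_d f hl hn, hv₁, hv₁', hv, csnd_extMap f θ hn, hw₁', map_zero, LinearMap.zero_apply,
        smul_zero, sub_zero]
  -- The first component is ± d u₀, with generators of rank below that of i only; the second is w -
  -- u₀ f, from which i has disappeared.
  have hsupp' : ExtSuppIn Q (w₁ + n.negOnePow • (ext (cone σ)).d hn t₀) := by
    refine forall_coord_of_cpair f (M := cone σ)
      (fun a n x => ∀ (p : ℤ) (h : n + 1 = p), S.SuppIn Q (snd σ h x)) hn _ ?_ ?_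
    · intro j p hp
      have e : cfst f (w₁ + n.negOnePow • (ext (cone σ)).d hn t₀) =
          singleElt (hq := rfl) (by omega : S.deg i = m - s)
            (n.negOnePow • (cone σ).d (sub_add_cancel _ 1) (inr σ (sub_add_cancel _ 1) (S.e i))) := by
        rw [map_add, hw₁, zero_add, LinearMap.map_smul_of_tower, hd₀', LinearMap.map_smul_of_tower]
        exact congrArg (n.negOnePow • ·) (d_singleElt _ _ _ (sub_add_cancel _ 1) _)
      rw [e]
      exact suppIn_snd_castDeg _ rfl _ (suppIn_snd_d_inr i hQ _)
    · intro j p hp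
      have e : snd σ hp (coord j (csnd f hn (w₁ + n.negOnePow • (ext (cone σ)).d hn t₀))) =
          snd σ hp (coord j w) - S.gen i (by omega)
            (S.coeff i (by omega : S.deg i + (0 + s - z.1.X.deg j) = p) (snd σ hp (coord j w))) := by
        rw [map_add, hw₁', LinearMap.map_smul_of_tower, hd₀, smul_neg, smul_smul,
          Int.units_mul_self, one_smul, ← sub_eq_add_neg, map_sub, map_sub]
        refine congrArg _ ?_
        rw [coord_act_singleElt, snd_act _ (sub_add_cancel _ 1) hp (by omega), snd_inr,
          Cells.act_e]
        exact congrArg _ (entry_coeffHom i hs w j hp)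
      rw [e]
      intro j' hj' p' hp'
      rw [map_sub]
      by_cases hij : j' = i
      · subst hij
        obtain rfl : p' = 0 + s - z.1.X.deg j := by omega
        rw [Cells.coeff_gen_self, sub_self]
      · rw [Cells.coeff_gen_of_ne (Ne.symm hij), sub_zero]
        exact hsupp j p hp j' (by tauto) p' hp'
  obtain ⟨t, ht⟩ := h _ n m (m + 1) hn rfl _ _ hclosed hθ hsupp'
  have ht₁ : (ext (cone σ)).d hn (t - n.negOnePow • t₀) = w₁ := by
    rw [map_sub, LinearMap.map_smul_of_tower, ht, add_sub_cancel_right]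
  have h₁ := cfst_d f hn (t - n.negOnePow • t₀)
  have h₂ := csnd_d f hl hn (t - n.negOnePow • t₀)
  rw [ht₁, hw₁] at h₁
  rw [ht₁, hw₁'] at h₂
  -- The first component of the primitive of (0, w) is closed at y = b[s], hence equal to dx;
  -- replacing it by dx turns the second component into a primitive of w.
  obtain ⟨x, hx⟩ := (exactAt_ext (z := y) fun _ => hi) l n m hl hn _ h₁.symm
  refine ⟨csnd f hl (t - n.negOnePow • t₀) - n.negOnePow • (ext (cone σ)).act (add_zero l) x f.1, ?_⟩
  rw [map_sub, LinearMap.map_smul_of_tower, d_act_cocycle, hx, ← h₂]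

/-- There may be infinitely many generators of a given rank, but an element involves finitely many.
So the induction on the rank contains an induction over finite sets of generators of rank exactly r.
-/
theorem InjOnSupp.of_rank {X : DGModule.{u, u, u, u} A} {θ : (dgCat A).cocycles (cone σ) X 0}
    (h : InjOnSupp θ fun _ => False) (hZ : ∀ i, (cone σ).ExactAt (S.obj i)) (r : ℕ) :
    InjOnSupp θ (fun j => S.rank j < r) := by
  classical
  induction r with
  | zero =>
    intro z l n m hl hn w v hw hv hs
    exact h z l n m hl hn w v hw hv (hs.mono fun i hi => absurd hi (Nat.not_lt_zero _))
  | succ r ih =>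
    have key : ∀ T : Finset S.I, InjOnSupp θ fun j => S.rank j < r ∨ j ∈ T ∧ S.rank j = r := by
      intro T
      induction T using Finset.induction_on with
      | empty =>
        intro z l n m hl hn w v hw hv hs
        exact ih z l n m hl hn w v hw hv (hs.mono fun i hi => by simpa using hi)
      | insert i T _ ihT =>
        by_cases hi : S.rank i = r
        · have := ihT.insert i (hZ i) (fun j hj => Or.inl (hi ▸ hj)) (by
            rintro j (hj | ⟨_, hj⟩) <;> omega)
          exact fun z l n m hl hn w v hw hv hs => this z l n m hl hn w v hw hv
            (hs.mono fun j hj => by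
              rcases hj with hj | ⟨hj, hj'⟩
              · exact Or.inl (Or.inl hj)
              · rcases Finset.mem_insert.1 hj with rfl | hj
                · exact Or.inr rfl
                · exact Or.inl (Or.inr ⟨hj, hj'⟩))
        · exact fun z l n m hl hn w v hw hv hs => ihT z l n m hl hn w v hw hv
            (hs.mono fun j hj => by
              rcases hj with hj | ⟨hj, hj'⟩
              · exact Or.inl hj
              · rcases Finset.mem_insert.1 hj with rfl | hj
                · exact absurd hj' hi
                · exact Or.inr ⟨hj, hj'⟩)
    intro z l n m hl hn w v hw hv hs
    obtain ⟨T, hT⟩ := exists_extSuppIn w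
    refine key T z l n m hl hn w v hw hv fun j p hp i hi => ?_
    by_cases hiT : i ∈ T
    · exact hs j p hp i fun hi' => hi (by
        rcases Nat.lt_succ_iff_lt_or_eq.1 hi' with h | h
        · exact Or.inl h
        · exact Or.inr ⟨hiT, h⟩)
    · exact hT j p hp i hiT

theorem InjOnSupp.exact {X : DGModule.{u, u, u, u} A} {θ : (dgCat A).cocycles (cone σ) X 0}
    (h : InjOnSupp θ fun _ => False) (hZ : ∀ i, (cone σ).ExactAt (S.obj i)) {l n m : ℤ}
    (hl : l + 1 = n) (hn : n + 1 = m) (w : (ext (cone σ)).X z n) (v : (ext X).X z l)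
    (hw : (ext (cone σ)).d hn w = 0)
    (hv : (ext X).d hl v = app (toHom (extMap θ)) z (add_zero n) w) :
    ∃ w', (ext (cone σ)).d hl w' = w := by
  obtain ⟨T, hT⟩ := exists_extSuppIn w
  exact h.of_rank hZ (T.sup S.rank + 1) z l n m hl hn w v hw hv
    (hT.mono fun i hi => Nat.lt_succ_of_le (Finset.le_sup hi))

end Injectivity

end DGCat

namespace DGModule

section

variable {k : Type w} [CommRing k] {A : DGCat.{w, u, v} k} {M N : DGModule.{w, u, v, v} A}
  {a : A.Obj}

theorem app_toHom_app_eltMap (θ : (dgCat A).cocycles M N 0) {x : M.X a 0}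
    (hx : M.d (zero_add 1) x = 0) {y : N.X a 0} (hy : N.d (zero_add 1) y = 0)
    (h : app (toHom θ) a (add_zero 0) x = y) {b : A.Obj} {p : ℤ} (f : A.Hom b a p) :
    app (toHom θ) b (add_zero p) (app (toHom (eltMap x hx)) b (add_zero p) f) =
      app (toHom (eltMap y hy)) b (add_zero p) f := by
  rw [app_eltMap, app_eltMap, app_act (toHom θ) (add_zero 0) (add_zero p) (zero_add p)
    (zero_add p), h]

variable (σ : (dgCat A).cocycles M (representable a) 0)

theorem app_coneDesc_inl {L M N : DGModule.{w, u, v, u₁} A} (φ : (dgCat A).cocycles L M 0)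
    {n l : ℤ} (h : l + 1 = n) (g : M.homs N n) (s : L.homs N l) {b : A.Obj} {p q : ℤ}
    (hq : p + n = q) (y : M.X b p) : app (coneDesc φ h g s) b hq (inl φ y) = app g b hq y := by
  rw [app_coneDesc φ h g s hq rfl (by omega), fst_inl, snd_inl, map_zero, add_zero]

theorem d_inl_one : (cone σ).d (zero_add 1) (inl σ (A.one a)) = 0 :=
  (d_inl (φ := σ) (zero_add 1) (A.one a)).trans
    ((congrArg (inl σ) (A.d_one (zero_add 1))).trans (map_zero (inl σ)))

theorem app_eltMap_inl_one {b : A.Obj} {p : ℤ} (f : A.Hom b a p) :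
    app (toHom (eltMap (inl σ (A.one a)) (d_inl_one σ))) b (add_zero p) f = inl σ f :=
  (inl_act (φ := σ) (zero_add p) (A.one a) f).trans (congrArg (inl σ) (A.one_comp f))

end

end DGModule

/-! ### The module ξ^* h_{ξ a} as the cone of a relative resolution -/

namespace DGCat

open DGModule

variable {k : Type u} [CommRing k] {A C : DGCat.{u, u, u} k} {B : Set A.Obj} {ξ : DGFunctor A C}
  {a : A.Obj}

theorem extMap_extMap_eltMap {M N : DGModule.{u, u, u, u} A} (θ : (dgCat A).cocycles M N 0)
    {x : M.X a 0} (hx : M.d (zero_add 1) x = 0) {y : N.X a 0} (hy : N.d (zero_add 1) y = 0)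
    (h : app (toHom θ) a (add_zero 0) x = y) {z : A.pretr.Obj} {n : ℤ}
    (f : (ext (representable a)).X z n) :
    app (toHom (extMap θ)) z (add_zero n) (app (toHom (extMap (eltMap x hx))) z (add_zero n) f) =
      app (toHom (extMap (eltMap y hy))) z (add_zero n) f :=
  coord_ext fun j => app_toHom_app_eltMap θ hx hy h (coord (M := representable a) j f)

section

variable {M : DGModule.{u, u, u, u} A} (σ : (dgCat A).cocycles M (representable a) 0)

theorem coord_extMap_eltMap_inl_one {z : A.pretr.Obj} {n : ℤ} (f : (ext (representable a)).X z n)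
    (j : Fin z.1.X.n) :
    coord j (app (toHom (extMap (eltMap (inl σ (A.one a)) (d_inl_one σ)))) z (add_zero n) f) =
      inl σ (coord (M := representable a) j f) :=
  app_eltMap_inl_one σ (coord (M := representable a) j f)

theorem extMap_eltMap_inl_one_injective {z : A.pretr.Obj} {n : ℤ}
    (f : (ext (representable a)).X z n)
    (h : app (toHom (extMap (eltMap (inl σ (A.one a)) (d_inl_one σ)))) z (add_zero n) f = 0) :
    f = 0 :=
  coord_ext (M := representable a) fun j => by
    have e := congrArg (fun w => fst σ (coord j w)) h
    rw [coord_extMap_eltMap_inl_one] at e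
    exact e.trans ((congrArg (fst σ) (map_zero (coord j))).trans
      ((map_zero (fst σ)).trans (map_zero (coord (M := representable a) j)).symm))

theorem eq_extMap_eltMap_inl_one {z : A.pretr.Obj} {n : ℤ} (w : (ext (cone σ)).X z n)
    (h : ∀ j, snd σ rfl (coord j w) = 0) :
    w = app (toHom (extMap (eltMap (inl σ (A.one a)) (d_inl_one σ)))) z (add_zero n)
      (extMk (M := representable a) fun j => fst σ (coord j w)) :=
  coord_ext fun j => cone_ext (φ := σ) rfl
    ((fst_inl (φ := σ) (fst σ (coord j w))).symm.trans
      (congrArg (fst σ) (coord_extMap_eltMap_inl_one σ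
        (extMk (M := representable a) fun i => fst σ (coord i w)) j)).symm)
    ((h j).trans ((congrArg (snd σ rfl) (coord_extMap_eltMap_inl_one σ _ j)).trans
      (snd_inl rfl _)).symm)

end

variable {S : Cells A} {σ : (dgCat A).cocycles S.sem (representable a) 0}

/-- Start of the induction: without generators of S, the element is ι x with x in ext h_a, and θ
carries it to the image of x under the unit, so `IsDGQuotient.exact_of_unitMap_exact` concludes. -/
theorem IsDGQuotient.injOnSupp_empty (hξ : IsDGQuotient ξ B) (hσ : ∀ b ∈ B, (cone σ).ExactAt b)
    (θ : (dgCat A).cocycles (cone σ) (restrict ξ (representable (ξ.obj a))) 0)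
    (hθ : app (toHom θ) a (add_zero 0) (inl σ (A.one a)) = C.one (ξ.obj a)) :
    InjOnSupp θ fun _ => False := by
  intro z l n m hl hn w v hw hv hsupp
  have hw' := eq_extMap_eltMap_inl_one σ w fun j => Cells.eq_zero_of_suppIn (hsupp j _ rfl)
  generalize (extMk (M := representable a) fun j => fst σ (coord j w)) = x at hw'
  subst hw'
  have hx : (ext (representable a)).d hn x = 0 :=
    extMap_eltMap_inl_one_injective σ _ (by rw [← toHom_d, hw])
  rw [extMap_extMap_eltMap θ (d_inl_one σ) (C.d_one (zero_add 1)) hθ] at hv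
  exact hξ.exact_of_unitMap_exact hσ _ (d_inl_one σ) hl hn x hx v hv

/-- The results at all twisted complexes are specialized to a single summand b in degree 0. The
detour is essential: the inductive proof of injectivity replaces an object by cones. -/
theorem IsDGQuotient.qIsoAt (hξ : IsDGQuotient ξ B) (hσ : ∀ b ∈ B, (cone σ).ExactAt b)
    (hS : ∀ i, S.obj i ∈ B)
    (θ : (dgCat A).cocycles (cone σ) (restrict ξ (representable (ξ.obj a))) 0)
    (hθ : app (toHom θ) a (add_zero 0) (inl σ (A.one a)) = C.one (ξ.obj a)) (b : A.Obj) :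
    QIsoAt θ b where
  inj l n m hl hn x y hx hy := by
    obtain ⟨w', hw'⟩ := (hξ.injOnSupp_empty hσ θ hθ).exact (fun i => hσ _ (hS i)) hl hn
      (singleElt (c := b) (n := 0) (q := 0) (hq := rfl) (sub_zero n).symm x)
      (singleElt (c := b) (n := 0) (q := 0) (hq := rfl) (sub_zero l).symm y)
      (d_singleElt_eq_zero _ _ hn _ hx)
      (by rw [d_singleElt _ (sub_zero n).symm _ hl, hy, extMap_singleElt])
    obtain ⟨x', rfl⟩ := singleElt_surjective (sub_zero l).symm w'
    rw [d_singleElt _ (sub_zero n).symm _ hl] at hw'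
    exact ⟨x', singleElt_injective _ hw'⟩
  surj l n m hl hn y hy := by
    obtain ⟨x, v, hx, hv⟩ := hξ.exists_extMap_sub_exact hσ _ (d_inl_one σ) θ hθ hl hn
      (singleElt (c := b) (n := 0) (q := 0) (hq := rfl) (sub_zero n).symm y)
      (d_singleElt_eq_zero _ _ hn _ hy)
    obtain ⟨x, rfl⟩ := singleElt_surjective (sub_zero n).symm x
    obtain ⟨v, rfl⟩ := singleElt_surjective (sub_zero l).symm v
    rw [d_singleElt _ (sub_zero m).symm _ hn] at hx
    rw [d_singleElt _ (sub_zero n).symm _ hl, extMap_singleElt, ← map_sub] at hv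
    refine ⟨x, -v, singleElt_injective _ (hx.trans (map_zero _).symm), ?_⟩
    rw [map_neg, ← singleElt_injective _ hv]
    abel

/-- If `ξ` is a DG quotient, `ξ^* h_{ξ a}` is quasi-isomorphic to the cone of a relative resolution
of `h_a`. -/
theorem IsDGQuotient.exists_qIso (hξ : IsDGQuotient ξ B) (hσ : ∀ b ∈ B, QIsoAt σ b)
    (hS : ∀ i, S.obj i ∈ B) :
    ∃ θ : (dgCat A).cocycles (cone σ) (restrict ξ (representable (ξ.obj a))) 0,
      homsComp (add_zero 0) (toHom θ) (coneInl σ) = toHom (unitMap ξ a) ∧ ∀ b, QIsoAt θ b := by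
  -- Since ξ kills B, Hom(S, ξ^* h_{ξ a}) is exact; so the unit composed with σ has a null-homotopy
  -- s, and the unit with s is a closed morphism θ from the cone.
  have horth : Orth S.sem (restrict ξ (representable (ξ.obj a))) :=
    Cells.orth_sem fun i => hξ.exactAt_restrict _ (hS i)
  obtain ⟨s, hs⟩ := horth (-1) 0 1 (neg_add_cancel 1) (zero_add 1)
    (homsComp (add_zero 0) (toHom (unitMap ξ a)) (toHom σ))
    (homsD_homsComp_eq_zero _ _ (zero_add 1) (zero_add 1) (homsD_toHom _ _) (homsD_toHom _ _))
  have h : homsD _ _ (zero_add 1) (coneDesc σ (neg_add_cancel 1) (toHom (unitMap ξ a)) s) = 0 := by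
    rw [homsD_coneDesc, homsD_toHom, hs, Int.negOnePow_zero, one_smul, sub_self, coneDesc_zero]
  have happ : ∀ {b : A.Obj} {p : ℤ} (f : (representable a).X b p),
      app (toHom (ofHom _ h)) b (add_zero p) (inl σ f) =
        app (toHom (unitMap ξ a)) b (add_zero p) f := fun {b p} f => by
    rw [toHom_ofHom, app_coneDesc_inl]
  refine ⟨ofHom _ h, homs_ext fun b p q hq f => ?_, hξ.qIsoAt (fun b hb =>
    (exactAt_cone_iff σ b).2 (hσ b hb)) hS _ ((happ _).trans
      ((app_unitMap ξ _).trans (ξ.map_one a)))⟩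
  obtain rfl : p = q := by omega
  rw [homsComp_apply (add_zero 0) _ _ hq (add_zero p) hq, app_coneInl]
  exact happ f

end DGCat

/-! ### Full faithfulness -/

namespace DGCat

open DGModule

section

variable {k : Type w} [CommRing k] {C : DGCat.{w, u, v} k} {c₀ c c' : C.Obj}

/-- A closed morphism is exact if its composite with a morphism having a right homotopy inverse
is exact. -/
theorem exists_d_eq_of_comp {γ : C.cocycles c₀ c 0} {γ' : C.cocycles c c₀ 0} {β : C.Hom c c (-1)}
    (hβ : C.d (neg_add_cancel 1) β = C.comp (zero_add 0) γ.1 γ'.1 - C.one c) {l n n' m : ℤ}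
    (hl : l + 1 = n) (hn : n + 1 = m) (hn' : n + 0 = n') (hl' : l + 1 = n') {f : C.Hom c c' n}
    (hf : C.d hn f = 0) (z : C.Hom c₀ c' l) (hz : C.d hl' z = C.comp hn' f γ.1) :
    ∃ y, C.d hl y = f := by
  obtain rfl : n' = n := by omega
  refine ⟨C.comp (add_zero l) z γ'.1 - n'.negOnePow • C.comp (by omega) f β, ?_⟩
  have h₁ := C.leibniz (add_zero l) hl hl (zero_add 1) (add_zero n') hl z γ'.1
  have h₂ := C.leibniz (by omega : n' + -1 = l) hl hn (neg_add_cancel 1) (by omega) (add_zero n') f β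
  rw [(mem_cocycles (zero_add 1)).1 γ'.2, map_zero, smul_zero, add_zero, hz,
    C.assoc hn' (add_zero n') (zero_add 0) (add_zero n')] at h₁
  rw [hf, hβ, map_zero, LinearMap.zero_apply, zero_add, map_sub, C.comp_one] at h₂
  rw [map_sub, h₁, LinearMap.map_smul_of_tower, h₂, smul_smul, Int.units_mul_self, one_smul,
    sub_sub_cancel]

/-- A closed morphism factors up to homotopy through a morphism having a left homotopy inverse. -/
theorem exists_comp_sub_eq {γ : C.cocycles c₀ c 0} {γ' : C.cocycles c c₀ 0} {β : C.Hom c₀ c₀ (-1)}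
    (hβ : C.d (neg_add_cancel 1) β = C.comp (zero_add 0) γ'.1 γ.1 - C.one c₀) {l n n' m m' : ℤ}
    (hn : n + 1 = m) (hn' : n + 0 = n') (hm' : n' + 1 = m') (hl' : l + 1 = n') (x : C.Hom c₀ c' n')
    (hx : C.d hm' x = 0) :
    ∃ (f : C.Hom c c' n) (z : C.Hom c₀ c' l), C.d hn f = 0 ∧
      C.d hl' z = C.comp hn' f γ.1 - x := by
  obtain rfl : n' = n := by omega
  obtain rfl : m' = m := by omega
  refine ⟨C.comp hn' x γ'.1, n'.negOnePow • C.comp (by omega) x β, ?_, ?_⟩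
  · rw [C.leibniz hn' hn hn (zero_add 1) (add_zero m') hn, hx,
      (mem_cocycles (zero_add 1)).1 γ'.2, map_zero, map_zero, LinearMap.zero_apply, smul_zero,
      add_zero]
  · have h₂ := C.leibniz (by omega : n' + -1 = l) hl' hn (neg_add_cancel 1) (by omega)
      (add_zero n') x β
    rw [hx, hβ, map_zero, LinearMap.zero_apply, zero_add, map_sub, C.comp_one] at h₂
    rw [LinearMap.map_smul_of_tower, h₂, smul_smul, Int.units_mul_self, one_smul,
      C.assoc hn' hn' (zero_add 0) hn']

end

section

variable {k : Type u} [CommRing k] {A C : DGCat.{u, u, u} k} {B : Set A.Obj}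
  {L M N X : DGModule.{u, u, u, u} A} {a : A.Obj}

theorem _root_.DGModule.HProj.dmap_surjective (hP : HProj N) (g : toDerived A N ⟶ toDerived A X) :
    ∃ φ, dmap φ = g := by
  obtain ⟨f, rfl⟩ := (hP.bijective_Q_map X).2 g
  obtain ⟨φ, rfl⟩ := homMk_surjective f
  exact ⟨φ, rfl⟩

theorem _root_.DGModule.HProj.dmap_eq_iff (hP : HProj N) (φ ψ : (dgCat A).cocycles N X 0) :
    dmap φ = dmap ψ ↔
      ∃ β : N.homs X (-1), homsD _ _ (neg_add_cancel 1) β = toHom φ - toHom ψ :=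
  (hP.bijective_Q_map X).1.eq_iff.trans (homMk_eq_iff_homsD φ ψ)

theorem dmap_eltMap_surjective (g : toDerived A (representable a) ⟶ toDerived A X) :
    ∃ x hx, dmap (eltMap (M := X) (a := a) x hx) = g := by
  obtain ⟨φ, rfl⟩ := (hProj_representable a).dmap_surjective g
  refine ⟨app (toHom φ) a (add_zero 0) (A.one a), ?_, ?_⟩
  · exact (toHom_d φ (zero_add 1) (A.one a)).trans
      ((congrArg (app (toHom φ) a (add_zero 1)) (A.d_one (zero_add 1))).trans (map_zero _))
  · exact congrArg dmap (Subtype.ext (eltHom_app (toHom φ)))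

theorem dmap_eltMap_eq_iff {x y : X.X a 0} (hx : X.d (zero_add 1) x = 0)
    (hy : X.d (zero_add 1) y = 0) :
    dmap (eltMap x hx) = dmap (eltMap y hy) ↔ ∃ z, X.d (neg_add_cancel 1) z = x - y := by
  refine ((hProj_representable a).dmap_eq_iff _ _).trans ⟨?_, ?_⟩
  · rintro ⟨β, hβ⟩
    rw [← eltHom_app β, homsD_eltHom] at hβ
    exact ⟨_, eltHom_injective (hβ.trans (eltHom_sub x y).symm)⟩
  · rintro ⟨z, hz⟩
    exact ⟨eltHom z, by rw [homsD_eltHom, hz]; exact eltHom_sub x y⟩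

/-- The inclusion of the target of a morphism in its cone. -/
def coneIncl (φ : (dgCat A).cocycles L M 0) : (dgCat A).cocycles M (cone φ) 0 :=
  ofHom (coneInl φ) (homsD_coneInl φ)

/-- The kernel of restriction from the cone to M comes from H^{-1} Hom(L, X), which vanishes.
Homotopical projectivity of L and M, hence of the cone, allows computing with homotopy classes. -/
theorem dmap_coneIncl_comp_injective (φ : (dgCat A).cocycles L M 0) (hL : HProj L) (hM : HProj M)
    (h : Orth L X) :
    Function.Injective fun g : toDerived A (cone φ) ⟶ toDerived A X => dmap (coneIncl φ) ≫ g := by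
  intro g g' e
  obtain ⟨γ, rfl⟩ := (HProj.cone φ hL hM).dmap_surjective g
  obtain ⟨γ', rfl⟩ := (HProj.cone φ hL hM).dmap_surjective g'
  refine ((HProj.cone φ hL hM).dmap_eq_iff _ _).2 ?_
  obtain ⟨β, hβ⟩ := (hM.dmap_eq_iff (zcomp (A := dgCat A) (zero_add 0) γ (coneIncl φ))
    (zcomp (A := dgCat A) (zero_add 0) γ' (coneIncl φ))).1
    ((dmap_comp _ _).symm.trans (e.trans (dmap_comp _ _)))
  refine exact_of_exact_coneInl φ h (neg_add_cancel 1) (zero_add 1) _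
    (by rw [map_sub, homsD_toHom, homsD_toHom, sub_zero]) β ?_
  rw [hβ, map_sub, LinearMap.sub_apply]
  rfl

variable {ξ : DGFunctor A C}

theorem IsDGQuotient.exists_cone_iso (hξ : IsDGQuotient ξ B) {S : Cells A} (hS : ∀ i, S.obj i ∈ B)
    (σ : (dgCat A).cocycles S.sem (representable a) 0) (hσ : ∀ b ∈ B, QIsoAt σ b) :
    ∃ θ : (dgCat A).cocycles (cone σ) (restrict ξ (representable (ξ.obj a))) 0, IsIso (dmap θ) ∧
      dmap (coneIncl σ) ≫ dmap θ = dmap (unitMap ξ a) := by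
  obtain ⟨θ, hθ, hθ'⟩ := hξ.exists_qIso hσ hS
  exact ⟨θ, isIso_Q_map hθ', (dmap_comp _ _).trans (congrArg dmap (Subtype.ext hθ))⟩

/-- Through θ, the unit is the inclusion of h_a in the cone of σ : S → h_a, and Hom(S, X) is exact
because S is generated over B. -/
theorem IsDGQuotient.dmap_unitMap_comp_injective (hξ : IsDGQuotient ξ B) (a : A.Obj)
    (hX : ∀ b ∈ B, X.ExactAt b) :
    Function.Injective fun g : toDerived A (restrict ξ (representable (ξ.obj a))) ⟶
      toDerived A X => dmap (unitMap ξ a) ≫ g := by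
  obtain ⟨S, σ, hσ⟩ := exists_relative_resolution B (representable a)
  obtain ⟨θ, hθ, hθ'⟩ := hξ.exists_cone_iso (S := S.incl) (fun i => (S.obj i).2) σ hσ
  intro g g' e
  rw [← cancel_epi (dmap θ)]
  refine dmap_coneIncl_comp_injective σ S.incl.hProj_sem (hProj_representable a)
    (Cells.orth_sem fun i => hX _ (S.obj i).2) ?_
  simp only [← Category.assoc, hθ']
  exact e

/-- The morphism `ξ^* h_c → ξ^* h_c'[n]` given by a closed morphism of degree `n`. -/
def resMap (ξ : DGFunctor A C) {c c' : C.Obj} {n : ℤ} (f : C.cocycles c c' n) :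
    (dgCat A).cocycles (restrict ξ (representable c)) (restrict ξ ((representable c').shift n)) 0 :=
  (res ξ).zmap ⟨shiftHom (zero_add n) (yonedaMap c c' n f.1), shiftHom_mem ((yoneda C).zmap f).2⟩

theorem dmap_eltMap_comp_resMap (ξ : DGFunctor A C) {c c' : C.Obj} (γ : C.cocycles (ξ.obj a) c 0)
    (hγ : (restrict ξ (representable c)).d (zero_add 1) γ.1 = 0) {n : ℤ} (f : C.cocycles c c' n)
    (hf : (restrict ξ ((representable c').shift n)).d (a := a) (zero_add 1)
      (C.comp (by omega : n + 0 = 0 + n) f.1 γ.1) = 0) :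
    dmap (eltMap (M := restrict ξ (representable c)) γ.1 hγ) ≫ dmap (resMap ξ f) =
      dmap (eltMap (M := restrict ξ ((representable c').shift n)) (a := a)
        (C.comp (by omega : n + 0 = 0 + n) f.1 γ.1) hf) :=
  (dmap_comp _ _).trans <| congrArg dmap <| Subtype.ext <| homs_ext fun b p q hq g => by
    obtain rfl : p = q := by omega
    exact (app_toHom_zcomp _ _ g).trans (app_toHom_app_eltMap (resMap ξ f) hγ hf rfl g)

/-- The morphism `ξ^* h_c → ξ^* h_c'` given by a closed morphism of degree `0`. -/
def resYoneda (ξ : DGFunctor A C) {c c' : C.Obj} (γ : C.cocycles c c' 0) :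
    (dgCat A).cocycles (restrict ξ (representable c)) (restrict ξ (representable c')) 0 :=
  (res ξ).zmap ((yoneda C).zmap γ)

theorem isIso_dmap_resYoneda (ξ : DGFunctor A C) {c c' : C.Obj} (γ : C.cocycles c c' 0)
    (h : IsIso (homMk γ)) : IsIso (dmap (resYoneda ξ γ)) :=
  inferInstanceAs (IsIso (((yoneda C).ho ⋙ (res ξ).ho ⋙ (acyclicCone A).Q).map (homMk γ)))

theorem dmap_unitMap_comp_resYoneda (ξ : DGFunctor A C) {c : C.Obj} (γ : C.cocycles (ξ.obj a) c 0)
    (hγ : (restrict ξ (representable c)).d (zero_add 1) γ.1 = 0) :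
    dmap (unitMap ξ a) ≫ dmap (resYoneda ξ γ) =
      dmap (eltMap (M := restrict ξ (representable c)) γ.1 hγ) :=
  (dmap_comp _ _).trans <| congrArg dmap <| Subtype.ext <| homs_ext fun b p q hq g => by
    obtain rfl : p = q := by omega
    exact (app_toHom_zcomp _ _ g).trans (app_toHom_app_eltMap _ _ hγ (C.comp_one γ.1) g)

theorem d_restrict_shift_eq_zero (ξ : DGFunctor A C) {c : C.Obj} {n m : ℤ} (h : 0 + n + 1 = m)
    (x : C.Hom (ξ.obj a) c (0 + n)) : (restrict ξ ((representable c).shift n)).d (a := a)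
      (zero_add 1) x = 0 ↔ C.d h x = 0 := by
  obtain rfl : m = 1 + n := by omega
  exact smul_eq_zero_iff_eq n.negOnePow

theorem exists_units_smul_eq_iff {P Q : Type*} [AddCommGroup P] [AddCommGroup Q] [Module k P]
    [Module k Q] (f : P →ₗ[k] Q) (t : ℤˣ) (x : Q) : (∃ z, t • f z = x) ↔ ∃ z, f z = x :=
  ⟨fun ⟨z, hz⟩ => ⟨t • z, by rw [LinearMap.map_smul_of_tower, hz]⟩, fun ⟨z, hz⟩ => ⟨t • z, by
    rw [LinearMap.map_smul_of_tower, hz, smul_smul, Int.units_mul_self, one_smul]⟩⟩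

theorem exists_d_restrict_shift_iff (ξ : DGFunctor A C) {c : C.Obj} {n : ℤ}
    (x : C.Hom (ξ.obj a) c (0 + n)) :
    (∃ z, (restrict ξ ((representable c).shift n)).d (a := a) (neg_add_cancel 1) z = x) ↔
      ∃ z : C.Hom (ξ.obj a) c (-1 + n), C.d (by omega) z = x :=
  exists_units_smul_eq_iff (C.d (by omega)) n.negOnePow x

/-- If `ξ` is a DG quotient, the graded homotopy category of the quotient embeds fully faithfully in
the derived category of `A`. -/
theorem IsDGQuotient.bijective_resExt (hξ : IsDGQuotient ξ B) (c c' : C.Obj) (n : ℤ) :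
    Function.Bijective fun f : C.H c c' n => resExt ξ _ _ n (gradedToDerived c c' n f) := by
  have := hξ.essSurj
  let a := (ξ.ho.objPreimage ⟨c⟩).as
  let e : (Ho.mk (ξ.obj a) : Ho C) ≅ Ho.mk c := ξ.ho.objObjPreimageIso ⟨c⟩
  obtain ⟨γ, hγ⟩ := homMk_surjective e.hom
  obtain ⟨γ', hγ'⟩ := homMk_surjective e.inv
  obtain ⟨β, hβ⟩ := (homMk_eq_iff (zcomp (zero_add 0) γ γ') ⟨C.one c, one_mem_cocycles _⟩).1
    (by rw [← homMk_comp, hγ, hγ']; exact e.inv_hom_id)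
  obtain ⟨β', hβ'⟩ := (homMk_eq_iff (zcomp (zero_add 0) γ' γ)
    ⟨C.one (ξ.obj a), one_mem_cocycles _⟩).1
    (by rw [← homMk_comp, hγ, hγ']; exact e.hom_inv_id)
  have hγ₀ : (restrict ξ (representable c)).d (zero_add 1) γ.1 = 0 :=
    (mem_cocycles (zero_add 1)).1 γ.2
  have hiso : IsIso (dmap (resYoneda ξ γ)) :=
    isIso_dmap_resYoneda ξ γ (hγ ▸ inferInstanceAs (IsIso e.hom))
  -- It now suffices that f ↦ fγ is bijective from H^n Hom(c, c') to H^n Hom(ξ a, c'): this is the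
  -- map under study followed by an injection into Hom(h_a, ξ^* h_{c'}[n]), which the Yoneda lemma
  -- computes. Bijectivity of f ↦ fγ comes from the homotopy inverse γ'.
  have hinj : Function.Injective fun g : toDerived A (restrict ξ (representable c)) ⟶
      toDerived A (restrict ξ ((representable c').shift n)) =>
        dmap (eltMap (M := restrict ξ (representable c)) γ.1 hγ₀) ≫ g := by
    intro g g' h
    rw [← cancel_epi (dmap (resYoneda ξ γ))]
    refine hξ.dmap_unitMap_comp_injective a (fun b hb => hξ.exactAt_restrict _ hb) ?_
    simp only [← Category.assoc, dmap_unitMap_comp_resYoneda ξ γ hγ₀]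
    exact h
  have hcomp : ∀ f : C.cocycles c c' n, (restrict ξ ((representable c').shift n)).d (a := a)
      (zero_add 1) (C.comp (by omega : n + 0 = 0 + n) f.1 γ.1) = 0 := fun f =>
    (d_restrict_shift_eq_zero ξ rfl _).2 ((mem_cocycles rfl).1 (comp_mem_cocycles _ f.2 γ.2))
  constructor
  · intro f f' h
    obtain ⟨f, rfl⟩ := cls_surjective f
    obtain ⟨f', rfl⟩ := cls_surjective f'
    have h₁ : dmap (resMap ξ f) = dmap (resMap ξ f') := h
    have h₂ := congrArg (dmap (eltMap (M := restrict ξ (representable c)) γ.1 hγ₀) ≫ ·) h₁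
    simp only [dmap_eltMap_comp_resMap ξ γ hγ₀ _ (hcomp _)] at h₂
    obtain ⟨z, hz⟩ := (exists_d_restrict_shift_iff ξ (C.comp _ f.1 γ.1 - C.comp _ f'.1 γ.1)).1
      ((dmap_eltMap_eq_iff _ _).1 h₂)
    obtain ⟨y, hy⟩ := exists_d_eq_of_comp hβ (l := -1 + n) (n := n) (f := f.1 - f'.1) (by omega)
      rfl (by omega : n + 0 = 0 + n) (by omega)
      (by rw [map_sub, (mem_cocycles rfl).1 f.2, (mem_cocycles rfl).1 f'.2, sub_zero]) z
      (hz.trans (LinearMap.map_sub₂ _ _ _ _).symm)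
    exact (cls_eq_iff f f').2 ((mem_coboundaries (by omega)).2 ⟨y, hy⟩)
  · intro g
    obtain ⟨x, hx, hxg⟩ := dmap_eltMap_surjective
      (dmap (eltMap (M := restrict ξ (representable c)) γ.1 hγ₀) ≫ g)
    obtain ⟨f, z, hf, hz⟩ := exists_comp_sub_eq hβ' rfl (by omega : n + 0 = 0 + n) rfl
      (by omega : -1 + n + 1 = 0 + n) x ((d_restrict_shift_eq_zero ξ rfl x).1 hx)
    refine ⟨cls ⟨f, (mem_cocycles rfl).2 hf⟩, hinj ?_⟩
    refine (dmap_eltMap_comp_resMap ξ γ hγ₀ ⟨f, (mem_cocycles rfl).2 hf⟩ (hcomp _)).trans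
      (Eq.trans ?_ hxg)
    exact (dmap_eltMap_eq_iff _ _).2 
      ((exists_d_restrict_shift_iff ξ (C.comp _ f γ.1 - (show C.Hom (ξ.obj a) c' (0 + n) from x))).2
        ⟨z, hz⟩)

end

end DGCat

/-! ### Invariance of cones and the essential image -/

namespace DGModule

section

variable {k : Type w} [CommRing k] {A : DGCat.{w, u, v} k} {L M N P : DGModule.{w, u, v, u₁} A}
  {σ : (dgCat A).cocycles L P 0} {φ : (dgCat A).cocycles M N 0}

theorem eq_inl_of_snd_eq_zero {a : A.Obj} {p p' : ℤ} (h : p + 1 = p') {z : (cone φ).X a p}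
    (hz : snd φ h z = 0) : z = inl φ (fst φ z) :=
  cone_ext h (fst_inl _).symm (hz.trans (snd_inl h _).symm)

theorem inl_injective {a : A.Obj} {p : ℤ} : Function.Injective (inl φ (a := a) (p := p)) :=
  fun x y h => by rw [← fst_inl (φ := φ) x, h, fst_inl]

/-- The five lemma for a morphism of cones. -/
theorem qIsoAt_of_cone {α : (dgCat A).cocycles P N 0} {β : (dgCat A).cocycles L M 0}
    (ψ : (dgCat A).cocycles (cone σ) (cone φ) 0) {a : A.Obj}
    (hψ : ∀ {p : ℤ} (y : P.X a p), app (toHom ψ) a (add_zero p) (inl σ y) =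
      inl φ (app (toHom α) a (add_zero p) y))
    (hψ' : ∀ {p p' : ℤ} (h : p + 1 = p') (z : (cone σ).X a p),
      snd φ h (app (toHom ψ) a (add_zero p) z) = app (toHom β) a (add_zero p') (snd σ h z))
    (hα : QIsoAt α a) (hβ : QIsoAt β a) : QIsoAt ψ a where
  inj l n m hl hn z w hz hw := by
    have hx : L.d rfl (snd σ hn z) = 0 := by
      rw [← neg_eq_zero, ← snd_d hn rfl, hz, map_zero]
    have hβx : M.d hn (-snd φ hl w) = app (toHom β) a (add_zero m) (snd σ hn z) := by
      rw [map_neg, ← snd_d hl hn, hw, hψ']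
    -- The boundary of x - x' removes the second component of z, while the closed x' and v are
    -- chosen so that the second component of w can be removed as well. This leaves a problem for α.
    obtain ⟨x, hx'⟩ := hβ.inj n m _ hn rfl _ _ hx hβx
    obtain ⟨x', v, hx₀, hv⟩ := hβ.surj l n m hl hn (app (toHom β) a (add_zero n) x + snd φ hl w) (by
      rw [map_add, toHom_d, hx', ← hβx, map_neg, neg_add_cancel])
    have h₀ : (cone σ).d hn (z + (cone σ).d hl (inr σ hl (x - x'))) = 0 := by
      rw [map_add, hz, (cone σ).d_d, add_zero]
    have h₁ : snd σ hn (z + (cone σ).d hl (inr σ hl (x - x'))) = 0 := by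
      rw [map_add, snd_d hl hn, snd_inr, map_sub, hx', hx₀, sub_zero, add_neg_cancel]
    obtain ⟨i, hi⟩ : ∃ i, i + 1 = l := ⟨l - 1, by omega⟩
    have h₂ : snd φ hl (w + app (toHom ψ) a (add_zero l) (inr σ hl (x - x')) +
        (cone φ).d hi (inr φ hi v)) = 0 := by
      rw [map_add, map_add, hψ', snd_d hi hl, snd_inr, snd_inr, map_sub]
      have e := congrArg (fun t => t - app (toHom β) a (add_zero n) x' - M.d hl v) hv
      simp only [add_sub_cancel_left, sub_self] at e
      rw [e]
      abel
    have h₃ : (cone φ).d hl (w + app (toHom ψ) a (add_zero l) (inr σ hl (x - x')) +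
        (cone φ).d hi (inr φ hi v)) =
        app (toHom ψ) a (add_zero n) (z + (cone σ).d hl (inr σ hl (x - x'))) := by
      rw [map_add, map_add, (cone φ).d_d, add_zero, hw, toHom_d, ← map_add]
    rw [eq_inl_of_snd_eq_zero hl h₂, eq_inl_of_snd_eq_zero hn h₁, hψ, d_inl] at h₃
    rw [eq_inl_of_snd_eq_zero hn h₁, d_inl] at h₀
    obtain ⟨p, hp⟩ := hα.inj l n m hl hn _ _
      (inl_injective (h₀.trans (map_zero _).symm)) (inl_injective h₃)
    refine ⟨inl σ p - inr σ hl (x - x'), ?_⟩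
    rw [map_sub, d_inl, hp, ← eq_inl_of_snd_eq_zero hn h₁, add_sub_cancel_right]
  surj l n m hl hn w hw := by
    obtain ⟨x, v, hx, hv⟩ := hβ.surj n m _ hn rfl (snd φ hn w) (by
      rw [← neg_eq_zero, ← snd_d hn rfl, hw, map_zero])
    have h₁ : snd φ hn (w + (cone φ).d hl (inr φ hl v) -
        app (toHom ψ) a (add_zero n) (inr σ hn x)) = 0 := by
      rw [map_sub, map_add, hψ', snd_d hl hn, snd_inr, snd_inr, ← hv]
      abel
    obtain ⟨u, hu⟩ : ∃ u, w + (cone φ).d hl (inr φ hl v) -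
        app (toHom ψ) a (add_zero n) (inr σ hn x) = inl φ u := ⟨_, eq_inl_of_snd_eq_zero hn h₁⟩
    have h₂ := congrArg ((cone φ).d hn) hu
    rw [map_sub, map_add, hw, (cone φ).d_d, toHom_d, d_inr hn rfl, hx, map_zero, sub_zero, hψ,
      add_zero, zero_sub, d_inl, ← map_neg] at h₂
    have h₃ := inl_injective h₂
    -- u need not be closed: du = -α(σx). By injectivity of α, σx = dy, and then u + αy is closed.
    obtain ⟨y, hy⟩ := hα.inj n m _ hn rfl (app (toHom σ) a (add_zero m) x) (-u)
      (by rw [toHom_d, hx, map_zero]) (by rw [map_neg, ← h₃, neg_neg])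
    obtain ⟨y', v', hy', hv'⟩ := hα.surj l n m hl hn (u + app (toHom α) a (add_zero n) y)
      (by rw [map_add, toHom_d, hy, ← h₃, neg_add_cancel])
    refine ⟨inr σ hn x + inl σ (y' - y), inl φ v' - inr φ hl v, ?_, ?_⟩
    · rw [map_add, d_inr hn rfl, hx, map_zero, sub_zero, d_inl, map_sub, hy', hy, zero_sub, map_neg,
        add_neg_cancel]
    · have e : app (toHom α) a (add_zero n) (y' - y) + N.d hl v' = u := by
        rw [map_sub, sub_add_eq_add_sub, hv', add_sub_cancel_right]
      rw [map_add, hψ, map_sub ((cone φ).d hl), d_inl, ← add_sub_assoc, add_assoc _ (inl φ _), ← map_add, e, ← hu]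
      abel

theorem homsComp_coneInl (g : P.homs N 0) :
    homsComp (add_zero 0) (coneInl φ) g = coneLift φ (zero_add 1) g 0 :=
  homs_ext fun a p q hq x => by
    obtain rfl : p = q := by omega
    rw [app_coneLift φ _ _ _ hq rfl (by omega), app_zero, map_zero, add_zero,
      homsComp_apply (add_zero 0) (coneInl φ) _ hq hq hq, app_coneInl]

/-- A square commuting up to homotopy induces a morphism of cones. -/
theorem exists_coneMap {α : (dgCat A).cocycles P N 0} {β : (dgCat A).cocycles L M 0}
    {t : L.homs N (-1)} (ht : homsD _ _ (neg_add_cancel 1) t =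
      homsComp (add_zero 0) (toHom α) (toHom σ) - homsComp (add_zero 0) (toHom φ) (toHom β)) :
    ∃ ψ : (dgCat A).cocycles (cone σ) (cone φ) 0,
      (∀ {a : A.Obj} {p : ℤ} (y : P.X a p), app (toHom ψ) a (add_zero p) (inl σ y) =
        inl φ (app (toHom α) a (add_zero p) y)) ∧
      ∀ {a : A.Obj} {p p' : ℤ} (h : p + 1 = p') (z : (cone σ).X a p),
        snd φ h (app (toHom ψ) a (add_zero p) z) = app (toHom β) a (add_zero p') (snd σ h z) := by
  have h₀ : homsD _ _ (neg_add_cancel 1) (coneLift φ (neg_add_cancel 1) t (toHom β)) =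
      homsComp (add_zero 0) (homsComp (add_zero 0) (coneInl φ) (toHom α)) (toHom σ) := by
    rw [homsD_coneLift φ _ (zero_add 1), ht, homsD_toHom, neg_zero, sub_add_cancel,
      homsComp_assoc (add_zero 0) (add_zero 0) (add_zero 0) (add_zero 0), homsComp_coneInl]
  have h₁ : homsD _ _ (zero_add 1) (homsComp (add_zero 0) (coneInl φ) (toHom α)) = 0 :=
    homsD_homsComp_eq_zero (add_zero 0) (zero_add 1) (zero_add 1) (zero_add 1) (homsD_coneInl φ)
      (homsD_toHom α _)
  have h : homsD _ _ (zero_add 1) (coneDesc σ (neg_add_cancel 1)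
      (homsComp (add_zero 0) (coneInl φ) (toHom α))
      (coneLift φ (neg_add_cancel 1) t (toHom β))) = 0 := by
    rw [homsD_coneDesc, h₀, h₁, Int.negOnePow_zero, one_smul, sub_self, coneDesc_zero]
  refine ⟨ofHom _ h, fun {a p} y => ?_, fun {a p p'} hp z => ?_⟩
  · rw [toHom_ofHom, app_coneDesc_inl, homsComp_apply _ _ _ _ (add_zero p) (add_zero p),
      app_coneInl]
  · rw [toHom_ofHom, app_coneDesc σ _ _ _ _ hp (by omega), map_add,
      homsComp_apply _ _ _ _ (add_zero p) (add_zero p), app_coneInl, snd_inl, zero_add,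
      app_coneLift φ _ _ _ _ hp (add_zero p'), map_add, snd_inl, snd_inr, zero_add]

end

end DGModule

namespace DGCat

open DGModule

variable {k : Type u} [CommRing k] {A C : DGCat.{u, u, u} k} {B : Set A.Obj}

/-- A commutative square in the derived category whose vertical morphisms are isomorphisms induces
an isomorphism of cones. -/
theorem nonempty_cone_iso {L M N P : DGModule.{u, u, u, u} A} (hL : HProj L) (hP : HProj P)
    {σ : (dgCat A).cocycles L P 0} {φ : (dgCat A).cocycles M N 0}
    (e : toDerived A L ≅ toDerived A M) (e' : toDerived A P ≅ toDerived A N)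
    (h : e.hom ≫ dmap φ = dmap σ ≫ e'.hom) :
    Nonempty (toDerived A (cone σ) ≅ toDerived A (cone φ)) := by
  obtain ⟨β, hβ⟩ := hL.dmap_surjective e.hom
  obtain ⟨α, hα⟩ := hP.dmap_surjective e'.hom
  rw [← hβ, ← hα, dmap_comp, dmap_comp] at h
  -- Homotopical projectivity of L turns commutativity in the derived category into commutativity up
  -- to a homotopy t, which supplies the off-diagonal entry of the map of cones.
  obtain ⟨t, ht⟩ := (hL.dmap_eq_iff _ _).1 h.symm
  obtain ⟨ψ, hψ, hψ'⟩ := exists_coneMap ht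
  have hα' : IsIso (dmap α) := hα ▸ inferInstance
  have hβ' : IsIso (dmap β) := hβ ▸ inferInstance
  have : IsIso (dmap ψ) := isIso_Q_map fun a =>
    qIsoAt_of_cone ψ hψ hψ' (qIsoAt_of_isIso hα' a) (qIsoAt_of_isIso hβ' a)
  exact ⟨asIso (dmap ψ)⟩

/-- If `ξ` is a DG quotient, the modules `ξ^* h_c` are the cones of the counits of derived induction
and restriction at the represented modules. -/
theorem IsDGQuotient.essImage_iff {ξ : DGFunctor A C} (hξ : IsDGQuotient ξ B)
    {F : Derived (A.full B) ⥤ Derived A} (adj : F ⊣ resDerived (A.incl B)) (M : Derived A) :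
    (C.hoToDerived ⋙ resDerived ξ).essImage M ↔
      ∃ a : A.Obj, IsConeOf (adj.counit.app (A.hoToDerived.obj ⟨a⟩)) M := by
  have key : ∀ a : A.Obj, ∃ (S : Cells (A.full B))
      (σ : (dgCat A).cocycles S.incl.sem (representable a) 0)
      (e : F.obj ((resDerived (A.incl B)).obj (toDerived A (representable a))) ≅
        toDerived A S.incl.sem), e.hom ≫ dmap σ = adj.counit.app (toDerived A (representable a)) ∧
      Nonempty (toDerived A (cone σ) ≅ toDerived A (restrict ξ (representable (ξ.obj a)))) := by
    intro a
    obtain ⟨S, σ, hσ⟩ := exists_relative_resolution B (representable a)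
    obtain ⟨e, he⟩ := exists_iso_counit adj σ hσ
    obtain ⟨θ, hθ, -⟩ := hξ.exists_cone_iso (S := S.incl) (fun i => (S.obj i).2) σ hσ
    exact ⟨S, σ, e, he, ⟨asIso (dmap θ)⟩⟩
  constructor
  · rintro ⟨⟨c⟩, ⟨i⟩⟩
    have := hξ.essSurj
    obtain ⟨S, σ, e, he, ⟨j⟩⟩ := key (ξ.ho.objPreimage ⟨c⟩).as
    refine ⟨(ξ.ho.objPreimage ⟨c⟩).as, S.incl.sem, representable _, σ, e.symm, Iso.refl _, ?_, ⟨?_⟩⟩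
    · refine (Category.comp_id _).trans ?_
      exact (Iso.eq_inv_comp e).2 he
    · exact i.symm ≪≫ (C.hoToDerived ⋙ resDerived ξ).mapIso (ξ.ho.objObjPreimageIso ⟨c⟩).symm ≪≫
        j.symm
  · rintro ⟨a, M₁, N₁, φ, e₁, e₂, h, ⟨i⟩⟩
    obtain ⟨S, σ, e, he, ⟨j⟩⟩ := key a
    have h' : (e.symm ≪≫ e₁.symm).hom ≫ dmap φ = dmap σ ≫ e₂.symm.hom := by
      have h₁ : e₁.hom ≫ e.hom ≫ dmap σ = dmap φ ≫ e₂.hom := (congrArg (e₁.hom ≫ ·) he).trans h.symm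
      refine (Category.assoc _ _ _).trans ((Iso.inv_comp_eq e).2 ((Iso.inv_comp_eq e₁).2 ?_))
      exact ((Iso.eq_comp_inv e₂).2 h₁.symm).trans
        ((Category.assoc _ _ _).trans (congrArg (e₁.hom ≫ ·) (Category.assoc _ _ _)))
    -- `IsConeOf` allows any φ isomorphic to the counit, so its cone has to be compared with that of
    -- the relative resolution σ.
    obtain ⟨i'⟩ := nonempty_cone_iso S.incl.hProj_sem (hProj_representable a) (e.symm ≪≫ e₁.symm)
      e₂.symm h'
    exact ⟨⟨ξ.obj a⟩, ⟨j.symm ≪≫ i' ≪≫ i.symm⟩⟩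

end DGCat

theorem proposition1p5p1 {k : Type u} [CommRing k] (A C : DGCat.{u, u, u} k) (B : Set A.Obj)
    (ξ : DGFunctor A C) (hξ : DGCat.IsDGQuotient ξ B) :
    (∀ (c c' : C.Obj) (n : ℤ), Function.Bijective fun f : C.H c c' n =>
      DGCat.resExt ξ _ _ n (DGCat.gradedToDerived c c' n f)) ∧
    (DGCat.resDerived (A.incl B)).IsRightAdjoint ∧
    ∀ (LInd : DGCat.Derived (A.full B) ⥤ DGCat.Derived A)
      (adj : LInd ⊣ DGCat.resDerived (A.incl B)) (M : DGCat.Derived A),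
      (C.hoToDerived ⋙ DGCat.resDerived ξ).essImage M ↔
        ∃ a : A.Obj, DGCat.IsConeOf (adj.counit.app (A.hoToDerived.obj ⟨a⟩)) M := ⟨hξ.bijective_resExt, DGCat.isRightAdjoint_resDerived B,
    fun _ adj M => hξ.essImage_iff adj M⟩
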